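/- **Convolution 3SUM over quadratic universes.** Write $[m] = \{1,\dots,m\}$. All algorithms are deterministic word RAM algorithms: a fixed program that performs unit-cost arithmetic, bitwise, comparison and indirect memory operations on words of $\kappa(\lfloor\log_2 n\rfloor+1)$ bits, where $n\ge 1$ is the input size and $\kappa$ is a constant that may depend on the program. * *3SUM over $[U]$*: given a set $A\subseteq[U]$ of $n$ integers, listed in an arbitrary order, decide whether there are $a,b,c\in A$ (not necessarily distinct) with $a+b=c$. * *Convolution 3SUM over $[U]$*: given a vector $X\in[U]^n$, decide for each $k\in[n]$ whether there are $i,j\in[n]$ (not necessarily distinct) with $i+j=k$ and $X[i]+X[j]=X[k]$. * *Deterministic 3SUM hypothesis*: for every $\epsilon>0$ there is a constant $c$ such that no deterministic algorithm solves 3SUM over $[n^c]$ in time $O(n^{2-\epsilon})$. Assume the deterministic 3SUM hypothesis. Then for every $\epsilon>0$ there is no deterministic algorithm that solves Convolution 3SUM over $[n^2]$ in time $O(n^{2-\epsilon})$. -/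

import Mathlib

/-! The deterministic word RAM, its running time, and the problems 3SUM and Convolution 3SUM. -/

namespace WordRAM

/-- The binary arithmetic and bitwise operations on machine words. -/
inductive BinOp
  | add | sub | mul | div | mod | and | or | xor | shl | shr

/-- The result of an operation on natural numbers: subtraction is cut off at `0`, division
rounds down, `x / 0 = 0` and `x % 0 = x`, and the shifts multiply and divide by a power of two. -/
def BinOp.eval : BinOp → ℕ → ℕ → ℕ
  | .add, x, y => x + y
  | .sub, x, y => x - y
  | .mul, x, y => x * y
  | .div, x, y => x / y
  | .mod, x, y => x % y
  | .and, x, y => x &&& y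
  | .or, x, y => x ||| y
  | .xor, x, y => x ^^^ y
  | .shl, x, y => x * 2 ^ y
  | .shr, x, y => x / 2 ^ y

/-- Programs. Registers are named by fixed numbers in the program text (so a program uses only
finitely many); the memory is accessed indirectly, through addresses held in registers. -/
inductive Prog
  /-- do nothing -/
  | skip
  /-- `r_d := k` -/
  | const (d k : ℕ)
  /-- `r_d := r_a o r_b` -/
  | op (o : BinOp) (d a b : ℕ)
  /-- `r_d := mem[r_a]` -/
  | load (d a : ℕ)
  /-- `mem[r_a] := r_b` -/
  | store (a b : ℕ)
  /-- first `p`, then `q` -/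
  | seq (p q : Prog)
  /-- if `r_a < r_b` then `p` else `q` -/
  | ite (a b : ℕ) (p q : Prog)
  /-- while `r_a < r_b` do `p` -/
  | loop (a b : ℕ) (p : Prog)

/-- The contents of the registers and of the memory cells. -/
structure State where
  reg : ℕ → ℕ
  mem : ℕ → ℕ

/-- Write `v` to register `d`. -/
def State.setReg (s : State) (d v : ℕ) : State :=
  { s with reg := Function.update s.reg d v }

/-- Write `v` to memory cell `i`. -/
def State.setMem (s : State) (i v : ℕ) : State :=
  { s with mem := Function.update s.mem i v }

/-- `Exec w p s t s'`: on a machine with words of `w` bits, the program `p` started in state `s`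
halts in state `s'` after exactly `t` steps. Every elementary instruction and every evaluation of
a test of a conditional or of a loop is one step. Addresses and all values that are read from
memory or written have to be smaller than `2 ^ w`; an instruction that violates this has no
successor state, so that the run is aborted and does not count as halting. -/
inductive Exec (w : ℕ) : Prog → State → ℕ → State → Prop
  | skip (s : State) : Exec w .skip s 1 s
  | const (d k : ℕ) (s : State) (h : k < 2 ^ w) :
      Exec w (.const d k) s 1 (s.setReg d k)
  | op (o : BinOp) (d a b : ℕ) (s : State) (h : o.eval (s.reg a) (s.reg b) < 2 ^ w) :
      Exec w (.op o d a b) s 1 (s.setReg d (o.eval (s.reg a) (s.reg b)))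
  | load (d a : ℕ) (s : State) (ha : s.reg a < 2 ^ w) (hv : s.mem (s.reg a) < 2 ^ w) :
      Exec w (.load d a) s 1 (s.setReg d (s.mem (s.reg a)))
  | store (a b : ℕ) (s : State) (ha : s.reg a < 2 ^ w) (hv : s.reg b < 2 ^ w) :
      Exec w (.store a b) s 1 (s.setMem (s.reg a) (s.reg b))
  | seq {p q : Prog} {s s₁ s₂ : State} {t₁ t₂ : ℕ}
      (hp : Exec w p s t₁ s₁) (hq : Exec w q s₁ t₂ s₂) :
      Exec w (.seq p q) s (t₁ + t₂) s₂
  | ite_true {a b : ℕ} {p q : Prog} {s s₁ : State} {t : ℕ}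
      (h : s.reg a < s.reg b) (hp : Exec w p s t s₁) :
      Exec w (.ite a b p q) s (t + 1) s₁
  | ite_false {a b : ℕ} {p q : Prog} {s s₁ : State} {t : ℕ}
      (h : ¬ s.reg a < s.reg b) (hq : Exec w q s t s₁) :
      Exec w (.ite a b p q) s (t + 1) s₁
  | loop_done {a b : ℕ} {p : Prog} {s : State} (h : ¬ s.reg a < s.reg b) :
      Exec w (.loop a b p) s 1 s
  | loop_step {a b : ℕ} {p : Prog} {s s₁ s₂ : State} {t₁ t₂ : ℕ}
      (h : s.reg a < s.reg b) (hp : Exec w p s t₁ s₁) (hl : Exec w (.loop a b p) s₁ t₂ s₂) :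
      Exec w (.loop a b p) s (t₁ + t₂ + 1) s₂

/-- The machine is deterministic: the program and the initial state determine the number of
steps and the final state. -/
theorem Exec.deterministic {w : ℕ} {p : Prog} {s s₁ s₂ : State} {t₁ t₂ : ℕ}
    (h₁ : Exec w p s t₁ s₁) (h₂ : Exec w p s t₂ s₂) : t₁ = t₂ ∧ s₁ = s₂ := by
  induction h₁ generalizing t₂ s₂ with
  | skip | const | op | load | store => cases h₂; exact ⟨rfl, rfl⟩
  | seq _ _ ihp ihq =>
    cases h₂ with
    | seq hp hq =>
      obtain ⟨rfl, rfl⟩ := ihp hp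
      obtain ⟨rfl, rfl⟩ := ihq hq
      exact ⟨rfl, rfl⟩
  | ite_true h _ ih =>
    cases h₂ with
    | ite_true _ hp => obtain ⟨rfl, rfl⟩ := ih hp; exact ⟨rfl, rfl⟩
    | ite_false h' _ => exact absurd h h'
  | ite_false h _ ih =>
    cases h₂ with
    | ite_true h' _ => exact absurd h' h
    | ite_false _ hq => obtain ⟨rfl, rfl⟩ := ih hq; exact ⟨rfl, rfl⟩
  | loop_done h =>
    cases h₂ with
    | loop_done _ => exact ⟨rfl, rfl⟩
    | loop_step h' _ _ => exact absurd h' h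
  | loop_step h _ _ ihp ihl =>
    cases h₂ with
    | loop_done h' => exact absurd h h'
    | loop_step _ hp hl =>
      obtain ⟨rfl, rfl⟩ := ihp hp
      obtain ⟨rfl, rfl⟩ := ihl hl
      exact ⟨rfl, rfl⟩

/-- The initial state for an input `x 1, …, x n`: register `0` holds `n`, memory cell `i` holds
`x i` for `1 ≤ i ≤ n`, and everything else is `0`. -/
def input (n : ℕ) (x : ℕ → ℕ) : State where
  reg r := if r = 0 then n else 0
  mem i := if 1 ≤ i ∧ i ≤ n then x i else 0

/-- The word length `κ · (⌊log₂ n⌋ + 1)`, that is, `κ` times the number of bits of `n`. -/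
def wordLength (κ n : ℕ) : ℕ := κ * (Nat.log 2 n + 1)

end WordRAM

/-- 3SUM over the universe `[U n] = {1, …, U n}` can be solved in deterministic time `O(T n)`:
there is a single word RAM program, with words of `κ · (⌊log₂ n⌋ + 1)` bits for a constant `κ`,
that, given any set `A ⊆ [U n]` of `n ≥ 1` numbers, listed in any order, decides whether there are
`a, b, c ∈ A` with `a + b = c` (the answer is yes if register `0` is `1` in the end, and no
otherwise). -/
def ThreeSumSolvable (U : ℕ → ℕ) (T : ℕ → ℝ) : Prop :=
  ∃ (p : WordRAM.Prog) (κ : ℕ) (C : ℝ),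
    ∀ n : ℕ, 1 ≤ n → ∀ A : Finset ℕ, A ⊆ Finset.Icc 1 (U n) → A.card = n →
      ∀ x : ℕ → ℕ, Set.BijOn x (Set.Icc 1 n) (A : Set ℕ) →
        ∃ (t : ℕ) (s : WordRAM.State),
          WordRAM.Exec (WordRAM.wordLength κ n) p (WordRAM.input n x) t s ∧
          (t : ℝ) ≤ C * T n ∧
          (s.reg 0 = 1 ↔ ∃ a ∈ A, ∃ b ∈ A, ∃ c ∈ A, a + b = c)

/-- Convolution 3SUM over the universe `[U n] = {1, …, U n}` can be solved in deterministic time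
`O(T n)`: there is a single word RAM program, with words of `κ · (⌊log₂ n⌋ + 1)` bits for a
constant `κ`, that, given any vector `X ∈ [U n]^n` with `n ≥ 1`, decides for each `k ∈ [n]` whether
there are `i, j ∈ [n]` with `i + j = k` and `X[i] + X[j] = X[k]` (the answer for `k` is yes if
memory cell `k` holds `1` in the end, and no otherwise). -/
def ConvThreeSumSolvable (U : ℕ → ℕ) (T : ℕ → ℝ) : Prop :=
  ∃ (p : WordRAM.Prog) (κ : ℕ) (C : ℝ),
    ∀ n : ℕ, 1 ≤ n → ∀ X : ℕ → ℕ, (∀ i ∈ Set.Icc 1 n, X i ∈ Set.Icc 1 (U n)) →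
      ∃ (t : ℕ) (s : WordRAM.State),
        WordRAM.Exec (WordRAM.wordLength κ n) p (WordRAM.input n X) t s ∧
        (t : ℝ) ≤ C * T n ∧
        ∀ k ∈ Set.Icc 1 n, (s.mem k = 1 ↔
          ∃ i ∈ Set.Icc 1 n, ∃ j ∈ Set.Icc 1 n, i + j = k ∧ X i + X j = X k)

/-- The deterministic 3SUM hypothesis: for any `ε > 0` there is a constant `c` such that 3SUM over
`[n ^ c]` cannot be solved in deterministic time `O(n ^ (2 - ε))`. -/
def DeterministicThreeSumHypothesis : Prop :=
  ∀ ε : ℝ, 0 < ε → ∃ c : ℕ,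
    ¬ ThreeSumSolvable (fun n => n ^ c) (fun n => (n : ℝ) ^ (2 - ε))

/-! The contrapositive is proved: an `O(n ^ (2 - ε))` algorithm for Convolution 3SUM over `[n ^ 2]`
yields a number `g`, depending on `ε` only, such that 3SUM over `[n ^ c]` takes time `O(n ^ (2 - 1 /
g))` for every `c`. Take `J ≥ 16` with `J ε ≥ 16`, `g = 20 J`, `B = ⌊n ^ (1 / g)⌋` and `s = B ^ J`,
roughly `n ^ (1 / 20)`. All work has to fit into `O(n ^ 2 / B)`.

Random hashing is replaced by moduli that are found by search. A nonzero `z ≤ 2 n ^ c` has at most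
`D` divisors with `D ^ 3 = O(B)` (`Bounds.exists_divisor_bound`). So, for a finite family of nonzero
numbers of this size, the best `q` in `[y, 2y)` leaves at most a fraction `D / y` of those divisible
by `M` still divisible by `M q` (`mul_card_dvd_le`). Two such steps with `y = ⌊√n⌋` give `p = O(n)`
with `O(D ^ 2 n)` collisions of distinct elements modulo `p` (`off_step`). A third step gives `q` in
`[s ^ 2, 2 s ^ 2)` with few false triples, that is, `a + b ≡ c` modulo `p q` but `a + b ≠ c`
(`fal_step`). The triples modulo `p q` are counted for each candidate by Karatsuba's method
(`triCmd_spec`), which is well below quadratic.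

Elements in classes modulo `p` with more than `B ^ 2` members are rare (`heavy_mul_le`) and are
tested by brute force. The others are placed in buckets of at most `B ^ 2` elements. Residues modulo
`p` are cut into blocks of length `s`. For each pair of blocks, each choice of three ranks within
the buckets and each possible overflow modulo `p q`, there is a convolution instance of length `8 s`
with entries at most `23 q ≤ (8 s) ^ 2`: the position encodes the residue modulo `p` and the value
encodes the next digit modulo `q` (`exists_inst_iff`). There are about `B ^ 6 (n / s) ^ 2`
instances, and the oracle saves a factor `s ^ ε ≥ B ^ 16` on each. Every reported position is
checked in time `O(s)`. As long as no solution is found, the reported positions inject into the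
false triples modulo `p q` (`card_reported_le`, `sum_card_fiber_le`), so these checks are
affordable.

To run this on the word RAM, the reduction is written in a small language with four-index arrays
(`solveCmd_spec`), which is compiled with constant slow-down (`HExec.simulate`). The given
convolution program is executed inside one array row by shifting its addresses (`Exec.relocate`). -/

/-! ### A high-level language over registers and multi-dimensional arrays -/

namespace HL
open WordRAM

/-- Binary operations of the high-level language; `msub` is subtraction modulo `N`. -/
inductive Op
  | plus | sub | msub | mul | div | rem

/-- Values of binary operations; results that could be large are reduced modulo `N`. -/
def Op.eval (N : ℕ) : Op → ℕ → ℕ → ℕ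
  | .plus, x, y => (x + y) % N
  | .sub, x, y => x - y
  | .msub, x, y => (x + (N - y % N)) % N
  | .mul, x, y => (x * y) % N
  | .div, x, y => x / y
  | .rem, x, y => x % y

/-- Expressions over registers and array cells. -/
inductive Expr
  | const (k : ℕ)
  | var (x : ℕ)
  | bin (o : Op) (a b : Expr)
  | get (t : ℕ) (i j k : Expr)

instance : Add Expr := ⟨.bin .plus⟩
instance : Sub Expr := ⟨.bin .sub⟩
instance : Mul Expr := ⟨.bin .mul⟩
instance : Div Expr := ⟨.bin .div⟩
instance : Mod Expr := ⟨.bin .rem⟩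

/-- States of the high-level machine: registers, and arrays named by a tag with three indices. -/
structure St where
  reg : ℕ → ℕ
  arr : ℕ → ℕ → ℕ → ℕ → ℕ

namespace St

/-- Write a register. -/
def set (σ : St) (x v : ℕ) : St := { σ with reg := Function.update σ.reg x v }

/-- Write an array cell. -/
def put (σ : St) (t i j k v : ℕ) : St :=
  { σ with arr := fun t' i' j' k' =>
      if t' = t ∧ i' = i ∧ j' = j ∧ k' = k then v else σ.arr t' i' j' k' }

/-- Replace a whole row of an array. -/
def putRow (σ : St) (t i j : ℕ) (f : ℕ → ℕ) : St :=
  { σ with arr := fun t' i' j' k' =>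
      if t' = t ∧ i' = i ∧ j' = j then f k' else σ.arr t' i' j' k' }

@[simp] theorem set_reg (σ : St) (x v y : ℕ) :
    (σ.set x v).reg y = if y = x then v else σ.reg y := by
  simp [set, Function.update_apply]

@[simp] theorem set_arr (σ : St) (x v : ℕ) : (σ.set x v).arr = σ.arr := rfl

@[simp] theorem put_reg (σ : St) (t i j k v : ℕ) : (σ.put t i j k v).reg = σ.reg := rfl

@[simp] theorem put_arr (σ : St) (t i j k v t' i' j' k' : ℕ) :
    (σ.put t i j k v).arr t' i' j' k' =
      if t' = t ∧ i' = i ∧ j' = j ∧ k' = k then v else σ.arr t' i' j' k' := rfl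

@[simp] theorem putRow_reg (σ : St) (t i j : ℕ) (f : ℕ → ℕ) :
    (σ.putRow t i j f).reg = σ.reg := rfl

@[simp] theorem putRow_arr (σ : St) (t i j : ℕ) (f : ℕ → ℕ) (t' i' j' k' : ℕ) :
    (σ.putRow t i j f).arr t' i' j' k' =
      if t' = t ∧ i' = i ∧ j' = j then f k' else σ.arr t' i' j' k' := rfl

end St

/-- The value of an expression. -/
def Expr.eval (N : ℕ) (σ : St) : Expr → ℕ
  | .const k => k
  | .var x => σ.reg x
  | .bin o a b => o.eval N (a.eval N σ) (b.eval N σ)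
  | .get t i j k => σ.arr t (i.eval N σ) (j.eval N σ) (k.eval N σ)

section eval
variable (N : ℕ) (σ : St) (a b : Expr)
@[simp] theorem eval_const (k : ℕ) : (Expr.const k).eval N σ = k := rfl
@[simp] theorem eval_var (x : ℕ) : (Expr.var x).eval N σ = σ.reg x := rfl
@[simp] theorem eval_get (t : ℕ) (i j k : Expr) : (Expr.get t i j k).eval N σ =
    σ.arr t (i.eval N σ) (j.eval N σ) (k.eval N σ) := rfl
@[simp] theorem eval_plus : (a + b).eval N σ = (a.eval N σ + b.eval N σ) % N := rfl
@[simp] theorem eval_sub : (a - b).eval N σ = a.eval N σ - b.eval N σ := rfl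
@[simp] theorem eval_mul : (a * b).eval N σ = (a.eval N σ * b.eval N σ) % N := rfl
@[simp] theorem eval_div : (a / b).eval N σ = a.eval N σ / b.eval N σ := rfl
@[simp] theorem eval_rem : (a % b).eval N σ = a.eval N σ % b.eval N σ := rfl
@[simp] theorem eval_msub : (Expr.bin .msub a b).eval N σ =
    (a.eval N σ + (N - b.eval N σ % N)) % N := rfl
end eval

/-- The power `a ^ k` as an expression. -/
def Expr.pow (a : Expr) : ℕ → Expr
  | 0 => .const 1
  | k + 1 => Expr.pow a k * a

theorem eval_pow {N : ℕ} (hN : 1 < N) (σ : St) (a : Expr) (k : ℕ) :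
    (a.pow k).eval N σ = (a.eval N σ) ^ k % N := by
  induction k with
  | zero => simp [Expr.pow, Nat.mod_eq_of_lt hN]
  | succ k ih => simp [Expr.pow, ih, pow_succ, Nat.mul_mod]

/-- Commands. `ite a b c d` tests `a < b`; `loop x y c` repeats `c` while register `x` is less
than register `y`; `call m e` runs the oracle program on the input of size `m` stored in row `e`
of the oracle array. -/
inductive Cmd
  | skip
  | assign (x : ℕ) (e : Expr)
  | put (t : ℕ) (i j k v : Expr)
  | seq (c d : Cmd)
  | ite (a b : Expr) (c d : Cmd)
  | loop (x y : ℕ) (c : Cmd)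
  | call (m e : ℕ)

/-- The tag of the oracle array. -/
def orcTag : ℕ := 9

/-- Big-step semantics with step counts. -/
inductive HExec (N : ℕ) (pr : Prog) (κ : ℕ) : Cmd → St → ℕ → St → Prop
  | skip (σ : St) : HExec N pr κ .skip σ 1 σ
  | assign (x : ℕ) (e : Expr) (σ : St) : HExec N pr κ (.assign x e) σ 1 (σ.set x (e.eval N σ))
  | put (t : ℕ) (i j k v : Expr) (σ : St) : HExec N pr κ (.put t i j k v) σ 1
      (σ.put t (i.eval N σ) (j.eval N σ) (k.eval N σ) (v.eval N σ))
  | seq {c d : Cmd} {σ σ₁ σ₂ : St} {t₁ t₂ : ℕ} (hc : HExec N pr κ c σ t₁ σ₁)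
      (hd : HExec N pr κ d σ₁ t₂ σ₂) : HExec N pr κ (.seq c d) σ (t₁ + t₂) σ₂
  | ite_true {a b : Expr} {c d : Cmd} {σ σ₁ : St} {t : ℕ} (h : a.eval N σ < b.eval N σ)
      (hc : HExec N pr κ c σ t σ₁) : HExec N pr κ (.ite a b c d) σ (t + 1) σ₁
  | ite_false {a b : Expr} {c d : Cmd} {σ σ₁ : St} {t : ℕ} (h : ¬ a.eval N σ < b.eval N σ)
      (hd : HExec N pr κ d σ t σ₁) : HExec N pr κ (.ite a b c d) σ (t + 1) σ₁
  | loop_done {x y : ℕ} {c : Cmd} {σ : St} (h : ¬ σ.reg x < σ.reg y) :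
      HExec N pr κ (.loop x y c) σ 1 σ
  | loop_step {x y : ℕ} {c : Cmd} {σ σ₁ σ₂ : St} {t₁ t₂ : ℕ} (h : σ.reg x < σ.reg y)
      (hc : HExec N pr κ c σ t₁ σ₁) (hl : HExec N pr κ (.loop x y c) σ₁ t₂ σ₂) :
      HExec N pr κ (.loop x y c) σ (t₁ + t₂ + 1) σ₂
  | call {m e : ℕ} {σ : St} {t : ℕ} {s : State} (X : ℕ → ℕ)
      (hX : ∀ k < N, σ.arr orcTag 0 (σ.reg e) k = (input (σ.reg m) X).mem k)
      (hw : 2 ^ wordLength κ (σ.reg m) ≤ N)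
      (hex : Exec (wordLength κ (σ.reg m)) pr (input (σ.reg m) X) t s) :
      HExec N pr κ (.call m e) σ (t + 1) (σ.putRow orcTag 0 (σ.reg e) s.mem)

/-- The registers that a command may write. -/
def Cmd.writes : Cmd → List ℕ
  | .assign x _ => [x]
  | .seq c d => c.writes ++ d.writes
  | .ite _ _ c d => c.writes ++ d.writes
  | .loop _ _ c => c.writes
  | _ => []

/-- The arrays that a command may write. -/
def Cmd.tags : Cmd → List ℕ
  | .put t _ _ _ _ => [t]
  | .seq c d => c.tags ++ d.tags
  | .ite _ _ c d => c.tags ++ d.tags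
  | .loop _ _ c => c.tags
  | .call _ _ => [orcTag]
  | _ => []

/-- Two states agree outside the given registers and arrays. -/
structure Agree (rs ts : List ℕ) (σ σ' : St) : Prop where
  reg : ∀ z, z ∉ rs → σ'.reg z = σ.reg z
  arr : ∀ t, t ∉ ts → σ'.arr t = σ.arr t

theorem Agree.refl (rs ts : List ℕ) (σ : St) : Agree rs ts σ σ := ⟨fun _ _ => rfl, fun _ _ => rfl⟩

theorem Agree.trans {rs ts : List ℕ} {σ σ' σ'' : St} (h : Agree rs ts σ σ')
    (h' : Agree rs ts σ' σ'') : Agree rs ts σ σ'' :=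
  ⟨fun z hz => (h'.reg z hz).trans (h.reg z hz), fun t ht => (h'.arr t ht).trans (h.arr t ht)⟩

theorem Agree.mono {rs ts rs' ts' : List ℕ} {σ σ' : St} (h : Agree rs ts σ σ')
    (hr : rs ⊆ rs') (ht : ts ⊆ ts') : Agree rs' ts' σ σ' :=
  ⟨fun z hz => h.reg z fun h' => hz (hr h'), fun t h1 => h.arr t fun h' => h1 (ht h')⟩

/-- The frame property. It reduces every claim that a register or array is untouched to membership
in a list that is computed from the program text. -/
theorem HExec.agree {N : ℕ} {pr : Prog} {κ : ℕ} {c : Cmd} {σ σ' : St} {t : ℕ}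
    (h : HExec N pr κ c σ t σ') : Agree c.writes c.tags σ σ' := by
  induction h with
  | skip | loop_done => exact Agree.refl _ _ _
  | assign x e σ =>
    refine ⟨fun z hz => ?_, fun _ _ => rfl⟩
    have hzx : z ≠ x := by simpa [Cmd.writes] using hz
    simp [hzx]
  | put t i j k v σ =>
    refine ⟨fun _ _ => rfl, fun t' ht => ?_⟩
    have htt : t' ≠ t := by simpa [Cmd.tags] using ht
    funext i j k
    simp [htt]
  | seq _ _ ih₁ ih₂ =>
    exact (ih₁.mono (by simp [Cmd.writes]) (by simp [Cmd.tags])).trans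
      (ih₂.mono (by simp [Cmd.writes]) (by simp [Cmd.tags]))
  | ite_true _ _ ih | ite_false _ _ ih =>
    exact ih.mono (by simp [Cmd.writes]) (by simp [Cmd.tags])
  | loop_step _ _ _ ih₁ ih₂ => exact ih₁.trans ih₂
  | call X hX hw hex =>
    refine ⟨fun _ _ => rfl, fun t' ht => ?_⟩
    have htt : t' ≠ orcTag := by simpa [Cmd.tags] using ht
    funext i j k
    simp [htt]

/-- The command halts from `σ`, and `Q` holds of the number of steps and the final state. -/
def Runs (N : ℕ) (pr : Prog) (κ : ℕ) (c : Cmd) (σ : St) (Q : ℕ → St → Prop) : Prop :=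
  ∃ t σ', HExec N pr κ c σ t σ' ∧ Q t σ'

/-! ### Symbolic execution with step counts. -/

section rules
variable {N : ℕ} {pr : Prog} {κ : ℕ} {σ : St} {Q : ℕ → St → Prop}

theorem Runs.mono {c : Cmd} {Q' : ℕ → St → Prop} (h : Runs N pr κ c σ Q)
    (hQ : ∀ t σ', Agree c.writes c.tags σ σ' → Q t σ' → Q' t σ') : Runs N pr κ c σ Q' := by
  obtain ⟨t, σ', he, hq⟩ := h
  exact ⟨t, σ', he, hQ t σ' he.agree hq⟩

-- Together with the next equivalences this is a weakest-precondition calculus: `simp` executes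
-- straight-line code, and only loops and calls need an argument.
@[simp] theorem runs_skip : Runs N pr κ .skip σ Q ↔ Q 1 σ := by
  constructor
  · rintro ⟨t, σ', h, hq⟩; cases h; exact hq
  · exact fun h => ⟨_, _, .skip σ, h⟩

@[simp] theorem runs_assign {x : ℕ} {e : Expr} :
    Runs N pr κ (.assign x e) σ Q ↔ Q 1 (σ.set x (e.eval N σ)) := by
  constructor
  · rintro ⟨t, σ', h, hq⟩; cases h; exact hq
  · exact fun h => ⟨_, _, .assign x e σ, h⟩

@[simp] theorem runs_put {t : ℕ} {i j k v : Expr} :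
    Runs N pr κ (.put t i j k v) σ Q ↔
      Q 1 (σ.put t (i.eval N σ) (j.eval N σ) (k.eval N σ) (v.eval N σ)) := by
  constructor
  · rintro ⟨t, σ', h, hq⟩; cases h; exact hq
  · exact fun h => ⟨_, _, .put t i j k v σ, h⟩

@[simp] theorem runs_seq {c d : Cmd} :
    Runs N pr κ (.seq c d) σ Q ↔
      Runs N pr κ c σ (fun t σ' => Runs N pr κ d σ' (fun t' σ'' => Q (t + t') σ'')) := by
  constructor
  · rintro ⟨t, σ', h, hq⟩; cases h with
    | seq hc hd => exact ⟨_, _, hc, _, _, hd, hq⟩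
  · rintro ⟨_, _, hc, _, _, hd, hq⟩
    exact ⟨_, _, .seq hc hd, hq⟩

@[simp] theorem runs_ite {a b : Expr} {c d : Cmd} :
    Runs N pr κ (.ite a b c d) σ Q ↔
      if a.eval N σ < b.eval N σ then Runs N pr κ c σ (fun t σ' => Q (t + 1) σ')
      else Runs N pr κ d σ (fun t σ' => Q (t + 1) σ') := by
  constructor
  · rintro ⟨t, σ', h, hq⟩
    cases h with
    | ite_true h hc => rw [if_pos h]; exact ⟨_, _, hc, hq⟩
    | ite_false h hc => rw [if_neg h]; exact ⟨_, _, hc, hq⟩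
  · split_ifs with h
    · rintro ⟨_, _, hc, hq⟩; exact ⟨_, _, .ite_true h hc, hq⟩
    · rintro ⟨_, _, hc, hq⟩; exact ⟨_, _, .ite_false h hc, hq⟩

/-- For `x` from `0` to the value of register `y`, exclusive. -/
def Cmd.for (x y : ℕ) (c : Cmd) : Cmd :=
  .seq (.assign x (.const 0)) (.loop x y (.seq c (.assign x (.var x + .const 1))))

/-- The invariant speaks only of the time `t` spent in the bodies. Each round adds one step for the
test and one for the increment, and the last test adds one more; this is the term `2 * k + 1`. -/
theorem Runs.loop_of_invariant {x y : ℕ} {c : Cmd} (hx : x ∉ c.writes) (hy : y ∉ c.writes)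
    (hxy : x ≠ y) {k : ℕ} (hkN : k < N) {σ₀ : St} (hk : σ₀.reg y = k) (I : ℕ → ℕ → St → Prop)
    (hstep : ∀ i t σ', i < k → σ'.reg x = i → Agree (x :: c.writes) c.tags σ₀ σ' → I i t σ' →
      Runs N pr κ c σ' (fun t' σ'' => I (i + 1) (t + t') (σ''.set x (i + 1))))
    (hQ : ∀ t σ', σ'.reg x = k → Agree (x :: c.writes) c.tags σ₀ σ' → I k t σ' →
      Q (t + 2 * k + 1) σ') :
    ∀ d i t σ', i + d = k → σ'.reg x = i → Agree (x :: c.writes) c.tags σ₀ σ' → I i t σ' →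
      Runs N pr κ (.loop x y (.seq c (.assign x (.var x + .const 1)))) σ'
        (fun t' σ'' => Q (t + t' + 2 * i) σ'') := by
  intro d
  induction d with
  | zero =>
    intro i t σ' hi hxi ha hI
    obtain rfl : i = k := by omega
    have hyk : σ'.reg y = i := by rw [ha.reg y (by simp [hy, hxy.symm]), hk]
    refine ⟨_, _, .loop_done (by omega), ?_⟩
    have := hQ t σ' hxi ha hI
    show Q (t + 1 + 2 * i) σ'
    rwa [show t + 1 + 2 * i = t + 2 * i + 1 by omega]
  | succ d ih =>
    intro i t σ' hi hxi ha hI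
    have hyk : σ'.reg y = k := by rw [ha.reg y (by simp [hy, hxy.symm]), hk]
    obtain ⟨t₁, σ₁, he, h1⟩ := hstep i t σ' (by omega) hxi ha hI
    have hx1 : σ₁.reg x = i := by rw [he.agree.reg x hx, hxi]
    have hev : (Expr.var x + Expr.const 1).eval N σ₁ = i + 1 := by
      simp [hx1, Nat.mod_eq_of_lt (show i + 1 < N by omega)]
    have he' : HExec N pr κ (.seq c (.assign x (.var x + .const 1))) σ' (t₁ + 1)
        (σ₁.set x (i + 1)) := by
      have := HExec.seq he (.assign x (.var x + .const 1) σ₁)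
      rwa [hev] at this
    have ha' : Agree (x :: c.writes) c.tags σ₀ (σ₁.set x (i + 1)) := by
      refine ha.trans ((he.agree.mono (by simp) (by simp)).trans ⟨fun z hz => ?_, fun _ _ => rfl⟩)
      have : z ≠ x := fun h => hz (by simp [h])
      simp [this]
    obtain ⟨t₂, σ₂, hl, hq⟩ := ih (i + 1) (t + t₁) _ (by omega) (by simp) ha' h1
    refine ⟨_, _, .loop_step (by omega) he' hl, ?_⟩
    convert hq using 1
    ring

theorem Runs.for_of_invariant {x y : ℕ} {c : Cmd} (hx : x ∉ c.writes) (hy : y ∉ c.writes)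
    (hxy : x ≠ y) {k : ℕ} (hkN : k < N) (hk : σ.reg y = k) (I : ℕ → ℕ → St → Prop)
    (h0 : I 0 0 (σ.set x 0))
    (hstep : ∀ i t σ', i < k → σ'.reg x = i → Agree (x :: c.writes) c.tags σ σ' → I i t σ' →
      Runs N pr κ c σ' (fun t' σ'' => I (i + 1) (t + t') (σ''.set x (i + 1))))
    (hQ : ∀ t σ', σ'.reg x = k → Agree (x :: c.writes) c.tags σ σ' → I k t σ' →
      Q (t + 2 * k + 2) σ') :
    Runs N pr κ (Cmd.for x y c) σ Q := by
  rw [Cmd.for, runs_seq, runs_assign]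
  -- The shift of `Q` by one pays for the initial assignment of the counter.
  have := Runs.loop_of_invariant (Q := fun t σ => Q (t + 1) σ) hx hy hxy hkN hk I hstep hQ k 0 0
    (σ.set x 0) (by omega) (by simp)
    ⟨fun z hz => by simp [show z ≠ x from fun h => hz (by simp [h])], fun _ _ => rfl⟩ h0
  refine this.mono fun t σ' _ hq => ?_
  convert hq using 1
  ring

end rules

/-- The hypothesis covers the whole row, including cell `0` and the cells beyond the input: the
oracle expects memory that is zero outside its input. This is why each call gets a fresh row. -/
theorem Runs.call {N : ℕ} {pr : Prog} {κ : ℕ} {σ : St} {Q : ℕ → St → Prop} {m e : ℕ} {t : ℕ}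
    {s : State} (X : ℕ → ℕ)
    (hX : ∀ k < N, σ.arr orcTag 0 (σ.reg e) k = (input (σ.reg m) X).mem k)
    (hw : 2 ^ wordLength κ (σ.reg m) ≤ N)
    (hex : Exec (wordLength κ (σ.reg m)) pr (input (σ.reg m) X) t s)
    (hQ : Q (t + 1) (σ.putRow orcTag 0 (σ.reg e) s.mem)) : Runs N pr κ (.call m e) σ Q :=
  ⟨_, _, .call X hX hw hex, hQ⟩

end HL

/-! ### Machine-level reasoning and relocation of a program -/

namespace WordRAM

@[simp] theorem State.setReg_reg (s : State) (d v r : ℕ) :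
    (s.setReg d v).reg r = if r = d then v else s.reg r := by
  simp [State.setReg, Function.update_apply]

@[simp] theorem State.setReg_mem (s : State) (d v : ℕ) : (s.setReg d v).mem = s.mem := rfl

@[simp] theorem State.setMem_reg (s : State) (d v : ℕ) : (s.setMem d v).reg = s.reg := rfl

@[simp] theorem State.setMem_mem (s : State) (d v r : ℕ) :
    (s.setMem d v).mem r = if r = d then v else s.mem r := by
  simp [State.setMem, Function.update_apply]

/-- The program halts from `s` on `w`-bit words, and `Q` holds of the time and the final state. -/
def MRuns (w : ℕ) (p : Prog) (s : State) (Q : ℕ → State → Prop) : Prop :=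
  ∃ t s', Exec w p s t s' ∧ Q t s'

section rules
variable {w : ℕ} {s : State} {Q : ℕ → State → Prop}

theorem MRuns.mono {p : Prog} {Q' : ℕ → State → Prop} (h : MRuns w p s Q)
    (hQ : ∀ t s', Q t s' → Q' t s') : MRuns w p s Q' := by
  obtain ⟨t, s', he, hq⟩ := h
  exact ⟨t, s', he, hQ _ _ hq⟩

theorem MRuns.const {d k : ℕ} (h : k < 2 ^ w) (hQ : Q 1 (s.setReg d k)) :
    MRuns w (.const d k) s Q := ⟨_, _, .const d k s h, hQ⟩

theorem MRuns.op {o : BinOp} {d a b : ℕ} (h : o.eval (s.reg a) (s.reg b) < 2 ^ w)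
    (hQ : Q 1 (s.setReg d (o.eval (s.reg a) (s.reg b)))) :
    MRuns w (.op o d a b) s Q := ⟨_, _, .op o d a b s h, hQ⟩

theorem MRuns.load {d a : ℕ} (ha : s.reg a < 2 ^ w) (hv : s.mem (s.reg a) < 2 ^ w)
    (hQ : Q 1 (s.setReg d (s.mem (s.reg a)))) :
    MRuns w (.load d a) s Q := ⟨_, _, .load d a s ha hv, hQ⟩

theorem MRuns.store {a b : ℕ} (ha : s.reg a < 2 ^ w) (hv : s.reg b < 2 ^ w)
    (hQ : Q 1 (s.setMem (s.reg a) (s.reg b))) :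
    MRuns w (.store a b) s Q := ⟨_, _, .store a b s ha hv, hQ⟩

theorem MRuns.seq {p q : Prog}
    (h : MRuns w p s (fun t s' => MRuns w q s' (fun t' s'' => Q (t + t') s''))) :
    MRuns w (.seq p q) s Q := by
  obtain ⟨_, _, hp, _, _, hq, h⟩ := h
  exact ⟨_, _, .seq hp hq, h⟩

end rules

/-- All registers of the program are smaller than this number. -/
def Prog.regs : Prog → ℕ
  | .skip => 0
  | .const d _ => d + 1
  | .op _ d a b => d + a + b + 1
  | .load d a => d + a + 1
  | .store a b => a + b + 1
  | .seq p q => p.regs + q.regs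
  | .ite a b p q => a + b + 1 + p.regs + q.regs
  | .loop a b p => a + b + 1 + p.regs

/-- The program with all addresses shifted by the contents of register `rb`, using register `rt`
as scratch space. -/
def Prog.relocate (rb rt : ℕ) : Prog → Prog
  | .skip => .skip
  | .const d k => .const d k
  | .op o d a b => .op o d a b
  | .load d a => .seq (.op .add rt rb a) (.load d rt)
  | .store a b => .seq (.op .add rt rb a) (.store rt b)
  | .seq p q => .seq (p.relocate rb rt) (q.relocate rb rt)
  | .ite a b p q => .ite a b (p.relocate rb rt) (q.relocate rb rt)
  | .loop a b p => .loop a b (p.relocate rb rt)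

/-- The state `s₁` holds the state `s` in the registers below `R` and in the memory from `base`
on. -/
structure Holds (R len base : ℕ) (s s₁ : State) : Prop where
  reg : ∀ r < R, s₁.reg r = s.reg r
  mem : ∀ a < len, s₁.mem (base + a) = s.mem a

/-- A store to an address of `2 ^ w` or more aborts the run, so a guest with shorter words cannot
leave its part of the memory. -/
theorem Exec.mem_eq_of_le {w : ℕ} {p : Prog} {s s' : State} {t : ℕ} (h : Exec w p s t s') :
    ∀ a, 2 ^ w ≤ a → s'.mem a = s.mem a := by
  induction h with
  | skip | const | op | load | loop_done => exact fun _ _ => rfl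
  | store a b s ha hv =>
    intro x hx
    have : x ≠ s.reg a := by omega
    simp [this]
  | seq _ _ ih₁ ih₂ => exact fun a ha => (ih₂ a ha).trans (ih₁ a ha)
  | ite_true _ _ ih | ite_false _ _ ih => exact ih
  | loop_step _ _ _ ih₁ ih₂ => exact fun a ha => (ih₂ a ha).trans (ih₁ a ha)

theorem Exec.mem_lt {w N : ℕ} {p : Prog} {s s' : State} {t : ℕ} (h : Exec w p s t s')
    (hN : 2 ^ w ≤ N) (hs : ∀ a, s.mem a < N) : ∀ a, s'.mem a < N := by
  induction h with
  | skip | const | op | load | loop_done => exact hs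
  | store a b s ha hv =>
    intro x
    simp only [State.setMem_mem]
    split_ifs
    · omega
    · exact hs x
  | seq _ _ ih₁ ih₂ => exact ih₂ (ih₁ hs)
  | ite_true _ _ ih | ite_false _ _ ih => exact ih hs
  | loop_step _ _ _ ih₁ ih₂ => exact ih₂ (ih₁ hs)

/-- Lock-step simulation of a guest with `w`-bit words by a host with `w'`-bit words. A memory
access costs two steps instead of one because the base is added first. The base survives since the
guest uses only registers below `R`. -/
theorem Exec.relocate {w w' R base rb rt : ℕ} (hw : base + 2 ^ w ≤ 2 ^ w') (hb : R ≤ rb)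
    (ht : R ≤ rt) (hbt : rb ≠ rt) {p : Prog} {s s' : State} {t : ℕ} (h : Exec w p s t s')
    (hp : p.regs ≤ R) {s₁ : State} (hs : Holds R (2 ^ w) base s s₁) (hsb : s₁.reg rb = base) :
    ∃ t₁ s₁', Exec w' (p.relocate rb rt) s₁ t₁ s₁' ∧ t₁ ≤ 2 * t ∧ Holds R (2 ^ w) base s' s₁' ∧
      (∀ r, R ≤ r → r ≠ rt → s₁'.reg r = s₁.reg r) ∧
      (∀ a, (a < base ∨ base + 2 ^ w ≤ a) → s₁'.mem a = s₁.mem a) := by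
  have hle : 2 ^ w ≤ 2 ^ w' := by omega
  induction h generalizing s₁ with
  | skip s => exact ⟨_, _, .skip _, by omega, hs, fun _ _ _ => rfl, fun _ _ => rfl⟩
  | const d k s h =>
    simp only [Prog.regs] at hp
    refine ⟨_, _, .const d k _ (by omega), by omega, ⟨fun r hr => ?_, hs.mem⟩, fun r hr _ => ?_,
      fun _ _ => rfl⟩
    · simp [hs.reg r hr]
    · simp [show r ≠ d by omega]
  | op o d a b s h =>
    simp only [Prog.regs] at hp
    have ea := hs.reg a (by omega)
    have eb := hs.reg b (by omega)
    refine ⟨_, _, .op o d a b _ (by rw [ea, eb]; omega), by omega, ⟨fun r hr => ?_, hs.mem⟩,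
      fun r hr _ => ?_, fun _ _ => rfl⟩
    · simp [hs.reg r hr, ea, eb]
    · simp [show r ≠ d by omega]
  | load d a s ha hv =>
    simp only [Prog.regs] at hp
    have ea := hs.reg a (by omega)
    have em := hs.mem _ ha
    have hm : MRuns w' (.seq (.op .add rt rb a) (.load d rt)) s₁ (fun t s' => t = 2 ∧
        s' = (s₁.setReg rt (base + s.reg a)).setReg d (s.mem (s.reg a))) := by
      refine .seq (.op ?_ (.load ?_ ?_ ?_))
      · simp only [BinOp.eval, hsb, ea]; omega
      · simp only [BinOp.eval, hsb, ea, State.setReg_reg, if_true]; omega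
      · simp only [BinOp.eval, hsb, ea, State.setReg_reg, if_true, State.setReg_mem, em]; omega
      · simp [BinOp.eval, hsb, ea, em]
    obtain ⟨t₁, s₁', he, rfl, rfl⟩ := hm
    refine ⟨_, _, he, by omega, ⟨fun r hr => ?_, hs.mem⟩, fun r hr hr' => ?_, fun _ _ => rfl⟩
    · simp [hs.reg r hr, show r ≠ rt by omega]
    · simp [show r ≠ d by omega, hr']
  | store a b s ha hv =>
    simp only [Prog.regs] at hp
    have ea := hs.reg a (by omega)
    have eb := hs.reg b (by omega)
    have hm : MRuns w' (.seq (.op .add rt rb a) (.store rt b)) s₁ (fun t s' => t = 2 ∧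
        s' = (s₁.setReg rt (base + s.reg a)).setMem (base + s.reg a) (s.reg b)) := by
      refine .seq (.op ?_ (.store ?_ ?_ ?_))
      · simp only [BinOp.eval, hsb, ea]; omega
      · simp only [BinOp.eval, hsb, ea, State.setReg_reg, if_true]; omega
      · simp only [State.setReg_reg, if_neg (show b ≠ rt by omega), eb]; omega
      · simp [BinOp.eval, hsb, ea, eb, show b ≠ rt by omega]
    obtain ⟨t₁, s₁', he, rfl, rfl⟩ := hm
    refine ⟨_, _, he, by omega, ⟨fun r hr => ?_, fun x hx => ?_⟩, fun r hr hr' => ?_,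
      fun x hx => ?_⟩
    · simp [hs.reg r hr, show r ≠ rt by omega]
    · simp [hs.mem x hx]
    · simp [hr']
    · have : x ≠ base + s.reg a := by omega
      simp [this]
  | seq h₁ h₂ ih₁ ih₂ =>
    simp only [Prog.regs] at hp
    obtain ⟨t₁, u₁, e₁, l₁, H₁, r₁, m₁⟩ := ih₁ (by omega) hs hsb
    obtain ⟨t₂, u₂, e₂, l₂, H₂, r₂, m₂⟩ := ih₂ (by omega) H₁ (by rw [r₁ rb hb hbt, hsb])
    exact ⟨_, _, .seq e₁ e₂, by omega, H₂, fun r hr hr' => (r₂ r hr hr').trans (r₁ r hr hr'),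
      fun a ha => (m₂ a ha).trans (m₁ a ha)⟩
  | @ite_true a b p q s s₁' t h hq ih =>
    simp only [Prog.regs] at hp
    obtain ⟨t₁, u₁, e₁, l₁, H₁, r₁, m₁⟩ := ih (by omega) hs hsb
    refine ⟨_, _, .ite_true (by rwa [hs.reg a (by omega), hs.reg b (by omega)]) e₁, by omega, H₁,
      r₁, m₁⟩
  | @ite_false a b p q s s₁' t h hq ih =>
    simp only [Prog.regs] at hp
    obtain ⟨t₁, u₁, e₁, l₁, H₁, r₁, m₁⟩ := ih (by omega) hs hsb
    refine ⟨_, _, .ite_false (by rwa [hs.reg a (by omega), hs.reg b (by omega)]) e₁, by omega, H₁,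
      r₁, m₁⟩
  | @loop_done a b p s h =>
    simp only [Prog.regs] at hp
    exact ⟨_, _, .loop_done (by rwa [hs.reg a (by omega), hs.reg b (by omega)]), by omega, hs,
      fun _ _ _ => rfl, fun _ _ => rfl⟩
  | @loop_step a b p s _ _ _ _ h h₁ h₂ ih₁ ih₂ =>
    have hp' := hp
    simp only [Prog.regs] at hp
    obtain ⟨t₁, u₁, e₁, l₁, H₁, r₁, m₁⟩ := ih₁ (by omega) hs hsb
    obtain ⟨t₂, u₂, e₂, l₂, H₂, r₂, m₂⟩ := ih₂ hp' H₁ (by rw [r₁ rb hb hbt, hsb])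
    exact ⟨_, _, .loop_step (by rwa [hs.reg a (by omega), hs.reg b (by omega)]) e₁ e₂, by omega,
      H₂, fun r hr hr' => (r₂ r hr hr').trans (r₁ r hr hr'),
      fun a ha => (m₂ a ha).trans (m₁ a ha)⟩

end WordRAM

/-! ### Compilation of the high-level language -/

namespace HL
open WordRAM

theorem mul_add_inj {N a b a' b' : ℕ} (hb : b < N) (hb' : b' < N) (h : a * N + b = a' * N + b') :
    a = a' ∧ b = b' := by
  have h1 : (a * N + b) / N = a := by
    rw [mul_comm, Nat.mul_add_div (by omega), Nat.div_eq_of_lt hb, add_zero]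
  have h2 : (a' * N + b') / N = a' := by
    rw [mul_comm, Nat.mul_add_div (by omega), Nat.div_eq_of_lt hb', add_zero]
  have : a = a' := by rw [← h1, ← h2, h]
  subst this
  exact ⟨rfl, by omega⟩

theorem mul_add_lt {N M a b : ℕ} (ha : a < M) (hb : b < N) : a * N + b < M * N := by
  calc a * N + b < a * N + N := by omega
    _ = (a + 1) * N := by ring
    _ ≤ M * N := Nat.mul_le_mul_right _ ha

/-- The machine state `s` represents the high-level state `σ`. -/
structure Match (R N : ℕ) (σ : St) (s : State) : Prop where
  regN : s.reg R = N
  var : ∀ x, s.reg (R + 2 * x + 2) = σ.reg x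
  lt : ∀ x, σ.reg x < N
  cell : ∀ t i j k, t < N → i < N → j < N → k < N →
    s.mem (((t * N + i) * N + j) * N + k) = σ.arr t i j k
  cell_lt : ∀ t i j k, t < N → i < N → j < N → k < N → σ.arr t i j k < N

/-- Register layout: those below `R` belong to the oracle, `R` holds `N`, `R + 1` the base of a
call, the later even offsets hold the variables and the odd offsets from `R + 3` on are scratch.
Only `R` and the variables carry information about `σ`. -/
theorem Match.congr {R N : ℕ} {σ : St} {s s' : State} (h : Match R N σ s)
    (hr : ∀ r, (∀ d, r ≠ R + 2 * d + 3) → R ≤ r → r ≠ R + 1 → s'.reg r = s.reg r)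
    (hm : s'.mem = s.mem) : Match R N σ s' where
  regN := by rw [hr R (by omega) le_rfl (by omega), h.regN]
  var x := by rw [hr _ (by omega) (by omega) (by omega), h.var]
  lt := h.lt
  cell := by rw [hm]; exact h.cell
  cell_lt := h.cell_lt

/-- Code for binary operations, from registers `a`, `b` to `a`. -/
def Op.code (rN a b : ℕ) : Op → Prog
  | .plus => .seq (.op .add a a b) (.op .mod a a rN)
  | .sub => .op .sub a a b
  | .msub => .seq (.op .sub b rN b) (.seq (.op .add a a b) (.op .mod a a rN))
  | .mul => .seq (.op .mul a a b) (.op .mod a a rN)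
  | .div => .op .div a a b
  | .rem => .op .mod a a b

theorem Op.eval_lt {N x y : ℕ} (o : Op) (hx : x < N) : o.eval N x y < N := by
  have h0 : 0 < N := by omega
  cases o <;> simp only [Op.eval]
  · exact Nat.mod_lt _ h0
  · omega
  · exact Nat.mod_lt _ h0
  · exact Nat.mod_lt _ h0
  · exact (Nat.div_le_self _ _).trans_lt hx
  · exact (Nat.mod_le _ _).trans_lt hx

theorem Op.code_spec {w N rN a b : ℕ} (hN2 : 2 ≤ N) (hw : N ^ 4 ≤ 2 ^ w) (hNa : rN ≠ a) (hNb : rN ≠ b)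
    (hab : a ≠ b) (o : Op) {s : State} (hN : s.reg rN = N) (ha : s.reg a < N) (hb : s.reg b < N) :
    MRuns w (o.code rN a b) s (fun t s' => t ≤ 3 ∧ s'.reg a = o.eval N (s.reg a) (s.reg b) ∧
      (∀ r, r ≠ a → r ≠ b → s'.reg r = s.reg r) ∧ s'.mem = s.mem) := by
  have h0 : 1 ≤ N := by omega
  -- The machine has no modular operations, so sums and products must fit into a word before they
  -- are reduced modulo `N`.
  have h4 : N * N ≤ 2 ^ w :=
    le_trans (by nlinarith [Nat.pow_le_pow_right h0 (show 2 ≤ 4 by norm_num)]) hw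
  have h1 : N + N ≤ 2 ^ w := le_trans (by nlinarith) h4
  have hlt : N ≤ 2 ^ w := by omega
  have hmul : s.reg a * s.reg b < 2 ^ w :=
    lt_of_lt_of_le (Nat.mul_lt_mul'' ha hb) h4
  have hmod : ∀ x, x % N < 2 ^ w := fun x => (Nat.mod_lt _ h0).trans_le hlt
  cases o with
  | plus =>
    refine .seq (.op ?_ (.op ?_ ?_))
    · simp only [BinOp.eval]; omega
    · simp [BinOp.eval, hNa, hN, hmod]
    · refine ⟨by norm_num, by simp [BinOp.eval, hNa, hN, Op.eval], fun r h1 h2 => ?_, rfl⟩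
      simp [h1]
  | sub =>
    refine .op ?_ ⟨by norm_num, by simp [BinOp.eval, Op.eval], fun r h1 h2 => by simp [h1], rfl⟩
    simp only [BinOp.eval]; omega
  | msub =>
    have hbm : s.reg b % N = s.reg b := Nat.mod_eq_of_lt hb
    have hN1 : s.reg a + (N - s.reg b) < 2 ^ w := by omega
    refine .seq (.op ?_ (.seq (.op ?_ (.op ?_ ?_))))
    · simp only [BinOp.eval, hN]
      omega
    · simp [BinOp.eval, hab, hN, hN1]
    · simp [BinOp.eval, hNa, hNb, hN, hmod]
    · refine ⟨by norm_num, by simp [BinOp.eval, hNa, hNb, hN, hab, Op.eval, hbm],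
        fun r h1 h2 => ?_, rfl⟩
      simp [h1, h2]
  | mul =>
    refine .seq (.op ?_ (.op ?_ ?_))
    · exact hmul
    · simp [BinOp.eval, hNa, hN, hmod]
    · refine ⟨by norm_num, by simp [BinOp.eval, hNa, hN, Op.eval], fun r h1 h2 => ?_, rfl⟩
      simp [h1]
  | div =>
    refine .op ?_ ⟨by norm_num, by simp [BinOp.eval, Op.eval], fun r h1 h2 => by simp [h1], rfl⟩
    simp only [BinOp.eval]
    exact (Nat.div_le_self _ _).trans_lt (by omega)
  | rem =>
    refine .op ?_ ⟨by norm_num, by simp [BinOp.eval, Op.eval], fun r h1 h2 => by simp [h1], rfl⟩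
    simp only [BinOp.eval]
    exact (Nat.mod_le _ _).trans_lt (by omega)

/-- Code for the address of a cell, from the indices in registers `a`, `b`, `c` to `a`; `d` is
scratch space. -/
def addrCode (rN tag a b c d : ℕ) : Prog :=
  .seq (.const d tag) (.seq (.op .mul d d rN) (.seq (.op .add a d a) (.seq (.op .mul a a rN)
    (.seq (.op .add a a b) (.seq (.op .mul a a rN) (.op .add a a c))))))

/-- An address is a four-digit number in base `N`. Hence words of `4` times the length of `N`
suffice. -/
theorem addr_lt {N t i j k : ℕ} (ht : t < N) (hi : i < N) (hj : j < N) (hk : k < N) :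
    ((t * N + i) * N + j) * N + k < N ^ 4 :=
  (mul_add_lt (mul_add_lt (mul_add_lt ht hi) hj) hk).trans_eq (by ring)

theorem addrCode_spec {w N rN tag a b c d : ℕ} (hN2 : 2 ≤ N) (hw : N ^ 4 ≤ 2 ^ w) (hNa : rN ≠ a)
    (hNd : rN ≠ d) (had : a ≠ d) (hab : b ≠ a) (hbd : b ≠ d) (hac : c ≠ a) (hcd : c ≠ d)
    {s : State} (hN : s.reg rN = N) (ht : tag < N) (ha : s.reg a < N) (hb : s.reg b < N)
    (hc : s.reg c < N) :
    MRuns w (addrCode rN tag a b c d) s (fun t s' => t = 7 ∧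
      s'.reg a = ((tag * N + s.reg a) * N + s.reg b) * N + s.reg c ∧
      (∀ r, r ≠ a → r ≠ d → s'.reg r = s.reg r) ∧ s'.mem = s.mem) := by
  have h0 := addr_lt ht ha hb hc
  have h1 : tag ≤ tag * N := Nat.le_mul_of_pos_right _ (by omega)
  have h2 : tag * N + s.reg a ≤ (tag * N + s.reg a) * N := Nat.le_mul_of_pos_right _ (by omega)
  have h3 : (tag * N + s.reg a) * N + s.reg b ≤ ((tag * N + s.reg a) * N + s.reg b) * N :=
    Nat.le_mul_of_pos_right _ (by omega)
  refine .seq (.const ?_ (.seq (.op ?_ (.seq (.op ?_ (.seq (.op ?_ (.seq (.op ?_ (.seq (.op ?_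
    (.op ?_ ?_))))))))))))
  · omega
  · simp only [BinOp.eval, State.setReg_reg, if_true, if_neg hNd, hN]; omega
  · simp only [BinOp.eval, State.setReg_reg, if_true, if_neg hNd, hN, if_neg had]; omega
  · simp only [BinOp.eval, State.setReg_reg, if_true, if_neg hNd, if_neg hNa, hN, if_neg had]; omega
  · simp only [BinOp.eval, State.setReg_reg, if_true, if_neg hNd, if_neg hNa, hN, if_neg had,
      if_neg hab, if_neg hbd]; omega
  · simp only [BinOp.eval, State.setReg_reg, if_true, if_neg hNd, if_neg hNa, hN, if_neg had,
      if_neg hab, if_neg hbd]; omega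
  · simp only [BinOp.eval, State.setReg_reg, if_true, if_neg hNd, if_neg hNa, hN, if_neg had,
      if_neg hab, if_neg hbd, if_neg hac, if_neg hcd]; omega
  · refine ⟨rfl, ?_, fun r h1 h2 => ?_, rfl⟩
    · simp only [BinOp.eval, State.setReg_reg, if_true, if_neg hNd, if_neg hNa, hN, if_neg had,
        if_neg hab, if_neg hbd, if_neg hac, if_neg hcd]
    · simp [h1, h2]

/-! ### Evaluation of expressions. -/

/-- A bound on the constants of an expression. -/
def Expr.top : Expr → ℕ
  | .const k => k
  | .var _ => 0
  | .bin _ a b => a.top + b.top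
  | .get t i j k => t + i.top + j.top + k.top

/-- A bound on the time to evaluate an expression. -/
def Expr.cost : Expr → ℕ
  | .const _ => 1
  | .var _ => 1
  | .bin _ a b => a.cost + b.cost + 3
  | .get _ i j k => i.cost + j.cost + k.cost + 8

theorem eval_lt {R N : ℕ} {σ : St} {s : State} (hM : Match R N σ s) (e : Expr) (h : e.top < N) :
    e.eval N σ < N := by
  induction e with
  | const k => exact h
  | var x => exact hM.lt x
  | bin o a b iha ihb =>
    simp only [Expr.top] at h
    exact o.eval_lt (iha (by omega))
  | get t i j k ihi ihj ihk =>
    simp only [Expr.top] at h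
    exact hM.cell_lt _ _ _ _ (by omega) (ihi (by omega)) (ihj (by omega)) (ihk (by omega))

/-- Code that evaluates an expression to scratch register number `d`. -/
def Expr.code (R : ℕ) : Expr → ℕ → Prog
  | .const k, d => .const (R + 2 * d + 3) k
  | .var x, d => .op .and (R + 2 * d + 3) (R + 2 * x + 2) (R + 2 * x + 2)
  | .bin o a b, d => .seq (a.code R d) (.seq (b.code R (d + 1))
      (o.code R (R + 2 * d + 3) (R + 2 * (d + 1) + 3)))
  | .get t i j k, d => .seq (i.code R d) (.seq (j.code R (d + 1)) (.seq (k.code R (d + 2))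
      (.seq (addrCode R t (R + 2 * d + 3) (R + 2 * (d + 1) + 3) (R + 2 * (d + 2) + 3)
        (R + 2 * (d + 3) + 3)) (.load (R + 2 * d + 3) (R + 2 * d + 3)))))

/-- The scratch registers form a stack: evaluation at depth `d` changes only those numbered `d` and
above, so results of earlier subexpressions survive. -/
theorem Expr.code_spec {w R N : ℕ} (hN2 : 2 ≤ N) (hw : N ^ 4 ≤ 2 ^ w) {σ : St} (e : Expr) :
    ∀ (d : ℕ) (s : State), Match R N σ s → e.top < N →
      MRuns w (e.code R d) s (fun t s' => t ≤ e.cost ∧ s'.reg (R + 2 * d + 3) = e.eval N σ ∧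
        (∀ r, (∀ d' ≥ d, r ≠ R + 2 * d' + 3) → s'.reg r = s.reg r) ∧ s'.mem = s.mem ∧
        Match R N σ s') := by
  have hNw : N ≤ 2 ^ w := le_trans (Nat.le_self_pow (by norm_num) N) hw
  induction e with
  | const k =>
    intro d s hM ht
    have hr : ∀ r, (∀ d' ≥ d, r ≠ R + 2 * d' + 3) → (s.setReg (R + 2 * d + 3) k).reg r = s.reg r :=
      fun r hr => by simp [hr d le_rfl]
    exact .const (by simp only [Expr.top] at ht; omega) ⟨le_rfl, by simp, hr, rfl,
      hM.congr (fun r h _ _ => hr r fun d' _ => h d') rfl⟩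
  | var x =>
    intro d s hM ht
    have hr : ∀ r, (∀ d' ≥ d, r ≠ R + 2 * d' + 3) →
        (s.setReg (R + 2 * d + 3) (σ.reg x)).reg r = s.reg r := fun r hr => by simp [hr d le_rfl]
    refine .op ?_ ?_
    · simp only [BinOp.eval, Nat.and_self, hM.var]
      have := hM.lt x
      omega
    · simp only [BinOp.eval, Nat.and_self, hM.var]
      exact ⟨le_rfl, by simp, hr, rfl, hM.congr (fun r h _ _ => hr r fun d' _ => h d') rfl⟩
  | bin o a b iha ihb =>
    intro d s hM ht
    simp only [Expr.top] at ht
    refine .seq ((iha d s hM (by omega)).mono ?_)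
    rintro t₁ s₁ ⟨c₁, v₁, r₁, m₁, M₁⟩
    refine .seq ((ihb (d + 1) s₁ M₁ (by omega)).mono ?_)
    rintro t₂ s₂ ⟨c₂, v₂, r₂, m₂, M₂⟩
    have v₁' : s₂.reg (R + 2 * d + 3) = a.eval N σ := by rw [r₂ _ (fun d' _ => by omega), v₁]
    refine (Op.code_spec hN2 hw (by omega) (by omega) (by omega) o M₂.regN
      (by rw [v₁']; exact eval_lt hM a (by omega)) (by rw [v₂]; exact eval_lt hM b (by omega))).mono
      ?_
    rintro t₃ s₃ ⟨c₃, v₃, r₃, m₃⟩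
    have hr : ∀ r, (∀ d' ≥ d, r ≠ R + 2 * d' + 3) → s₃.reg r = s.reg r := fun r h => by
      rw [r₃ r (h d le_rfl) (h (d + 1) (by omega)), r₂ r (fun d' hd => h d' (by omega)), r₁ r h]
    exact ⟨by simp only [Expr.cost]; omega, by rw [v₃, v₁', v₂]; rfl, hr, by rw [m₃, m₂, m₁],
      hM.congr (fun r h _ _ => hr r fun d' _ => h d') (by rw [m₃, m₂, m₁])⟩
  | get tag i j k ihi ihj ihk =>
    intro d s hM ht
    simp only [Expr.top] at ht
    refine .seq ((ihi d s hM (by omega)).mono ?_)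
    rintro t₁ s₁ ⟨c₁, v₁, r₁, m₁, M₁⟩
    refine .seq ((ihj (d + 1) s₁ M₁ (by omega)).mono ?_)
    rintro t₂ s₂ ⟨c₂, v₂, r₂, m₂, M₂⟩
    refine .seq ((ihk (d + 2) s₂ M₂ (by omega)).mono ?_)
    rintro t₃ s₃ ⟨c₃, v₃, r₃, m₃, M₃⟩
    have hi := eval_lt hM i (by omega)
    have hj := eval_lt hM j (by omega)
    have hk := eval_lt hM k (by omega)
    have v₁' : s₃.reg (R + 2 * d + 3) = i.eval N σ := by
      rw [r₃ _ (fun d' _ => by omega), r₂ _ (fun d' _ => by omega), v₁]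
    have v₂' : s₃.reg (R + 2 * (d + 1) + 3) = j.eval N σ := by
      rw [r₃ _ (fun d' _ => by omega), v₂]
    refine .seq ((addrCode_spec hN2 hw (by omega) (by omega) (by omega) (by omega) (by omega)
      (by omega) (by omega) M₃.regN (show tag < N by omega) (by rwa [v₁']) (by rwa [v₂'])
      (by rwa [v₃])).mono ?_)
    rintro t₄ s₄ ⟨c₄, v₄, r₄, m₄⟩
    rw [v₁', v₂', v₃] at v₄
    have hmem : s₄.mem = s.mem := by rw [m₄, m₃, m₂, m₁]
    have hcell := hM.cell tag _ _ _ (by omega) hi hj hk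
    have hlt := hM.cell_lt tag _ _ _ (by omega) hi hj hk
    have hr : ∀ v r, (∀ d' ≥ d, r ≠ R + 2 * d' + 3) →
        (s₄.setReg (R + 2 * d + 3) v).reg r = s.reg r := fun v r h => by
      rw [State.setReg_reg, if_neg (h d le_rfl), r₄ r (h d le_rfl) (h (d + 3) (by omega)),
        r₃ r (fun d' hd => h d' (by omega)), r₂ r (fun d' hd => h d' (by omega)), r₁ r h]
    refine .load ?_ ?_ ?_
    · rw [v₄]; exact (addr_lt (by omega) hi hj hk).trans_le hw
    · rw [v₄, hmem, hcell]; omega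
    · rw [v₄, hmem, hcell]
      exact ⟨by simp only [Expr.cost]; omega, by simp, hr _, hmem,
        hM.congr (fun r h _ _ => hr _ r fun d' _ => h d') hmem⟩

end HL

/-! ### Simulation of the high-level language -/

namespace HL
open WordRAM

/-- Set all registers below `r` to `0`. -/
def clearCode : ℕ → Prog
  | 0 => .skip
  | r + 1 => .seq (clearCode r) (.const r 0)

theorem clearCode_spec {w : ℕ} (r : ℕ) (s : State) :
    MRuns w (clearCode r) s (fun t s' => t = r + 1 ∧ (∀ x < r, s'.reg x = 0) ∧
      (∀ x, r ≤ x → s'.reg x = s.reg x) ∧ s'.mem = s.mem) := by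
  induction r with
  | zero => exact ⟨_, _, .skip s, rfl, by simp, fun _ _ => rfl, rfl⟩
  | succ r ih =>
    refine .seq (ih.mono ?_)
    rintro t s' ⟨rfl, h0, hr, hm⟩
    refine .const (by positivity) ⟨by omega, fun x hx => ?_, fun x hx => ?_, hm⟩
    · by_cases h : x = r
      · simp [h]
      · simp [h, h0 x (by omega)]
    · simp [show x ≠ r by omega, hr x (by omega)]

/-- A bound on the constants of a command. -/
def Cmd.top : Cmd → ℕ
  | .skip => 0
  | .assign _ e => e.top
  | .put t i j k v => t + i.top + j.top + k.top + v.top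
  | .seq c d => c.top + d.top
  | .ite a b c d => a.top + b.top + c.top + d.top
  | .loop _ _ c => c.top
  | .call _ _ => orcTag

/-- The slow-down factor of the compilation. -/
def Cmd.factor (R : ℕ) : Cmd → ℕ
  | .skip => 1
  | .assign _ e => e.cost + 1
  | .put _ i j k v => i.cost + j.cost + k.cost + v.cost + 8
  | .seq c d => c.factor R + d.factor R
  | .ite a b c d => a.cost + b.cost + 1 + c.factor R + d.factor R
  | .loop _ _ c => c.factor R + 1
  | .call _ _ => R + 10

/-- Compilation of commands to word RAM programs. -/
def Cmd.compile (R : ℕ) (pr : Prog) : Cmd → Prog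
  | .skip => .skip
  | .assign x e => .seq (e.code R 0) (.op .and (R + 2 * x + 2) (R + 3) (R + 3))
  | .put t i j k v => .seq (i.code R 0) (.seq (j.code R 1) (.seq (k.code R 2)
      (.seq (addrCode R t (R + 3) (R + 5) (R + 7) (R + 9))
        (.seq (v.code R 1) (.store (R + 3) (R + 5))))))
  | .seq c d => .seq (c.compile R pr) (d.compile R pr)
  | .ite a b c d => .seq (a.code R 0) (.seq (b.code R 1)
      (.ite (R + 3) (R + 5) (c.compile R pr) (d.compile R pr)))
  | .loop x y c => .loop (R + 2 * x + 2) (R + 2 * y + 2) (c.compile R pr)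
  | .call m e => .seq (clearCode R) (.seq (.op .and 0 (R + 2 * m + 2) (R + 2 * m + 2))
      (.seq (.const (R + 3) orcTag) (.seq (.op .mul (R + 3) (R + 3) R)
        (.seq (.op .mul (R + 3) (R + 3) R) (.seq (.op .add (R + 3) (R + 3) (R + 2 * e + 2))
          (.seq (.op .mul (R + 1) (R + 3) R) (pr.relocate (R + 1) (R + 3))))))))

theorem Match.setVar {R N : ℕ} {σ : St} {s : State} (h : Match R N σ s) {x v : ℕ} (hv : v < N) :
    Match R N (σ.set x v) (s.setReg (R + 2 * x + 2) v) where
  regN := by simp [show R ≠ R + 2 * x + 2 by omega, h.regN]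
  var y := by
    by_cases hy : y = x
    · simp [hy]
    · simp [hy, h.var y]
  lt y := by
    by_cases hy : y = x
    · simpa [hy] using hv
    · simpa [hy] using h.lt y
  cell := h.cell
  cell_lt := h.cell_lt

theorem addr_inj {N t i j k t' i' j' k' : ℕ} (hi : i < N) (hj : j < N) (hk : k < N)
    (hi' : i' < N) (hj' : j' < N) (hk' : k' < N)
    (h : ((t * N + i) * N + j) * N + k = ((t' * N + i') * N + j') * N + k') :
    t' = t ∧ i' = i ∧ j' = j ∧ k' = k := by
  obtain ⟨h1, rfl⟩ := mul_add_inj hk hk' h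
  obtain ⟨h2, rfl⟩ := mul_add_inj hj hj' h1
  obtain ⟨rfl, rfl⟩ := mul_add_inj hi hi' h2
  exact ⟨rfl, rfl, rfl, rfl⟩

theorem Match.setCell {R N : ℕ} {σ : St} {s : State} (h : Match R N σ s) {t i j k v : ℕ}
    (hi : i < N) (hj : j < N) (hk : k < N) (hv : v < N) :
    Match R N (σ.put t i j k v) (s.setMem (((t * N + i) * N + j) * N + k) v) where
  regN := h.regN
  var := h.var
  lt := h.lt
  cell t' i' j' k' ht' hi' hj' hk' := by
    rw [State.setMem_mem, St.put_arr]
    by_cases he : t' = t ∧ i' = i ∧ j' = j ∧ k' = k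
    · obtain ⟨rfl, rfl, rfl, rfl⟩ := he
      simp
    · rw [if_neg he, if_neg fun e => he (addr_inj hi hj hk hi' hj' hk' e.symm)]
      exact h.cell _ _ _ _ ht' hi' hj' hk'
  cell_lt t' i' j' k' ht' hi' hj' hk' := by
    rw [St.put_arr]
    split_ifs
    · exact hv
    · exact h.cell_lt _ _ _ _ ht' hi' hj' hk'

/-- Used for the effect of an oracle call: the guest owns the first `len` cells of a row, and the
rest of the row has to be known to be unchanged. -/
theorem Match.setRow {R N : ℕ} {σ : St} {s s' : State} (h : Match R N σ s) {t i j len : ℕ}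
    {f : ℕ → ℕ} (hi : i < N) (hj : j < N) (hlen : len ≤ N) (hf : ∀ k < N, f k < N)
    (hr : ∀ r, R ≤ r → r ≠ R + 1 → r ≠ R + 3 → s'.reg r = s.reg r)
    (hin : ∀ k < len, s'.mem (((t * N + i) * N + j) * N + k) = f k)
    (hf' : ∀ k < N, len ≤ k → f k = σ.arr t i j k)
    (hout : ∀ a, (a < ((t * N + i) * N + j) * N ∨ ((t * N + i) * N + j) * N + len ≤ a) →
      s'.mem a = s.mem a) : Match R N (σ.putRow t i j f) s' where
  regN := by rw [hr R le_rfl (by omega) (by omega), h.regN]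
  var x := by rw [hr _ (by omega) (by omega) (by omega), h.var]; rfl
  lt := h.lt
  cell t' i' j' k' ht' hi' hj' hk' := by
    rw [St.putRow_arr]
    by_cases he : t' = t ∧ i' = i ∧ j' = j
    · obtain ⟨rfl, rfl, rfl⟩ := he
      rw [if_pos ⟨rfl, rfl, rfl⟩]
      by_cases hk : k' < len
      · exact hin k' hk
      · rw [hout _ (by omega), h.cell _ _ _ _ ht' hi' hj' hk', hf' k' hk' (by omega)]
    · rw [if_neg he, hout _ ?_, h.cell _ _ _ _ ht' hi' hj' hk']
      -- An address inside the row has the digits of that row, by uniqueness of base-`N` expansions.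
      by_contra! hc
      obtain ⟨x, hx⟩ := Nat.exists_eq_add_of_le hc.1
      have := addr_inj hi hj (show x < N by omega) hi' hj' hk' hx.symm
      exact he ⟨this.1, this.2.1, this.2.2.1⟩
  cell_lt t' i' j' k' ht' hi' hj' hk' := by
    rw [St.putRow_arr]
    split_ifs
    · exact hf _ hk'
    · exact h.cell_lt _ _ _ _ ht' hi' hj' hk'

/-- Each high-level step becomes a bounded number of machine steps, the bound depending on the
program text only. The language has been designed so that all values stay below `N`, hence no
compiled instruction can abort. -/
theorem HExec.simulate {w R N κ : ℕ} {pr : Prog} (hN2 : 2 ≤ N) (hw : N ^ 4 ≤ 2 ^ w) (hR : 1 ≤ R)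
    (hpr : pr.regs ≤ R) {c : Cmd} {σ σ' : St} {t : ℕ} (h : HExec N pr κ c σ t σ') :
    ∀ s, Match R N σ s → c.top < N →
      MRuns w (c.compile R pr) s (fun t' s' => t' ≤ c.factor R * t ∧ Match R N σ' s') := by
  have hNw : N ≤ 2 ^ w := le_trans (Nat.le_self_pow (by norm_num) N) hw
  induction h with
  | skip σ => exact fun s hM _ => ⟨_, _, .skip s, by simp [Cmd.factor], hM⟩
  | assign x e σ =>
    intro s hM ht
    refine .seq ((e.code_spec hN2 hw 0 s hM ht).mono ?_)
    rintro t₁ s₁ ⟨c₁, v₁, r₁, m₁, M₁⟩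
    have hv := eval_lt hM e ht
    refine .op ?_ ?_
    · simp only [BinOp.eval, Nat.and_self]
      rw [show R + 3 = R + 2 * 0 + 3 by omega, v₁]; omega
    · simp only [BinOp.eval, Nat.and_self]
      rw [show R + 3 = R + 2 * 0 + 3 by omega, v₁]
      exact ⟨by simp only [Cmd.factor]; omega, M₁.setVar hv⟩
  | put tag i j k v σ =>
    intro s hM ht
    simp only [Cmd.top] at ht
    have hi := eval_lt hM i (by omega)
    have hj := eval_lt hM j (by omega)
    have hk := eval_lt hM k (by omega)
    have hv := eval_lt hM v (by omega)
    refine .seq ((i.code_spec hN2 hw 0 s hM (by omega)).mono ?_)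
    rintro t₁ s₁ ⟨c₁, v₁, r₁, m₁, M₁⟩
    refine .seq ((j.code_spec hN2 hw 1 s₁ M₁ (by omega)).mono ?_)
    rintro t₂ s₂ ⟨c₂, v₂, r₂, m₂, M₂⟩
    refine .seq ((k.code_spec hN2 hw 2 s₂ M₂ (by omega)).mono ?_)
    rintro t₃ s₃ ⟨c₃, v₃, r₃, m₃, M₃⟩
    have v₁' : s₃.reg (R + 3) = i.eval N σ := by
      rw [r₃ _ (fun d' _ => by omega), r₂ _ (fun d' _ => by omega)]; exact v₁
    have v₂' : s₃.reg (R + 5) = j.eval N σ := by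
      rw [r₃ _ (fun d' _ => by omega)]; exact v₂
    have v₃' : s₃.reg (R + 7) = k.eval N σ := v₃
    refine .seq ((addrCode_spec hN2 hw (by omega) (by omega) (by omega) (by omega) (by omega)
      (by omega) (by omega) M₃.regN (show tag < N by omega) (by rwa [v₁']) (by rwa [v₂'])
      (by rwa [v₃'])).mono ?_)
    rintro t₄ s₄ ⟨c₄, v₄, r₄, m₄⟩
    rw [v₁', v₂', v₃'] at v₄
    have M₄ : Match R N σ s₄ := M₃.congr (fun r h _ _ => r₄ r (h 0) (h 3)) m₄
    refine .seq ((v.code_spec hN2 hw 1 s₄ M₄ (by omega)).mono ?_)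
    rintro t₅ s₅ ⟨c₅, v₅, r₅, m₅, M₅⟩
    have e1 : s₅.reg (R + 3) = _ := (r₅ (R + 3) (fun d' _ => by omega)).trans v₄
    have e2 : s₅.reg (R + 5) = _ := v₅
    refine .store ?_ ?_ ?_
    · rw [e1]; exact (addr_lt (by omega) hi hj hk).trans_le hw
    · rw [e2]; omega
    · rw [e1, e2]
      exact ⟨by simp only [Cmd.factor]; omega, M₅.setCell hi hj hk hv⟩
  | seq _ _ ih₁ ih₂ =>
    intro s hM ht
    simp only [Cmd.top] at ht
    refine .seq ((ih₁ s hM (by omega)).mono ?_)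
    rintro t₁ s₁ ⟨c₁, M₁⟩
    refine (ih₂ s₁ M₁ (by omega)).mono ?_
    rintro t₂ s₂ ⟨c₂, M₂⟩
    refine ⟨?_, M₂⟩
    simp only [Cmd.factor]
    nlinarith
  | @ite_true a b c d σ σ₁ t h hc ih =>
    intro s hM ht
    simp only [Cmd.top] at ht
    refine .seq ((a.code_spec hN2 hw 0 s hM (by omega)).mono ?_)
    rintro t₁ s₁ ⟨c₁, v₁, r₁, m₁, M₁⟩
    refine .seq ((b.code_spec hN2 hw 1 s₁ M₁ (by omega)).mono ?_)
    rintro t₂ s₂ ⟨c₂, v₂, r₂, m₂, M₂⟩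
    have e1 : s₂.reg (R + 3) = _ := (r₂ (R + 3) (fun d' _ => by omega)).trans v₁
    have e2 : s₂.reg (R + 5) = _ := v₂
    obtain ⟨t₃, s₃, e₃, c₃, M₃⟩ := ih s₂ M₂ (by omega)
    refine ⟨_, _, .ite_true (by rwa [e1, e2]) e₃, ?_, M₃⟩
    simp only [Cmd.factor]
    nlinarith [Nat.zero_le (t * (d.factor R)), Nat.zero_le (t * (a.cost + b.cost + 1))]
  | @ite_false a b c d σ σ₁ t h hc ih =>
    intro s hM ht
    simp only [Cmd.top] at ht
    refine .seq ((a.code_spec hN2 hw 0 s hM (by omega)).mono ?_)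
    rintro t₁ s₁ ⟨c₁, v₁, r₁, m₁, M₁⟩
    refine .seq ((b.code_spec hN2 hw 1 s₁ M₁ (by omega)).mono ?_)
    rintro t₂ s₂ ⟨c₂, v₂, r₂, m₂, M₂⟩
    have e1 : s₂.reg (R + 3) = _ := (r₂ (R + 3) (fun d' _ => by omega)).trans v₁
    have e2 : s₂.reg (R + 5) = _ := v₂
    obtain ⟨t₃, s₃, e₃, c₃, M₃⟩ := ih s₂ M₂ (by omega)
    refine ⟨_, _, .ite_false (by rwa [e1, e2]) e₃, ?_, M₃⟩
    simp only [Cmd.factor]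
    nlinarith [Nat.zero_le (t * (c.factor R)), Nat.zero_le (t * (a.cost + b.cost + 1))]
  | @loop_done x y c σ h =>
    intro s hM ht
    exact ⟨_, _, .loop_done (by rwa [hM.var, hM.var]), by simp [Cmd.factor], hM⟩
  | @loop_step x y c σ _ _ _ _ h h₁ h₂ ih₁ ih₂ =>
    intro s hM ht
    obtain ⟨t₁, u₁, e₁, l₁, H₁⟩ := ih₁ s hM ht
    obtain ⟨t₂, u₂, e₂, l₂, H₂⟩ := ih₂ u₁ H₁ ht
    refine ⟨_, _, .loop_step (by rwa [hM.var, hM.var]) e₁ e₂, ?_, H₂⟩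
    simp only [Cmd.factor] at *
    nlinarith
  | @call m e σ t st X hX hww hex =>
    intro s hM ht
    simp only [Cmd.top] at ht
    -- The first address of the row, which becomes the base of the oracle.
    set rowN := ((orcTag * N + 0) * N + σ.reg e) * N with hrowN
    have hrow : rowN = (orcTag * N * N + σ.reg e) * N := by rw [hrowN, add_zero]
    have hm := hM.lt m
    have he := hM.lt e
    have hrlt : rowN + N ≤ N ^ 4 := by
      have := addr_lt ht (show 0 < N by omega) he (show N - 1 < N by omega)
      omega
    have k1 : orcTag ≤ orcTag * N := Nat.le_mul_of_pos_right _ (by omega)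
    have k2 : orcTag * N ≤ orcTag * N * N := Nat.le_mul_of_pos_right _ (by omega)
    have k3 : orcTag * N * N + σ.reg e ≤ rowN := by
      rw [hrow]; exact Nat.le_mul_of_pos_right _ (by omega)
    refine .seq ((clearCode_spec R s).mono ?_)
    rintro t₁ s₁ ⟨rfl, z₁, r₁, m₁⟩
    have hN : s₁.reg R = N := by rw [r₁ R le_rfl, hM.regN]
    have hvm : s₁.reg (R + 2 * m + 2) = σ.reg m := by rw [r₁ _ (by omega), hM.var]
    have hve : s₁.reg (R + 2 * e + 2) = σ.reg e := by rw [r₁ _ (by omega), hM.var]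
    have n1 : R ≠ R + 3 := by omega
    have n2 : R ≠ 0 := by omega
    have n3 : R + 2 * e + 2 ≠ R + 3 := by omega
    have n4 : R + 2 * e + 2 ≠ 0 := by omega
    have n5 : R + 3 ≠ 0 := by omega
    refine .seq (.op ?_ (.seq (.const ?_ (.seq (.op ?_ (.seq (.op ?_ (.seq (.op ?_
      (.seq (.op ?_ ?_)))))))))))
    · simp only [BinOp.eval, Nat.and_self, hvm]; omega
    · omega
    · simp only [BinOp.eval, State.setReg_reg, if_true, if_neg n1, if_neg n2, hN]; omega
    · simp only [BinOp.eval, State.setReg_reg, if_true, if_neg n1, if_neg n2, hN]; omega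
    · simp only [BinOp.eval, State.setReg_reg, if_true, if_neg n1, if_neg n2, hN, if_neg n3,
        if_neg n4, hve]
      omega
    · simp only [BinOp.eval, State.setReg_reg, if_true, if_neg n1, if_neg n2, hN, if_neg n3,
        if_neg n4, hve, ← hrow]
      omega
    · simp only [BinOp.eval, State.setReg_reg, if_true, if_neg n1, if_neg n2, hN, if_neg n3,
        if_neg n4, hve, ← hrow, Nat.and_self, hvm]
      set s₂ := ((((((s₁.setReg 0 (σ.reg m)).setReg (R + 3) orcTag).setReg (R + 3)
        (orcTag * N)).setReg (R + 3) (orcTag * N * N)).setReg (R + 3)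
        (orcTag * N * N + σ.reg e)).setReg (R + 1) rowN) with hs₂
      have hmem₂ : s₂.mem = s.mem := m₁
      have hreg₂ : ∀ r, R ≤ r → r ≠ R + 1 → r ≠ R + 3 → s₂.reg r = s.reg r := by
        intro r h1 h2 h3
        simp only [hs₂, State.setReg_reg, if_neg h2, if_neg h3, if_neg (show r ≠ 0 by omega)]
        exact r₁ r h1
      -- After the clearing of the low registers and the copy of the size, the oracle sees exactly
      -- its initial state.
      have hH : Holds R (2 ^ wordLength κ (σ.reg m)) rowN (input (σ.reg m) X) s₂ := by
        refine ⟨fun r hr => ?_, fun a ha => ?_⟩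
        · simp only [hs₂, State.setReg_reg, if_neg (show r ≠ R + 1 by omega),
            if_neg (show r ≠ R + 3 by omega)]
          by_cases h0 : r = 0
          · simp [h0, input]
          · simp [h0, input, z₁ r hr]
        · rw [hmem₂, ← hX a (by omega), hrowN]
          exact hM.cell _ _ _ _ ht (by omega) he (by omega)
      obtain ⟨t₃, s₃, e₃, c₃, H₃, r₃, m₃⟩ := Exec.relocate (w' := w) (rb := R + 1) (rt := R + 3)
        (by omega) (by omega) (by omega) (by omega) hex hpr hH (by simp [hs₂])
      refine ⟨t₃, s₃, e₃, ?_, hM.setRow (len := 2 ^ wordLength κ (σ.reg m)) (by omega) he hww ?_ ?_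
        H₃.mem ?_ ?_⟩
      · simp only [Cmd.factor]
        nlinarith
      · intro k hk
        refine Exec.mem_lt hex hww (fun a => ?_) k
        by_cases ha : a < N
        · rw [← hX a ha]
          exact hM.cell_lt _ _ _ _ ht (by omega) he ha
        · simp only [input]
          split_ifs with h
          · omega
          · omega
      · intro r h1 h2 h3
        rw [r₃ r h1 h3, hreg₂ r h1 h2 h3]
      -- Cells of the row beyond the oracle's address range were zero input cells and stay so.
      · intro k hk hk'
        rw [hex.mem_eq_of_le k hk', hX k hk]
      · intro a ha
        rw [m₃ a ha, hmem₂]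

end HL

/-! ### Complete programs -/

namespace HL
open WordRAM

/-- The modulus for inputs of size `n`. -/
def modulus (κ n : ℕ) : ℕ := (2 ^ (Nat.log 2 n + 1)) ^ κ

/-- Code for `r := r_a ^ k`. -/
def powCode (r a : ℕ) : ℕ → Prog
  | 0 => .const r 1
  | k + 1 => .seq (powCode r a k) (.op .mul r r a)

theorem powCode_spec {w r a v : ℕ} (hra : a ≠ r) (hv : 1 ≤ v) {s : State} (hs : s.reg a = v)
    (k : ℕ) (hk : v ^ k < 2 ^ w) :
    MRuns w (powCode r a k) s (fun t s' => t = k + 1 ∧ s' = s.setReg r (v ^ k)) := by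
  induction k with
  | zero => exact .const (by simpa using hk) ⟨rfl, by simp⟩
  | succ k ih =>
    have hle : v ^ k ≤ v ^ (k + 1) := Nat.pow_le_pow_right hv (by omega)
    refine .seq ((ih (by omega)).mono ?_)
    rintro t s' ⟨rfl, rfl⟩
    have e : (s.setReg r (v ^ k)).reg r * (s.setReg r (v ^ k)).reg a = v ^ (k + 1) := by
      simp [hra, hs, pow_succ]
    refine .op ?_ ?_
    · simp only [BinOp.eval, e]; exact hk
    · simp only [BinOp.eval, e]
      refine ⟨by trivial, ?_⟩
      simp [State.setReg]

/-- Repeated doubling finds `2 ^ l` as the least power of two above `n`; with `l = ⌊log₂ n⌋ + 1`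
this is the base from which the modulus is computed. Here `d` is the number of remaining rounds. -/
theorem double_spec {w a b n l : ℕ} (hab : a ≠ b) (hl : n < 2 ^ l)
    (hl' : ∀ i < l, 2 ^ i ≤ n) (hw : 2 ^ l < 2 ^ w) :
    ∀ d i (s : State), i + d = l → s.reg a = 2 ^ i → s.reg b = n + 1 →
      MRuns w (.loop a b (.op .add a a a)) s (fun t s' => t = 2 * d + 1 ∧ s'.reg a = 2 ^ l ∧
        (∀ r, r ≠ a → s'.reg r = s.reg r) ∧ s'.mem = s.mem) := by
  intro d
  induction d with
  | zero =>
    intro i s hi ha hb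
    obtain rfl : i = l := by omega
    exact ⟨_, _, .loop_done (by omega), rfl, ha, fun _ _ => rfl, rfl⟩
  | succ d ih =>
    intro i s hi ha hb
    have h1 := hl' i (by omega)
    have h2 : 2 ^ (i + 1) ≤ 2 ^ l := Nat.pow_le_pow_right (by norm_num) (by omega)
    have e : s.reg a + s.reg a = 2 ^ (i + 1) := by rw [ha, pow_succ]; ring
    obtain ⟨t, s', he, rfl, h3, h4, h5⟩ := ih (i + 1) (s.setReg a (s.reg a + s.reg a)) (by omega)
      (by simp [e]) (by simp [hab.symm, hb])
    refine ⟨_, _, .loop_step (by omega) (.op .add a a a s ?_) he, by omega, h3, fun r hr => ?_, h5⟩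
    · simp only [BinOp.eval]; omega
    · simp [h4 r hr, hr]

/-- The word RAM program for a command: the modulus is computed from the input size, register `0`
of the command holds the input size, and register `out` the output. -/
def Cmd.program (κ R : ℕ) (pr : Prog) (c : Cmd) (out : ℕ) : Prog :=
  .seq (.const (R + 3) 1) (.seq (.op .add (R + 5) 0 (R + 3)) (.seq (.const (R + 7) 1)
    (.seq (.loop (R + 7) (R + 5) (.op .add (R + 7) (R + 7) (R + 7)))
      (.seq (powCode R (R + 7) κ) (.seq (.op .and (R + 2) 0 0)
        (.seq (c.compile R pr) (.op .and 0 (R + 2 * out + 2) (R + 2 * out + 2))))))))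

/-- The initial state of a command: array `0` holds the input. -/
def initSt (n : ℕ) (x : ℕ → ℕ) : St where
  reg r := if r = 0 then n else 0
  arr t i j k := if t = 0 ∧ i = 0 ∧ j = 0 ∧ 1 ≤ k ∧ k ≤ n then x k else 0

theorem two_le_modulus {κ n : ℕ} (hκ : 1 ≤ κ) : 2 ≤ modulus κ n := by
  unfold modulus
  rw [← pow_mul]
  exact Nat.le_self_pow (Nat.mul_ne_zero (by omega) (by omega)) 2

/-- Entry and exit code around a compiled command. The modulus `N` is computed at run time, and `N ^
4` is exactly the number of words, so the address space of the arrays matches the memory. -/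
theorem Cmd.program_spec {κ κ' R n out T : ℕ} {pr : Prog} {c : Cmd} {x : ℕ → ℕ}
    {Q : ℕ → Prop} (hκ : 1 ≤ κ)
    (hR : 1 ≤ R) (hpr : pr.regs ≤ R) (hn : 1 ≤ n) (hnN : n < modulus κ n)
    (hx : ∀ i, 1 ≤ i → i ≤ n → x i < modulus κ n)
    (htop : c.top < modulus κ n)
    (h : Runs (modulus κ n) pr κ' c (initSt n x) (fun t σ => t ≤ T ∧ Q (σ.reg out))) :
    ∃ t s, Exec (wordLength (4 * κ) n) (c.program κ R pr out) (input n x) t s ∧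
      t ≤ c.factor R * T + (2 * Nat.log 2 n + κ + 9) ∧ Q (s.reg 0) := by
  have hN2 : 2 ≤ modulus κ n := two_le_modulus hκ
  have hw : modulus κ n ^ 4 = 2 ^ wordLength (4 * κ) n := by
    unfold modulus wordLength
    rw [← pow_mul, ← pow_mul]
    congr 1
    ring
  have hNN : modulus κ n < modulus κ n ^ 4 := by
    calc modulus κ n = modulus κ n ^ 1 := (pow_one _).symm
      _ < modulus κ n ^ 4 := Nat.pow_lt_pow_right hN2 (by norm_num)
  have hWN : 2 ^ (Nat.log 2 n + 1) ≤ modulus κ n := Nat.le_self_pow (by omega) _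
  set N := modulus κ n with hNdef
  set w := wordLength (4 * κ) n
  obtain ⟨T', σ', hex, hT, hQ⟩ := h
  suffices hmr : MRuns w (c.program κ R pr out) (input n x)
      (fun t s => t ≤ c.factor R * T + (2 * Nat.log 2 n + κ + 9) ∧ Q (s.reg 0)) by
    obtain ⟨t, s, h1, h2, h3⟩ := hmr
    exact ⟨t, s, h1, h2, h3⟩
  have n0 : R + 3 ≠ 0 := by omega
  refine .seq (.const (by omega) (.seq (.op ?_ (.seq (.const (by omega) (.seq ?_))))))
  · simp only [BinOp.eval, State.setReg_reg, if_true, if_neg n0.symm]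
    simp only [input, if_true]; omega
  have hval : BinOp.eval .add (((input n x).setReg (R + 3) 1).reg 0)
      (((input n x).setReg (R + 3) 1).reg (R + 3)) = n + 1 := by
    simp [BinOp.eval, input]
  rw [hval]
  refine (double_spec (n := n) (l := Nat.log 2 n + 1) (by omega) (Nat.lt_pow_succ_log_self
    (by norm_num) n) (fun i hi => (Nat.pow_le_pow_right (by norm_num) (by omega)).trans
      (Nat.pow_log_le_self 2 (by omega))) (by omega) (Nat.log 2 n + 1) 0 _ (by omega) (by simp)
      (by simp)).mono ?_
  rintro t₁ s₁ ⟨rfl, ha, hr, hm⟩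
  have hm1 : s₁.mem = (input n x).mem := hm
  have hr1 : ∀ r, r ≠ R + 3 → r ≠ R + 5 → r ≠ R + 7 → s₁.reg r = (input n x).reg r := by
    intro r h1 h2 h3
    rw [hr r h3]
    simp [h1, h2, h3]
  refine .seq ((powCode_spec (by omega) (Nat.one_le_two_pow) ha κ (by
    change N < _; omega)).mono ?_)
  rintro t₂ s₂ ⟨rfl, rfl⟩
  change MRuns _ _ (s₁.setReg R N) _
  have hn0 : s₁.reg 0 = n := by rw [hr1 0 (by omega) (by omega) (by omega)]; simp [input]
  have hn0' : (s₁.setReg R N).reg 0 = n := by simp [show 0 ≠ R by omega, hn0]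
  refine .seq (.op ?_ ?_)
  · simp only [BinOp.eval, Nat.and_self, hn0']; omega
  simp only [BinOp.eval, Nat.and_self, hn0']
  have hM : Match R N (initSt n x) ((s₁.setReg R N).setReg (R + 2) n) := by
    refine ⟨by simp, fun y => ?_, fun y => ?_, fun t i j k ht hi hj hk => ?_,
      fun t i j k ht hi hj hk => ?_⟩
    · by_cases hy : y = 0
      · subst hy; simp [initSt]
      · have h1 : R + 2 * y + 2 ≠ R + 2 := by omega
        have h2 : R + 2 * y + 2 ≠ R := by omega
        have h3 : R + 2 * y + 2 ≠ 0 := by omega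
        simp only [State.setReg_reg, if_neg h1, if_neg h2]
        rw [hr1 _ (by omega) (by omega) (by omega)]
        simp only [input, initSt, if_neg h3, if_neg hy]
    · simp only [initSt]
      split_ifs <;> omega
    · rw [State.setReg_mem, State.setReg_mem, hm1]
      simp only [input, initSt]
      by_cases hz : t = 0 ∧ i = 0 ∧ j = 0
      · obtain ⟨rfl, rfl, rfl⟩ := hz
        simp
      -- Row `0`, `0` of array `0` starts at address `0`, where the input lies. Any other row starts
      -- at `N > n` or later, where the memory is still zero.
      · have hpos : 1 ≤ (t * N + i) * N + j := by
          by_contra hc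
          have h0 : (t * N + i) * N + j = 0 := by omega
          have h1 : (t * N + i) * N = 0 ∧ j = 0 := by omega
          rcases Nat.mul_eq_zero.1 h1.1 with h | h
          · have h2 : t * N = 0 ∧ i = 0 := by omega
            rcases Nat.mul_eq_zero.1 h2.1 with h' | h'
            · exact hz ⟨h', h2.2, h1.2⟩
            · omega
          · omega
        have : N ≤ ((t * N + i) * N + j) * N := Nat.le_mul_of_pos_left _ hpos
        rw [if_neg (by omega), if_neg (by tauto)]
    · simp only [initSt]
      split_ifs with h
      · exact hx k h.2.2.2.1 h.2.2.2.2
      · omega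
  refine .seq ((hex.simulate hN2 hw.le hR hpr _ hM htop).mono ?_)
  rintro t₃ s₃ ⟨c₃, M₃⟩
  have hlt := M₃.lt out
  refine .op ?_ ⟨?_, ?_⟩
  · simp only [BinOp.eval, Nat.and_self, M₃.var]; omega
  · have := Nat.mul_le_mul_left (c.factor R) hT
    omega
  · simp only [BinOp.eval, Nat.and_self, M₃.var, State.setReg_reg, if_true]
    exact hQ

end HL

/-! ### Divisor bound and pseudo-solutions -/

namespace Pseudo
open Finset

/-- Powers grow more slowly than exponentials, so the quotient is a convergent, hence bounded
sequence. -/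
theorem exists_succ_pow_le (k : ℕ) : ∃ C : ℕ, 1 ≤ C ∧ ∀ e : ℕ, (e + 1) ^ k ≤ C * 2 ^ e := by
  have h : Filter.Tendsto (fun e : ℕ => ((e : ℝ) ^ k / 2 ^ e)) Filter.atTop (nhds 0) :=
    tendsto_pow_const_div_const_pow_of_one_lt k (by norm_num)
  obtain ⟨M, hM⟩ := h.bddAbove_range
  obtain ⟨C, hC⟩ := exists_nat_ge M
  refine ⟨2 * C + 1, by omega, fun e => ?_⟩
  have h1 : ((e + 1 : ℕ) : ℝ) ^ k / 2 ^ (e + 1) ≤ C := (hM ⟨e + 1, rfl⟩).trans hC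
  rw [div_le_iff₀ (by positivity)] at h1
  -- The bound is taken at the index `e + 1`, which costs a factor `2`; the further `1` in `2 * C +
  -- 1` makes the constant positive.
  have h2 : (e + 1) ^ k ≤ C * 2 ^ (e + 1) := by exact_mod_cast h1
  calc (e + 1) ^ k ≤ C * 2 ^ (e + 1) := h2
    _ ≤ (2 * C + 1) * 2 ^ e := by rw [pow_succ]; nlinarith [Nat.zero_le (2 ^ e)]

/-- The divisor bound: the number of divisors of `z` is at most `(C z) ^ (1 / k)`. -/
theorem card_divisors_pow_le (k : ℕ) :
    ∃ C : ℕ, 1 ≤ C ∧ ∀ z : ℕ, z ≠ 0 → z.divisors.card ^ k ≤ C * z := by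
  obtain ⟨C, hC, h⟩ := exists_succ_pow_le k
  -- In the product over the primes of `z`, a prime `p ≥ 2 ^ k` satisfies `(e + 1) ^ k ≤ p ^ e`
  -- without a constant. Only the fewer than `2 ^ k` smaller primes cost a factor `C` each.
  refine ⟨C ^ 2 ^ k, Nat.one_le_pow _ _ hC, fun z hz => ?_⟩
  rw [Nat.card_divisors hz, ← Finset.prod_pow]
  have hprod : z = ∏ p ∈ z.primeFactors, p ^ z.factorization p :=
    (Nat.prod_factorization_pow_eq_self hz).symm
  have hle : ∀ p ∈ z.primeFactors, (z.factorization p + 1) ^ k ≤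
      (if p < 2 ^ k then C else 1) * p ^ z.factorization p := by
    intro p hp
    have h2 : 2 ≤ p := (Nat.prime_of_mem_primeFactors hp).two_le
    set e := z.factorization p
    split_ifs with hpk
    · exact (h e).trans (Nat.mul_le_mul_left _ (Nat.pow_le_pow_left h2 e))
    · rw [one_mul]
      calc (e + 1) ^ k ≤ (2 ^ e) ^ k := Nat.pow_le_pow_left (Nat.lt_two_pow_self) k
        _ = (2 ^ k) ^ e := by rw [← pow_mul, ← pow_mul, mul_comm]
        _ ≤ p ^ e := Nat.pow_le_pow_left (by omega) e
  refine (Finset.prod_le_prod' hle).trans ?_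
  rw [Finset.prod_mul_distrib, ← hprod]
  refine Nat.mul_le_mul_right _ ?_
  rw [Finset.prod_ite, Finset.prod_const, Finset.prod_const_one, mul_one]
  refine Nat.pow_le_pow_right hC ?_
  calc _ ≤ (range (2 ^ k)).card := card_le_card fun p hp => by simp at hp ⊢; exact hp.2
    _ = 2 ^ k := card_range _

/-- Double counting: the multiples `M * (y + i)` that divide `f x` are distinct divisors of `f x`,
so `x` is counted at most `D` times, and not at all unless `M` divides `f x`. -/
theorem sum_card_dvd_le {ι : Type*} (S : Finset ι) (f : ι → ℤ) {D Z : ℕ}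
    (hD : ∀ z, 0 < z → z ≤ Z → z.divisors.card ≤ D) (hf : ∀ x ∈ S, f x ≠ 0)
    (hZ : ∀ x ∈ S, (f x).natAbs ≤ Z) {M : ℕ} (hM : 1 ≤ M) (y : ℕ) :
    ∑ i ∈ range y, #{x ∈ S | ((M * (y + i) : ℕ) : ℤ) ∣ f x} ≤ D * #{x ∈ S | (M : ℤ) ∣ f x} := by
  simp_rw [card_filter]
  rw [sum_comm, mul_sum]
  refine sum_le_sum fun x hx => ?_
  by_cases hd : (M : ℤ) ∣ f x
  · rw [if_pos hd, mul_one, ← card_filter]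
    refine le_trans ?_ (hD (f x).natAbs (Int.natAbs_pos.2 (hf x hx)) (hZ x hx))
    refine card_le_card_of_injOn (fun i => M * (y + i)) (fun i hi => ?_) (fun i _ j _ h => ?_)
    · simp only [coe_filter, mem_range, Set.mem_ofPred_eq] at hi
      simp only [mem_coe, Nat.mem_divisors]
      exact ⟨Int.natCast_dvd.1 hi.2, Int.natAbs_ne_zero.2 (hf x hx)⟩
    · have := Nat.eq_of_mul_eq_mul_left (by omega : 0 < M) h
      omega
  · rw [if_neg hd, mul_zero, sum_eq_zero]
    intro i _
    rw [if_neg]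
    exact fun h => hd (Dvd.dvd.trans (by simp) h)

/-! ### Collisions and false triples modulo `M`. -/

/-- Ordered pairs of different elements that collide modulo `M`. -/
def off (A : Finset ℕ) (M : ℕ) : ℕ :=
  #{z ∈ A ×ˢ A | z.1 ≠ z.2 ∧ z.1 % M = z.2 % M}

/-- Ordered pairs that collide modulo `M`. -/
def coll (A : Finset ℕ) (M : ℕ) : ℕ := #{z ∈ A ×ˢ A | z.1 % M = z.2 % M}

/-- The triples `a + b = c` modulo `M` that are no solutions. -/
def falTriples (A : Finset ℕ) (M : ℕ) : Finset (ℕ × ℕ × ℕ) :=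
  {z ∈ A ×ˢ A ×ˢ A | z.1 + z.2.1 ≠ z.2.2 ∧ (z.1 + z.2.1) % M = z.2.2 % M}

/-- The number of solutions of `a + b = c` modulo `M`. -/
def tri (A : Finset ℕ) (M : ℕ) : ℕ :=
  #{z ∈ A ×ˢ A ×ˢ A | (z.1 + z.2.1) % M = z.2.2 % M}

/-- The diagonal does not depend on `M`. Hence a modulus that minimizes the easily computed `coll`
also minimizes `off`. -/
theorem coll_eq (A : Finset ℕ) (M : ℕ) : coll A M = #A + off A M := by
  unfold coll off
  rw [← card_filter_add_card_filter_not (s := {z ∈ A ×ˢ A | z.1 % M = z.2 % M})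
    (fun z => z.1 = z.2), filter_filter, filter_filter]
  congr 1
  · refine (card_nbij' (fun a => (a, a)) (fun z => z.1) ?_ ?_ ?_ ?_).symm
    · intro a ha; simpa using ha
    · intro z hz; simp at hz; simpa using hz.1.1
    · intro a _; rfl
    · rintro ⟨a, b⟩ hz; simp at hz; simp [hz.2.2]
  · congr 1
    ext z
    simp only [mem_filter]
    tauto

/-- The number of true solutions is unknown but does not depend on `M`. Minimizing `tri` therefore
minimizes the number of false triples without any knowledge of the true ones. -/
theorem tri_eq (A : Finset ℕ) (M : ℕ) : tri A M =
    #{z ∈ A ×ˢ A ×ˢ A | z.1 + z.2.1 = z.2.2} + #(falTriples A M) := by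
  unfold tri falTriples
  rw [← card_filter_add_card_filter_not
    (s := {z ∈ A ×ˢ A ×ˢ A | (z.1 + z.2.1) % M = z.2.2 % M})
    (fun z => z.1 + z.2.1 = z.2.2), filter_filter, filter_filter]
  congr 1
  · congr 1
    ext z
    simp only [mem_filter]
    constructor
    · tauto
    · rintro ⟨h1, h2⟩; exact ⟨h1, by rw [h2], h2⟩
  · congr 1
    ext z
    simp only [mem_filter]
    tauto

/-- The best candidate is at most the average of the `y` candidates. -/
theorem mul_card_dvd_le {ι : Type*} (S : Finset ι) (f : ι → ℤ) {D Z : ℕ}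
    (hD : ∀ z, 0 < z → z ≤ Z → z.divisors.card ≤ D) (hf : ∀ x ∈ S, f x ≠ 0)
    (hZ : ∀ x ∈ S, (f x).natAbs ≤ Z) {M : ℕ} (hM : 1 ≤ M) {y q : ℕ}
    (hq : ∀ i < y, #{x ∈ S | ((M * q : ℕ) : ℤ) ∣ f x} ≤
      #{x ∈ S | ((M * (y + i) : ℕ) : ℤ) ∣ f x}) :
    y * #{x ∈ S | ((M * q : ℕ) : ℤ) ∣ f x} ≤ D * #{x ∈ S | (M : ℤ) ∣ f x} := by
  refine le_trans ?_ (sum_card_dvd_le S f hD hf hZ hM y)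
  rw [← smul_eq_mul, ← card_range y, ← sum_const, card_range]
  exact sum_le_sum fun i hi => hq i (mem_range.1 hi)

theorem off_step {A : Finset ℕ} {D Z : ℕ}
    (hD : ∀ z, 0 < z → z ≤ Z → z.divisors.card ≤ D) (hA : ∀ a ∈ A, a ≤ Z)
    {M : ℕ} (hM : 1 ≤ M) {y q : ℕ} (hq : ∀ i < y, coll A (M * q) ≤ coll A (M * (y + i))) :
    y * off A (M * q) ≤ D * off A M := by
  have hdef : ∀ M', off A M' =
      #{z ∈ {z ∈ A ×ˢ A | z.1 ≠ z.2} | (M' : ℤ) ∣ ((z.2 : ℤ) - z.1)} := by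
    intro M'
    unfold off
    rw [filter_filter]
    congr 1
    ext z
    simp only [mem_filter]
    refine and_congr_right fun _ => and_congr_right fun _ => ?_
    exact Nat.modEq_iff_dvd
  simp_rw [coll_eq, add_le_add_iff_left, hdef] at hq
  rw [hdef, hdef]
  refine mul_card_dvd_le _ _ hD (fun z hz => ?_) (fun z hz => ?_) hM hq
  · simp only [mem_filter] at hz; omega
  · simp only [mem_filter, mem_product] at hz
    have h1 := hA _ hz.1.1
    have h2 := hA _ hz.1.2
    omega

/-- The divisor bound is needed up to `2 * Z` because `c - (a + b)` can be as small as about `-2 Z`.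
-/
theorem fal_step {A : Finset ℕ} {D Z : ℕ}
    (hD : ∀ z, 0 < z → z ≤ 2 * Z → z.divisors.card ≤ D) (hA : ∀ a ∈ A, a ≤ Z)
    {M : ℕ} (hM : 1 ≤ M) {y q : ℕ} (hq : ∀ i < y, tri A (M * q) ≤ tri A (M * (y + i))) :
    y * #(falTriples A (M * q)) ≤ D * #(falTriples A M) := by
  have hdef : ∀ M', #(falTriples A M') = #{z ∈ {z ∈ A ×ˢ A ×ˢ A | z.1 + z.2.1 ≠ z.2.2} |
      (M' : ℤ) ∣ ((z.2.2 : ℤ) - ((z.1 + z.2.1 : ℕ) : ℤ))} := by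
    intro M'
    unfold falTriples
    rw [filter_filter]
    congr 1
    ext z
    simp only [mem_filter]
    refine and_congr_right fun _ => and_congr_right fun _ => ?_
    exact Nat.modEq_iff_dvd
  simp_rw [tri_eq, add_le_add_iff_left, hdef] at hq
  rw [hdef, hdef]
  refine mul_card_dvd_le _ _ hD (fun z hz => ?_) (fun z hz => ?_) hM hq
  · simp only [mem_filter] at hz; omega
  · simp only [mem_filter, mem_product] at hz
    have h1 := hA _ hz.1.1
    have h2 := hA _ hz.1.2.1
    have h3 := hA _ hz.1.2.2
    omega

/-- With `F r` the size of the class `r`, the left side is the correlation of `F` with its shift by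
`a`. By `2 x y ≤ x ^ 2 + y ^ 2` it is largest without a shift, where it is `coll A p`. -/
theorem card_shift_le (A : Finset ℕ) {p : ℕ} (hp : 1 ≤ p) (a : ℕ) :
    #{z ∈ A ×ˢ A | (a + z.1) % p = z.2 % p} ≤ coll A p := by
  have : NeZero p := ⟨by omega⟩
  set F : ZMod p → ℕ := fun r => #{b ∈ A | ((b : ℕ) : ZMod p) = r} with hF
  have key : ∀ a : ℕ, #{z ∈ A ×ˢ A | (a + z.1) % p = z.2 % p} =
      ∑ r : ZMod p, F r * F (a + r) := by
    intro a
    rw [card_eq_sum_card_fiberwise (f := fun z => ((z.1 : ℕ) : ZMod p)) (t := univ)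
      (fun _ _ => by simp)]
    refine sum_congr rfl fun r _ => ?_
    rw [hF, ← card_product]
    congr 1
    ext z
    simp only [mem_filter, mem_product, ← ZMod.natCast_eq_natCast_iff', Nat.cast_add]
    constructor
    · rintro ⟨⟨⟨h1, h2⟩, h3⟩, rfl⟩; exact ⟨⟨h1, rfl⟩, h2, h3.symm⟩
    · rintro ⟨⟨h1, rfl⟩, h2, h3⟩; exact ⟨⟨⟨h1, h2⟩, h3.symm⟩, rfl⟩
  have h0 := key 0
  have hc : coll A p = ∑ r : ZMod p, F r * F r := by
    unfold coll
    simpa using h0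
  rw [key, hc]
  have hperm : ∑ r : ZMod p, F (a + r) * F (a + r) = ∑ r : ZMod p, F r * F r :=
    Equiv.sum_comp (Equiv.addLeft (a : ZMod p)) (fun r => F r * F r)
  have h2 : 2 * ∑ r : ZMod p, F r * F (a + r) ≤
      ∑ r : ZMod p, F r * F r + ∑ r : ZMod p, F (a + r) * F (a + r) := by
    rw [mul_sum, ← sum_add_distrib]
    refine sum_le_sum fun r _ => ?_
    have := two_mul_le_add_sq (F r : ℤ) (F (a + r))
    zify
    nlinarith
  omega

theorem tri_le {A : Finset ℕ} {p : ℕ} (hp : 1 ≤ p) : tri A p ≤ #A * coll A p := by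
  unfold tri
  rw [card_eq_sum_card_fiberwise (f := fun z => z.1) (t := A)
    (fun z hz => by simp at hz; simpa using hz.1.1)]
  rw [← smul_eq_mul, ← sum_const]
  refine sum_le_sum fun a _ => le_trans ?_ (card_shift_le A hp a)
  refine card_le_card_of_injOn (fun z => z.2) (fun z hz => ?_) (fun z hz z' hz' h => ?_)
  · simp only [coe_filter, mem_filter, mem_product, Set.mem_ofPred_eq] at hz ⊢
    obtain ⟨⟨⟨_, h1⟩, h2⟩, rfl⟩ := hz
    exact ⟨h1, h2⟩
  · simp only [coe_filter, mem_filter, Set.mem_ofPred_eq] at hz hz'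
    exact Prod.ext (hz.2.trans hz'.2.symm) h

/-- A heavy element collides with at least `b` other elements. -/
theorem heavy_mul_le (A : Finset ℕ) (p b : ℕ) :
    #{x ∈ A | b < #{a ∈ A | a % p = x % p}} * b ≤ off A p := by
  have h : off A p = ∑ x ∈ A, #{a ∈ A | x ≠ a ∧ x % p = a % p} := by
    unfold off
    rw [card_filter, sum_product]
    simp_rw [card_filter]
  rw [h, ← smul_eq_mul, ← sum_const]
  refine le_trans (sum_le_sum (fun x hx => ?_)) (sum_le_sum_of_subset (filter_subset _ A))
  simp only [mem_filter] at hx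
  have : {a ∈ A | x ≠ a ∧ x % p = a % p} = {a ∈ A | a % p = x % p}.erase x := by
    ext a
    simp only [mem_filter, mem_erase]
    constructor
    · rintro ⟨h1, h2, h3⟩; exact ⟨h2.symm, h1, h3.symm⟩
    · rintro ⟨h1, h2, h3⟩; exact ⟨h2, h1.symm, h3.symm⟩
  rw [this, card_erase_of_mem (by simp [hx.1])]
  omega

end Pseudo

/-! ### Program blocks -/

namespace HL
open WordRAM

/-- Sequential composition. -/
infixr:60 " ;; " => Cmd.seq

/-- Register number `x` as an expression. -/
abbrev v (x : ℕ) : Expr := .var x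

/-- The constant `k` as an expression. -/
abbrev lit (k : ℕ) : Expr := .const k

section
variable {N κ : ℕ} {pr : Prog}

/-- Register `dst` becomes the integer part of the `g`-th root of the input size. -/
def rootCmd (g dst : ℕ) : Cmd :=
  .for 17 0 (.ite ((v 17 + lit 1).pow g) (v 0 + lit 1) (.assign dst (v 17 + lit 1)) .skip)

theorem rootCmd_spec {g dst n : ℕ} {σ : St} (hg : 1 ≤ g) (hd0 : dst ≠ 0) (hd : dst ≠ 17)
    (hn : σ.reg 0 = n) (hn1 : 1 ≤ n) (h0 : σ.reg dst = 0) (hN : n ^ g < N) (hnN : n + 1 < N) :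
    Runs N pr κ (rootCmd g dst) σ (fun t σ' => t ≤ 4 * n + 2 ∧
      (σ'.reg dst) ^ g ≤ n ∧ n < (σ'.reg dst + 1) ^ g) := by
  refine Runs.for_of_invariant (by simp [Cmd.writes, hd.symm]) (by simp [Cmd.writes, hd0.symm])
    (by norm_num) (by omega) hn (fun i t σ' => t = 2 * i ∧ (σ'.reg dst) ^ g ≤ n ∧
      σ'.reg dst ≤ i ∧ ∀ x ≤ i, x ^ g ≤ n → x ≤ σ'.reg dst) ?_ ?_ ?_
  · simp [hd, h0, show g ≠ 0 by omega]
  · rintro i t σ' hi hx ha ⟨rfl, h1, h2, h3⟩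
    have e0 : σ'.reg 0 = n := by rw [ha.reg 0 (by simp [Cmd.writes, hd0.symm]), hn]
    have hlt : (i + 1) ^ g < N := (Nat.pow_le_pow_left (by omega) g).trans_lt hN
    simp only [runs_ite, eval_pow (show 1 < N by omega), eval_plus, eval_var, eval_const, e0, hx,
      Nat.mod_eq_of_lt hnN, Nat.mod_eq_of_lt (show i + 1 < N by omega), Nat.mod_eq_of_lt hlt,
      runs_assign, runs_skip]
    split_ifs with hc
    · simp only [St.set_reg, if_true, if_neg hd]
      refine ⟨by omega, by omega, le_rfl, fun x hx _ => hx⟩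
    · simp only [St.set_reg, if_neg hd]
      refine ⟨by omega, h1, by omega, fun x hx hxn => ?_⟩
      rcases Nat.lt_or_ge x (i + 1) with h | h
      · exact h3 x (by omega) hxn
      · have : x = i + 1 := by omega
        subst this; omega
  · rintro t σ' - - ⟨rfl, h1, h2, h3⟩
    refine ⟨by omega, h1, ?_⟩
    by_contra hc
    have h4 : (σ'.reg dst + 1) ^ g ≤ n := by omega
    have h5 : σ'.reg dst + 1 ≤ (σ'.reg dst + 1) ^ g := Nat.le_self_pow (by omega) _
    have := h3 _ (by omega) h4
    omega

/-- Element number `v 10 + 1` of the input. -/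
abbrev inp : Expr := .get 0 (lit 0) (lit 0) (v 10 + lit 1)

/-- The number of input elements in a residue class. -/
def cls (X : ℕ → ℕ) (n M r : ℕ) : ℕ := ((Finset.range n).filter fun j => X (j + 1) % M = r).card

/-- Count the input elements by residue modulo register `9`, in row `ph`, `v 8` of array `1`. -/
def cntCmd (ph : ℕ) : Cmd :=
  .for 10 0 (.put 1 (lit ph) (v 8) (inp % v 9) (.get 1 (lit ph) (v 8) (inp % v 9) + lit 1))

theorem cls_le (X : ℕ → ℕ) (n M r : ℕ) : cls X n M r ≤ n :=
  (Finset.card_filter_le _ _).trans_eq (Finset.card_range n)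

theorem cls_succ (X : ℕ → ℕ) (n M r : ℕ) :
    cls X (n + 1) M r = cls X n M r + if X (n + 1) % M = r then 1 else 0 := by
  unfold cls
  rw [Finset.range_add_one, Finset.filter_insert]
  split_ifs with h
  · rw [Finset.card_insert_of_notMem (by simp)]
  · rfl

/-- The counters are never reset: every modulus gets its own row, indexed by the phase `ph` and the
number of the candidate, and this row is still zero. -/
theorem cntCmd_spec {ph n i M : ℕ} {X : ℕ → ℕ} {σ : St} (hn : σ.reg 0 = n) (hi : σ.reg 8 = i)
    (hM : σ.reg 9 = M) (hX : ∀ k, 1 ≤ k → k ≤ n → σ.arr 0 0 0 k = X k)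
    (h0 : ∀ r, σ.arr 1 ph i r = 0) (hN : n + 1 < N) :
    Runs N pr κ (cntCmd ph) σ (fun t σ' => t ≤ 3 * n + 2 ∧
      (∀ r, σ'.arr 1 ph i r = cls X n M r) ∧
      ∀ a b r, ¬(a = ph ∧ b = i) → σ'.arr 1 a b r = σ.arr 1 a b r) := by
  refine Runs.for_of_invariant (by simp [Cmd.writes]) (by simp [Cmd.writes])
    (by norm_num) (by omega) hn (fun j t σ' => t = j ∧ (∀ r, σ'.arr 1 ph i r = cls X j M r) ∧
      ∀ a b r, ¬(a = ph ∧ b = i) → σ'.arr 1 a b r = σ.arr 1 a b r) ?_ ?_ ?_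
  · exact ⟨rfl, fun r => by simp [h0, cls], fun _ _ _ _ => rfl⟩
  · rintro j t σ' hj hx ha ⟨rfl, h1, h2⟩
    have e8 : σ'.reg 8 = i := by rw [ha.reg 8 (by simp [Cmd.writes]), hi]
    have e9 : σ'.reg 9 = M := by rw [ha.reg 9 (by simp [Cmd.writes]), hM]
    have eX : σ'.arr 0 0 0 (t + 1) = X (t + 1) := by
      rw [ha.arr 0 (by simp [Cmd.tags]), hX _ (by omega) (by omega)]
    have hlt : cls X t M (X (t + 1) % M) + 1 < N := by
      have := cls_le X t M (X (t + 1) % M)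
      omega
    simp only [runs_put, eval_plus, eval_rem, eval_var, eval_const, eval_get, hx, e8, e9, eX, h1,
      Nat.mod_eq_of_lt (show t + 1 < N by omega), Nat.mod_eq_of_lt hlt, St.set_arr, St.put_arr,
      true_and]
    refine ⟨fun r => ?_, fun a b r hab => ?_⟩
    · rw [cls_succ]
      by_cases h : X (t + 1) % M = r
      · simp [h]
      · rw [if_neg (fun h' => h h'.symm), if_neg h, add_zero]
    · rw [if_neg (by tauto), h2 a b r hab]
  · rintro t σ' - - ⟨rfl, h1, h2⟩
    exact ⟨by omega, h1, h2⟩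

/-- Sum the sizes of the residue classes of the input elements in register `11`. -/
def collCmd (ph : ℕ) : Cmd :=
  .assign 11 (lit 0) ;; .for 10 0 (.assign 11 (v 11 + .get 1 (lit ph) (v 8) (inp % v 9)))

/-- Adding the class sizes over the elements gives the number of colliding ordered pairs in linear
time. -/
theorem collCmd_spec {ph n i M : ℕ} {X : ℕ → ℕ} {σ : St} (hn : σ.reg 0 = n) (hi : σ.reg 8 = i)
    (hM : σ.reg 9 = M) (hX : ∀ k, 1 ≤ k → k ≤ n → σ.arr 0 0 0 k = X k)
    (h0 : ∀ r, σ.arr 1 ph i r = cls X n M r) (hN : n * n + 1 < N) :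
    Runs N pr κ (collCmd ph) σ (fun t σ' => t ≤ 3 * n + 3 ∧
      σ'.reg 11 = ∑ j ∈ Finset.range n, cls X n M (X (j + 1) % M)) := by
  have hnn : n ≤ n * n := Nat.le_mul_self n
  rw [collCmd, runs_seq, runs_assign]
  refine Runs.for_of_invariant (by simp [Cmd.writes]) (by simp [Cmd.writes])
    (by norm_num) (show n < N by omega) (by simp [hn]) (fun j t σ' => t = j ∧
      σ'.reg 11 = ∑ j ∈ Finset.range j, cls X n M (X (j + 1) % M)) ?_ ?_ ?_
  · exact ⟨rfl, by simp⟩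
  · rintro j t σ' hj hx ha ⟨rfl, h1⟩
    have e8 : σ'.reg 8 = i := by rw [ha.reg 8 (by simp [Cmd.writes])]; simp [hi]
    have e9 : σ'.reg 9 = M := by rw [ha.reg 9 (by simp [Cmd.writes])]; simp [hM]
    have eX : σ'.arr 0 0 0 (t + 1) = X (t + 1) := by
      rw [ha.arr 0 (by simp [Cmd.tags]), St.set_arr, hX _ (by omega) (by omega)]
    have e1 : σ'.arr 1 = σ.arr 1 := ha.arr 1 (by simp [Cmd.tags])
    have hlt : ∑ j ∈ Finset.range (t + 1), cls X n M (X (j + 1) % M) < N := by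
      have h2 : ∑ j ∈ Finset.range (t + 1), cls X n M (X (j + 1) % M) ≤ (t + 1) * n := by
        refine (Finset.sum_le_card_nsmul _ _ n fun j _ => cls_le _ _ _ _).trans_eq ?_
        simp
      have h3 := Nat.mul_le_mul_right n (show t + 1 ≤ n by omega)
      omega
    rw [Finset.sum_range_succ] at hlt
    simp only [runs_assign, eval_plus, eval_rem, eval_var, eval_const, eval_get, hx, e8, e9, eX, h1,
      Nat.mod_eq_of_lt (show t + 1 < N by omega), e1, h0, Nat.mod_eq_of_lt hlt, St.set_reg,
      true_and]
    simp [Finset.sum_range_succ]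
  · rintro t σ' - - ⟨rfl, h1⟩
    exact ⟨by omega, h1⟩

/-- Find the number `q` from the value `lo` of register `7` to `2 * lo - 1` for which `body`
computes the smallest value, for the modulus `v 6 * q` in register `9`; the result is in
register `13`. -/
def argminCmd (ph : ℕ) (body : Cmd) : Cmd :=
  .assign 12 (.bin .msub (lit 0) (lit 1)) ;;
  .for 8 7 (.assign 9 (v 6 * (v 7 + v 8)) ;; cntCmd ph ;; body ;;
    .ite (v 11) (v 12) (.assign 12 (v 11) ;; .assign 13 (v 7 + v 8)) .skip)

theorem argminCmd_spec {ph n P lo Tb : ℕ} {X : ℕ → ℕ} {σ : St} {body : Cmd} {V : ℕ → ℕ}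
    (hn : σ.reg 0 = n) (hP : σ.reg 6 = P) (hlo : σ.reg 7 = lo) (hlo1 : 1 ≤ lo) (hP1 : 1 ≤ P)
    (hX : ∀ k, 1 ≤ k → k ≤ n → σ.arr 0 0 0 k = X k)
    (h0 : ∀ i r, σ.arr 1 ph i r = 0) (hN : n + 1 < N) (hlN : P * (2 * lo) < N)
    (hw : ∀ z ∈ [0, 6, 7, 8, 9, 12, 13], z ∉ body.writes) (hta : 0 ∉ body.tags)
    (htb : 1 ∉ body.tags)
    (hV : ∀ i < lo, V (P * (lo + i)) + 1 < N)
    (hbody : ∀ i < lo, ∀ σ', Agree ([8, 9, 10, 11, 12, 13] ++ body.writes) (1 :: body.tags) σ σ' →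
      σ'.reg 8 = i → σ'.reg 9 = P * (lo + i) →
      (∀ r, σ'.arr 1 ph i r = cls X n (P * (lo + i)) r) →
      Runs N pr κ body σ' (fun t σ'' => t ≤ Tb ∧ σ''.reg 11 = V (P * (lo + i)))) :
    Runs N pr κ (argminCmd ph body) σ (fun t σ' => t ≤ lo * (Tb + 3 * n + 8) + 3 ∧
      lo ≤ σ'.reg 13 ∧ σ'.reg 13 < 2 * lo ∧
      (∀ i < lo, V (P * σ'.reg 13) ≤ V (P * (lo + i))) ∧
      ∀ a i r, a ≠ ph → σ'.arr 1 a i r = σ.arr 1 a i r) := by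
  have h2lo : 2 * lo ≤ P * (2 * lo) := Nat.le_mul_of_pos_left _ (by omega)
  have wr : ∀ z, z ∉ body.writes → z ∉ [8, 9, 10, 12, 13] → z ∉ (8 :: Cmd.writes
      (.assign 9 (v 6 * (v 7 + v 8)) ;; cntCmd ph ;; body ;;
    .ite (v 11) (v 12) (.assign 12 (v 11) ;; .assign 13 (v 7 + v 8)) .skip)) := by
    intro z h1 h2
    simp at h2
    simp [Cmd.writes, cntCmd, Cmd.for, h1, h2]
  have wr' : ∀ z, z ∉ ([8, 9, 10, 11, 12, 13] ++ body.writes) → z ∉ (8 :: Cmd.writes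
      (.assign 9 (v 6 * (v 7 + v 8)) ;; cntCmd ph ;; body ;;
    .ite (v 11) (v 12) (.assign 12 (v 11) ;; .assign 13 (v 7 + v 8)) .skip)) := by
    intro z h1
    simp at h1
    refine wr z (by tauto) (by simp; tauto)
  have wt : ∀ z, z ∉ (1 :: body.tags) → z ∉ Cmd.tags
      (.assign 9 (v 6 * (v 7 + v 8)) ;; cntCmd ph ;; body ;;
    .ite (v 11) (v 12) (.assign 12 (v 11) ;; .assign 13 (v 7 + v 8)) .skip) := by
    intro z h1
    simp at h1
    simp [Cmd.tags, cntCmd, Cmd.for, h1]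
  rw [argminCmd, runs_seq, runs_assign]
  refine Runs.for_of_invariant (k := lo) ?_ ?_ (by norm_num) (by omega) (by simp [hlo])
    (fun i t σ' => t ≤ i * (Tb + 3 * n + 6) ∧
      (i = 0 ∧ σ'.reg 12 = N - 1 ∨ lo ≤ σ'.reg 13 ∧ σ'.reg 13 < lo + i ∧
        σ'.reg 12 = V (P * σ'.reg 13) ∧ ∀ i' < i, V (P * σ'.reg 13) ≤ V (P * (lo + i'))) ∧
      (∀ i' ≥ i, ∀ r, σ'.arr 1 ph i' r = 0) ∧
      ∀ a i r, a ≠ ph → σ'.arr 1 a i r = σ.arr 1 a i r) ?_ ?_ ?_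
  · have := hw 8 (by simp)
    simp [Cmd.writes, cntCmd, Cmd.for, this]
  · have := hw 7 (by simp)
    simp [Cmd.writes, cntCmd, Cmd.for, this]
  -- The running minimum starts at `0 - 1 = N - 1` modulo `N`. Since `V + 1 < N` for every
  -- candidate, the first one already improves on it, so register `13` is always set.
  · refine ⟨by simp, .inl ⟨rfl, ?_⟩, fun i _ r => h0 i r, fun _ _ _ _ => rfl⟩
    simp only [St.set_reg, eval_msub, eval_const]
    simp [Nat.mod_eq_of_lt (show 1 < N by omega), Nat.mod_eq_of_lt (show N - 1 < N by omega)]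
  · rintro i t σ' hi hx ha ⟨ht, hb, hz, ho⟩
    have e0 : σ'.reg 0 = n := by
      rw [ha.reg 0 (wr 0 (hw 0 (by simp)) (by simp))]; simp [hn]
    have e6 : σ'.reg 6 = P := by
      rw [ha.reg 6 (wr 6 (hw 6 (by simp)) (by simp))]; simp [hP]
    have e7 : σ'.reg 7 = lo := by
      rw [ha.reg 7 (wr 7 (hw 7 (by simp)) (by simp))]; simp [hlo]
    have hs1 : P * (lo + i) < N := lt_of_le_of_lt (Nat.mul_le_mul_left _ (by omega)) hlN
    have hs2 : lo + i < N := by omega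
    simp only [runs_seq, runs_assign, eval_mul, eval_plus, eval_var, e6, e7, hx,
      Nat.mod_eq_of_lt hs2, Nat.mod_eq_of_lt hs1]
    have a0 : (σ'.set 9 (P * (lo + i))).arr 0 = σ.arr 0 := by
      rw [St.set_arr, ha.arr 0 (wt 0 (by simp [hta]))]; rfl
    refine (cntCmd_spec (σ := σ'.set 9 (P * (lo + i))) (n := n) (i := i) (M := P * (lo + i)) (X := X)
      (by simp [e0]) (by simp [hx]) (by simp) (fun k h1 h2 => by
      rw [a0, hX k h1 h2]) (fun r => hz i le_rfl r) hN).mono ?_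
    rintro t₁ σ₁ ag₁ ⟨ht₁, hc₁, ho₁⟩
    have w1 : ∀ z, z ≠ 10 → σ₁.reg z = (σ'.set 9 (P * (lo + i))).reg z := fun z hz =>
      ag₁.reg z (by simpa [cntCmd, Cmd.for, Cmd.writes] using hz)
    have ag : Agree ([8, 9, 10, 11, 12, 13] ++ body.writes) (1 :: body.tags) σ σ₁ := by
      refine ⟨fun z hz => ?_, fun z hz => ?_⟩
      · have h1 : z ≠ 10 ∧ z ≠ 9 ∧ z ≠ 12 := by simp at hz; tauto
        rw [w1 z h1.1, St.set_reg, if_neg h1.2.1, ha.reg z (wr' z hz), St.set_reg, if_neg h1.2.2]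
      · have h1 : z ≠ 1 := by simp at hz; tauto
        rw [ag₁.arr z (by simpa [cntCmd, Cmd.for, Cmd.tags] using h1), St.set_arr,
          ha.arr z (wt z hz)]; rfl
    refine (hbody i hi σ₁ ag (by rw [w1 8 (by norm_num)]; simp [hx])
      (by rw [w1 9 (by norm_num)]; simp) hc₁).mono ?_
    rintro t₂ σ₂ ag₂ ⟨ht₂, hv₂⟩
    have w2 : ∀ z ∈ [7, 8, 12, 13], σ₂.reg z = σ'.reg z := fun z hz => by
      rw [ag₂.reg z (hw z (by simp at hz ⊢; tauto)), w1 z (by rintro rfl; simp at hz)]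
      rw [St.set_reg, if_neg (by rintro rfl; simp at hz)]
    have w7 := w2 7 (by simp)
    have w8 := w2 8 (by simp)
    have w12 := w2 12 (by simp)
    have w13 := w2 13 (by simp)
    have harr : (∀ i' ≥ i + 1, ∀ r, σ₂.arr 1 ph i' r = 0) ∧
        ∀ a i r, a ≠ ph → σ₂.arr 1 a i r = σ.arr 1 a i r := by
      rw [ag₂.arr 1 htb]
      refine ⟨fun i' hi' r => ?_, fun a i' r h => ?_⟩
      · rw [ho₁ _ _ _ (by omega)]; exact hz i' (by omega) r
      · rw [ho₁ _ _ _ (by tauto)]; exact ho a i' r h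
    simp only [runs_ite, runs_seq, runs_assign, runs_skip, eval_var, hv₂, w12, eval_plus]
    simp only [St.set_reg, St.set_arr, Nat.reduceEqDiff, ↓reduceIte, w7, w8, w12, w13, hx, e7,
      Nat.mod_eq_of_lt hs2]
    have hmul : (i + 1) * (Tb + 3 * n + 6) = i * (Tb + 3 * n + 6) + (Tb + 3 * n + 6) := by ring
    split_ifs with hlt
    · refine ⟨by omega, .inr ⟨by omega, by omega, trivial, fun i' hi' => ?_⟩, harr⟩
      rcases Nat.lt_succ_iff_lt_or_eq.1 hi' with h | rfl
      · rcases hb with ⟨rfl, _⟩ | ⟨_, _, h3, h4⟩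
        · omega
        · have := h4 i' h
          omega
      · exact le_rfl
    · refine ⟨by omega, .inr ?_, harr⟩
      rcases hb with ⟨rfl, h⟩ | ⟨h1, h2, h3, h4⟩
      · exfalso
        have := hV 0 hi
        omega
      · refine ⟨h1, by omega, h3, fun i' hi' => ?_⟩
        rcases Nat.lt_succ_iff_lt_or_eq.1 hi' with h | rfl
        · exact h4 i' h
        · omega
  · rintro t σ' - - ⟨ht, hb, hz, ho⟩
    rcases hb with ⟨h, _⟩ | ⟨h1, h2, h3, h4⟩
    · omega
    · have : lo * (Tb + 3 * n + 8) = lo * (Tb + 3 * n + 6) + 2 * lo := by ring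
      exact ⟨by omega, h1, by omega, h4, ho⟩

end
end HL

/-! ### Counting solutions of `a + b = c` in residue classes by Karatsuba's method -/

namespace HL
open WordRAM Finset

/-- The sum of `f x * f y * G (x + y)` for `x, y < 2 ^ k`. -/
def triSum {R : Type*} [CommRing R] (k : ℕ) (f G : ℕ → R) : R :=
  ∑ x ∈ range (2 ^ k), ∑ y ∈ range (2 ^ k), f x * f y * G (x + y)

/-- Karatsuba's identity in transposed form. With the halves `f₀`, `f₁` of `f` and the shifts `G₀`,
`G₁`, `G₂` of `G`, the expression `f₀ f₀ G₀ + 2 f₀ f₁ G₁ + f₁ f₁ G₂` equals `f₀ f₀ (G₀ - G₁) + f₁ f₁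
(G₂ - G₁) + (f₀ + f₁) (f₀ + f₁) G₁`: three sums of the same kind and half the size. The subtractions
are the reason for working in a ring. -/
theorem triSum_succ {R : Type*} [CommRing R] (k : ℕ) (f G : ℕ → R) :
    triSum (k + 1) f G = triSum k f (fun z => G z - G (z + 2 ^ k)) +
      triSum k (fun x => f (x + 2 ^ k)) (fun z => G (z + 2 * 2 ^ k) - G (z + 2 ^ k)) +
      triSum k (fun x => f x + f (x + 2 ^ k)) (fun z => G (z + 2 ^ k)) := by
  unfold triSum
  have h2 : 2 ^ (k + 1) = 2 ^ k + 2 ^ k := by ring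
  simp_rw [h2, sum_range_add, ← sum_add_distrib]
  refine sum_congr rfl fun x _ => sum_congr rfl fun y _ => ?_
  rw [show x + (2 ^ k + y) = x + y + 2 ^ k by ring, show 2 ^ k + x + y = x + y + 2 ^ k by ring,
    show 2 ^ k + x + (2 ^ k + y) = x + y + 2 * 2 ^ k by ring, add_comm (2 ^ k) x,
    add_comm (2 ^ k) y]
  ring

theorem triSum_congr {R : Type*} [CommRing R] {k : ℕ} {f f' G G' : ℕ → R}
    (hf : ∀ x < 2 ^ k, f x = f' x) (hG : ∀ z < 2 * 2 ^ k, G z = G' z) :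
    triSum k f G = triSum k f' G' := by
  refine sum_congr rfl fun x hx => sum_congr rfl fun y hy => ?_
  rw [mem_range] at hx hy
  rw [hf x hx, hf y hy, hG _ (by omega)]

theorem sum_range_three_mul {R : Type*} [AddCommMonoid R] (g : ℕ → R) (J : ℕ) :
    ∑ i ∈ range (3 * J), g i = ∑ j ∈ range J, (g (3 * j) + g (3 * j + 1) + g (3 * j + 2)) := by
  induction J with
  | zero => simp
  | succ J ih =>
    rw [show 3 * (J + 1) = 3 * J + 1 + 1 + 1 by ring, sum_range_succ, sum_range_succ,
      sum_range_succ, ih, sum_range_succ]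
    abel

section
variable {N κ : ℕ} {pr : Prog}

/-- Fill the first `v y` cells of row `0`, `0` of array `tag` with the values of `e`. -/
def tabCmd (tag y : ℕ) (e : Expr) : Cmd := .for 17 y (.put tag (lit 0) (lit 0) (v 17) e)

theorem tabCmd_spec {tag y k : ℕ} {e : Expr} {σ : St} {w : ℕ → ℕ} (hy : σ.reg y = k) (hy17 : y ≠ 17)
    (hk : k < N)
    (he : ∀ x < k, ∀ σ', (∀ z, z ≠ 17 → σ'.reg z = σ.reg z) → (∀ t, t ≠ tag → σ'.arr t = σ.arr t) →
      σ'.reg 17 = x → e.eval N σ' = w x) :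
    Runs N pr κ (tabCmd tag y e) σ (fun t σ' => t ≤ 3 * k + 2 ∧
      ∀ x < k, σ'.arr tag 0 0 x = w x) := by
  refine Runs.for_of_invariant (by simp [Cmd.writes]) (by simp [Cmd.writes]) hy17.symm hk hy
    (fun i t σ' => t = i ∧ ∀ x < i, σ'.arr tag 0 0 x = w x) ?_ ?_ ?_
  · simp
  · rintro i t σ' hi hx ha ⟨rfl, h1⟩
    have hev := he t hi σ' (fun z hz => ha.reg z (by simpa [Cmd.writes] using hz))
      (fun z hz => ha.arr z (by simpa [Cmd.tags] using hz)) hx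
    simp only [runs_put, eval_const, eval_var, hx, hev, St.set_arr, St.put_arr, true_and]
    intro x hxt
    split_ifs with h
    · rw [h]
    · exact h1 x (by omega)
  · rintro t σ' - - ⟨rfl, h1⟩
    exact ⟨by omega, h1⟩

/-- Fill three rows of the next level of array `tag`. -/
def fillCmd (tag y : ℕ) (e₀ e₁ e₂ : Expr) : Cmd :=
  .for 17 y (.put tag (v 20 + lit 1) (lit 3 * v 22) (v 17) e₀ ;;
    .put tag (v 20 + lit 1) (lit 3 * v 22 + lit 1) (v 17) e₁ ;;
    .put tag (v 20 + lit 1) (lit 3 * v 22 + lit 2) (v 17) e₂)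

/-- Node `j` of level `t` has the children `3 j`, `3 j + 1`, `3 j + 2` on level `t + 1`. The
expressions read level `t` only, so the writes do not disturb their values. -/
theorem fillCmd_spec {tag y k t j : ℕ} {e₀ e₁ e₂ : Expr} {σ : St} {w₀ w₁ w₂ : ℕ → ℕ}
    (hy : σ.reg y = k) (hy17 : y ≠ 17) (hk : k < N) (ht : σ.reg 20 = t) (hj : σ.reg 22 = j)
    (htN : t + 1 < N) (hjN : 3 * j + 2 < N)
    (he : ∀ x < k, ∀ σ', (∀ z, z ≠ 17 → σ'.reg z = σ.reg z) →
      (∀ b x, σ'.arr tag t b x = σ.arr tag t b x) → σ'.reg 17 = x →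
      e₀.eval N σ' = w₀ x ∧ e₁.eval N σ' = w₁ x ∧ e₂.eval N σ' = w₂ x) :
    Runs N pr κ (fillCmd tag y e₀ e₁ e₂) σ (fun T σ' => T ≤ 5 * k + 2 ∧
      (∀ x < k, σ'.arr tag (t + 1) (3 * j) x = w₀ x ∧ σ'.arr tag (t + 1) (3 * j + 1) x = w₁ x ∧
        σ'.arr tag (t + 1) (3 * j + 2) x = w₂ x) ∧
      ∀ a b x, ¬(a = t + 1 ∧ b / 3 = j) → σ'.arr tag a b x = σ.arr tag a b x) := by
  refine Runs.for_of_invariant (by simp [Cmd.writes]) (by simp [Cmd.writes]) hy17.symm hk hy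
    (fun i T σ' => T = 3 * i ∧ (∀ x < i, σ'.arr tag (t + 1) (3 * j) x = w₀ x ∧
        σ'.arr tag (t + 1) (3 * j + 1) x = w₁ x ∧
        σ'.arr tag (t + 1) (3 * j + 2) x = w₂ x) ∧
      ∀ a b x, ¬(a = t + 1 ∧ b / 3 = j) → σ'.arr tag a b x = σ.arr tag a b x) ?_ ?_ ?_
  · simp
  · rintro i T σ' hi hx ha ⟨rfl, h1, h2⟩
    have hr : ∀ z, z ≠ 17 → σ'.reg z = σ.reg z :=
      fun z hz => ha.reg z (by simpa [Cmd.writes] using hz)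
    have e20 : σ'.reg 20 = t := by rw [hr 20 (by norm_num), ht]
    have e22 : σ'.reg 22 = j := by rw [hr 22 (by norm_num), hj]
    have hd0 : 3 * j / 3 = j := by omega
    have hd1 : (3 * j + 1) / 3 = j := by omega
    have hd2 : (3 * j + 2) / 3 = j := by omega
    have hv0 := (he i hi σ' hr (fun b x => h2 t b x (by omega)) hx).1
    simp only [runs_seq, runs_put, eval_const, eval_var, eval_plus, eval_mul, hx, e20, e22,
      St.put_reg, Nat.mod_eq_of_lt htN, Nat.mod_eq_of_lt (show 3 * j < N by omega),
      Nat.mod_eq_of_lt (show 3 * j + 1 < N by omega), Nat.mod_eq_of_lt hjN, hv0]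
    have hv1 := (he i hi (σ'.put tag (t + 1) (3 * j) i (w₀ i)) hr (fun b x => by
      rw [St.put_arr, if_neg (by omega), h2 t b x (by omega)]) hx).2.1
    simp only [hv1]
    have hv2 := (he i hi ((σ'.put tag (t + 1) (3 * j) i (w₀ i)).put tag (t + 1) (3 * j + 1) i
      (w₁ i)) hr (fun b x => by
      rw [St.put_arr, St.put_arr, if_neg (by omega), if_neg (by omega), h2 t b x (by omega)])
      hx).2.2
    simp only [hv2, St.set_arr, St.put_arr, true_and]
    refine ⟨by omega, fun x hxi => ?_, fun a b x hab => ?_⟩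
    · rcases Nat.lt_succ_iff_lt_or_eq.1 hxi with h | rfl
      · obtain ⟨g0, g1, g2⟩ := h1 x h
        simp only [show x ≠ i by omega, and_false, if_false]
        exact ⟨g0, g1, g2⟩
      · simp
    · rw [if_neg (by rintro ⟨h, h', _⟩; omega), if_neg (by rintro ⟨h, h', _⟩; omega),
        if_neg (by rintro ⟨h, h', _⟩; omega), h2 a b x hab]
  · rintro T σ' - - ⟨rfl, h1, h2⟩
    exact ⟨by omega, h1, h2⟩

/-- An entry of the current level, shifted by a multiple of `v 19`. -/
abbrev cur (tag k : ℕ) : Expr := .get tag (v 20) (v 22) (v 17 + lit k * v 19)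

/-- One level of Karatsuba's recursion. -/
def levelCmd : Cmd :=
  .for 22 18 (fillCmd 2 19 (cur 2 0) (cur 2 1) (cur 2 0 + cur 2 1) ;;
    fillCmd 3 21 (.bin .msub (cur 3 0) (cur 3 1)) (.bin .msub (cur 3 2) (cur 3 1)) (cur 3 1))

theorem levelCmd_spec {t J H : ℕ} {σ : St} (ht : σ.reg 20 = t) (hJ : σ.reg 18 = J)
    (hH : σ.reg 19 = H) (hH2 : σ.reg 21 = 2 * H) (htN : t + 1 < N) (hJN : 3 * J < N)
    (hHN : 4 * H < N) :
    Runs N pr κ levelCmd σ (fun T σ' => T ≤ J * (15 * H + 6) + 2 ∧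
      ∀ j < J, (∀ x < H, σ'.arr 2 (t + 1) (3 * j) x = σ.arr 2 t j x ∧
          σ'.arr 2 (t + 1) (3 * j + 1) x = σ.arr 2 t j (x + H) ∧
          σ'.arr 2 (t + 1) (3 * j + 2) x = (σ.arr 2 t j x + σ.arr 2 t j (x + H)) % N) ∧
        ∀ z < 2 * H, σ'.arr 3 (t + 1) (3 * j) z =
            (σ.arr 3 t j z + (N - σ.arr 3 t j (z + H) % N)) % N ∧
          σ'.arr 3 (t + 1) (3 * j + 1) z =
            (σ.arr 3 t j (z + 2 * H) + (N - σ.arr 3 t j (z + H) % N)) % N ∧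
          σ'.arr 3 (t + 1) (3 * j + 2) z = σ.arr 3 t j (z + H)) := by
  refine Runs.for_of_invariant (by simp [Cmd.writes, fillCmd, Cmd.for])
    (by simp [Cmd.writes, fillCmd, Cmd.for]) (by norm_num) (by omega) hJ
    (fun j T σ' => T ≤ j * (15 * H + 4) ∧
      (∀ j' < j, (∀ x < H, σ'.arr 2 (t + 1) (3 * j') x = σ.arr 2 t j' x ∧
          σ'.arr 2 (t + 1) (3 * j' + 1) x = σ.arr 2 t j' (x + H) ∧
          σ'.arr 2 (t + 1) (3 * j' + 2) x = (σ.arr 2 t j' x + σ.arr 2 t j' (x + H)) % N) ∧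
        ∀ z < 2 * H, σ'.arr 3 (t + 1) (3 * j') z =
            (σ.arr 3 t j' z + (N - σ.arr 3 t j' (z + H) % N)) % N ∧
          σ'.arr 3 (t + 1) (3 * j' + 1) z =
            (σ.arr 3 t j' (z + 2 * H) + (N - σ.arr 3 t j' (z + H) % N)) % N ∧
          σ'.arr 3 (t + 1) (3 * j' + 2) z = σ.arr 3 t j' (z + H)) ∧
      (∀ b x, σ'.arr 2 t b x = σ.arr 2 t b x) ∧ ∀ b x, σ'.arr 3 t b x = σ.arr 3 t b x) ?_ ?_ ?_
  · simp
  · rintro j T σ' hj hx ha ⟨hT, h1, h2, h3⟩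
    have hr : ∀ z, z ≠ 17 → z ≠ 22 → σ'.reg z = σ.reg z :=
      fun z hz hz' => ha.reg z (by simp [Cmd.writes, fillCmd, Cmd.for, hz, hz'])
    have e20 : σ'.reg 20 = t := by rw [hr 20 (by norm_num) (by norm_num), ht]
    have e19 : σ'.reg 19 = H := by rw [hr 19 (by norm_num) (by norm_num), hH]
    have e21 : σ'.reg 21 = 2 * H := by rw [hr 21 (by norm_num) (by norm_num), hH2]
    rw [runs_seq]
    refine (fillCmd_spec (k := H) (t := t) (j := j) (w₀ := fun x => σ.arr 2 t j x)
      (w₁ := fun x => σ.arr 2 t j (x + H))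
      (w₂ := fun x => (σ.arr 2 t j x + σ.arr 2 t j (x + H)) % N) e19 (by norm_num) (by omega) e20 hx
      htN (by omega) ?_).mono ?_
    · intro x hxH σ'' g1 g2 g3
      simp only [eval_get, eval_var, eval_plus, eval_mul, eval_const, g3, g1 20 (by norm_num),
        g1 22 (by norm_num), g1 19 (by norm_num), e20, e19, hx, g2, h2, zero_mul, one_mul,
        Nat.zero_mod, add_zero, Nat.mod_eq_of_lt (show x < N by omega),
        Nat.mod_eq_of_lt (show H < N by omega), Nat.mod_eq_of_lt (show x + H < N by omega)]
      trivial
    rintro T₁ σ₁ ag₁ ⟨hT₁, f₁, o₁⟩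
    have r₁ : ∀ z, z ≠ 17 → σ₁.reg z = σ'.reg z := fun z hz =>
      ag₁.reg z (by simp [Cmd.writes, fillCmd, Cmd.for, hz])
    have a₁ : ∀ z, z ≠ 2 → σ₁.arr z = σ'.arr z := fun z hz =>
      ag₁.arr z (by simp [Cmd.tags, fillCmd, Cmd.for, hz])
    refine (fillCmd_spec (k := 2 * H) (t := t) (j := j)
      (w₀ := fun z => (σ.arr 3 t j z + (N - σ.arr 3 t j (z + H) % N)) % N)
      (w₁ := fun z => (σ.arr 3 t j (z + 2 * H) + (N - σ.arr 3 t j (z + H) % N)) % N)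
      (w₂ := fun z => σ.arr 3 t j (z + H)) (by rw [r₁ 21 (by norm_num), e21]) (by norm_num)
      (by omega) (by rw [r₁ 20 (by norm_num), e20]) (by rw [r₁ 22 (by norm_num), hx])
      htN (by omega) ?_).mono ?_
    · intro x hxH σ'' g1 g2 g3
      simp only [eval_get, eval_var, eval_plus, eval_mul, eval_const, eval_msub, g3,
        g1 20 (by norm_num), g1 22 (by norm_num), g1 19 (by norm_num), r₁ 20 (by norm_num),
        r₁ 22 (by norm_num), r₁ 19 (by norm_num), a₁ 3 (by norm_num), e20, e19, hx, g2, h3,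
        zero_mul, one_mul, Nat.zero_mod, add_zero, Nat.mod_eq_of_lt (show x < N by omega),
        Nat.mod_eq_of_lt (show H < N by omega), Nat.mod_eq_of_lt (show x + H < N by omega),
        Nat.mod_eq_of_lt (show 2 * H < N by omega), Nat.mod_eq_of_lt (show x + 2 * H < N by omega)]
      trivial
    rintro T₂ σ₂ ag₂ ⟨hT₂, f₂, o₂⟩
    have a₂ : σ₂.arr 2 = σ₁.arr 2 := ag₂.arr 2 (by simp [Cmd.tags, fillCmd, Cmd.for])
    have a₃ := a₁ 3 (by norm_num)
    simp only [St.set_arr, a₂]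
    refine ⟨?_, fun j' hj' => ?_, fun b x => ?_, fun b x => ?_⟩
    · have : (j + 1) * (15 * H + 4) = j * (15 * H + 4) + (15 * H + 4) := by ring
      omega
    · rcases Nat.lt_succ_iff_lt_or_eq.1 hj' with h | rfl
      · obtain ⟨u1, u2⟩ := h1 j' h
        refine ⟨fun x hxH => ?_, fun z hz => ?_⟩
        · rw [o₁ _ _ _ (by omega), o₁ _ _ _ (by omega), o₁ _ _ _ (by omega)]
          exact u1 x hxH
        · rw [o₂ _ _ _ (by omega), o₂ _ _ _ (by omega), o₂ _ _ _ (by omega), a₃]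
          exact u2 z hz
      · exact ⟨f₁, f₂⟩
    · rw [o₁ _ _ _ (by omega), h2]
    · rw [o₂ _ _ _ (by omega), a₃, h3]
  · rintro T σ' - - ⟨hT, h1, -, -⟩
    have : J * (15 * H + 6) = J * (15 * H + 4) + 2 * J := by ring
    exact ⟨by omega, h1⟩

/-- The value of level `t` of the recursion of depth `l`. -/
def levelSum (N l t : ℕ) (σ : St) : ZMod N :=
  ∑ j ∈ range (3 ^ t), triSum (l - t) (fun x => (σ.arr 2 t j x : ZMod N))
    (fun z => (σ.arr 3 t j z : ZMod N))

theorem cast_msub {N : ℕ} (hN : 0 < N) (a b : ℕ) :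
    (((a + (N - b % N)) % N : ℕ) : ZMod N) = a - b := by
  rw [ZMod.natCast_mod, Nat.cast_add, Nat.cast_sub (Nat.mod_lt _ hN).le, ZMod.natCast_self,
    ZMod.natCast_mod]
  ring

/-- Karatsuba's recursion of depth `v 15`, on arrays `2` and `3`; the result is in
register `11`. -/
def karCmd : Cmd :=
  .assign 18 (lit 1) ;; .assign 19 (v 16) ;;
  .for 20 15 (.assign 21 (v 19) ;; .assign 19 (v 19 / lit 2) ;; levelCmd ;;
    .assign 18 (lit 3 * v 18)) ;;
  .assign 11 (lit 0) ;;
  .for 22 18 (.assign 11 (v 11 + .get 2 (v 20) (v 22) (lit 0) * .get 2 (v 20) (v 22) (lit 0) *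
    .get 3 (v 20) (v 22) (lit 0)))

/-- The recursion runs breadth first, and `levelSum` is the same on all levels. Level `t` costs
about `3 ^ t * 2 ^ (l - t)`, a geometric series dominated by its last term `3 ^ l`. -/
theorem karCmd_spec {l : ℕ} {σ : St} (hl : σ.reg 15 = l) (hT : σ.reg 16 = 2 ^ l)
    (hN : 4 * 3 ^ l < N) :
    Runs N pr κ karCmd σ (fun T σ' => T ≤ 36 * 3 ^ l + 9 ∧
      (σ'.reg 11 : ZMod N) = levelSum N l 0 σ ∧ σ'.reg 11 < N) := by
  have h3 : ∀ t, 1 ≤ 3 ^ t := fun t => Nat.one_le_pow _ _ (by norm_num)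
  have h23 : 2 ^ l ≤ 3 ^ l := Nat.pow_le_pow_left (by norm_num) l
  have hl2 : l < 2 ^ l := Nat.lt_two_pow_self
  have hN0 : 0 < N := by omega
  rw [karCmd]
  simp only [runs_seq, runs_assign, eval_const, eval_var]
  refine Runs.for_of_invariant (k := l) (by simp [Cmd.writes, levelCmd, fillCmd, Cmd.for])
    (by simp [Cmd.writes, levelCmd, fillCmd, Cmd.for]) (by norm_num) (by omega) (by simp [hl])
    (fun t T σ' => T ≤ 28 * 3 ^ t * 2 ^ (l - t) ∧ σ'.reg 18 = 3 ^ t ∧ σ'.reg 19 = 2 ^ (l - t) ∧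
      levelSum N l t σ' = levelSum N l 0 σ) ?_ ?_ ?_
  · refine ⟨by simp, by simp, by simp [hT], rfl⟩
  · rintro t T σ' ht hx ha ⟨hT', e18, e19, hs⟩
    have hk : 2 ^ (l - t) = 2 * 2 ^ (l - (t + 1)) := by
      rw [show l - t = (l - (t + 1)) + 1 by omega, pow_succ]; ring
    set k := l - (t + 1) with hkdef
    have hk1 : 1 ≤ 2 ^ k := Nat.one_le_two_pow
    have hprod : 3 ^ (t + 1) * 2 ^ k ≤ 3 ^ l := by
      calc 3 ^ (t + 1) * 2 ^ k ≤ 3 ^ (t + 1) * 3 ^ k :=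
            Nat.mul_le_mul_left _ (Nat.pow_le_pow_left (by norm_num) k)
        _ = 3 ^ l := by rw [← pow_add]; congr 1; omega
    have hb1 : 3 ^ (t + 1) ≤ 3 ^ (t + 1) * 2 ^ k := Nat.le_mul_of_pos_right _ (by omega)
    have hb2 : 2 ^ k ≤ 3 ^ (t + 1) * 2 ^ k := Nat.le_mul_of_pos_left _ (h3 _)
    have hb3 : 3 * 3 ^ t = 3 ^ (t + 1) := by rw [pow_succ]; ring
    simp only [runs_seq, runs_assign, eval_var, eval_div, eval_const, St.set_reg, e19, hk,
      Nat.reduceEqDiff, ↓reduceIte, Nat.mul_div_cancel_left _ (show 0 < 2 by norm_num)]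
    refine (levelCmd_spec (t := t) (J := 3 ^ t) (H := 2 ^ k) (by simp [hx]) (by simp [e18])
      (by simp) (by simp) (by omega) (by omega) (by omega)).mono ?_
    rintro T₁ σ₁ ag₁ ⟨hT₁, f₁⟩
    have e18' : σ₁.reg 18 = 3 ^ t := by
      rw [ag₁.reg 18 (by simp [Cmd.writes, levelCmd, fillCmd, Cmd.for])]; simp [e18]
    have e19' : σ₁.reg 19 = 2 ^ k := by
      rw [ag₁.reg 19 (by simp [Cmd.writes, levelCmd, fillCmd, Cmd.for])]; simp
    simp only [eval_mul, eval_const, eval_var, e18', hb3,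
      Nat.mod_eq_of_lt (show 3 ^ (t + 1) < N by omega), e19', true_and]
    refine ⟨?_, ?_⟩
    -- The constant `28 = 15 + 6 + 7` covers one level, and passing from `t` to `t + 1` increases
    -- the bound `28 * 3 ^ t * 2 ^ (l - t)` by exactly that amount.
    · have h5 : 3 ^ t * (15 * 2 ^ k + 6) + 7 ≤ 28 * (3 ^ t * 2 ^ k) := by nlinarith [h3 t]
      have h6 : 28 * 3 ^ (t + 1) * 2 ^ k = 28 * 3 ^ t * (2 * 2 ^ k) + 28 * (3 ^ t * 2 ^ k) := by
        rw [pow_succ]; ring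
      rw [hk] at hT'
      omega
    · rw [← hs]
      unfold levelSum
      rw [← hb3, sum_range_three_mul]
      refine sum_congr rfl fun j hj => ?_
      rw [mem_range] at hj
      obtain ⟨u, w⟩ := f₁ j hj
      rw [show l - t = k + 1 by omega, triSum_succ, ← hkdef]
      simp only [St.set_arr]
      simp only [St.set_arr] at u w
      refine congrArg₂ _ (congrArg₂ _ (triSum_congr ?_ ?_) (triSum_congr ?_ ?_))
        (triSum_congr ?_ ?_)
      · intro x hx; simp only [(u x hx).1]
      · intro z hz; simp only [(w z hz).1, cast_msub hN0]
      · intro x hx; simp only [(u x hx).2.1]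
      · intro z hz; simp only [(w z hz).2.1, cast_msub hN0]
      · intro x hx; simp only [(u x hx).2.2, ZMod.natCast_mod, Nat.cast_add]
      · intro z hz; simp only [(w z hz).2.2]
  · rintro T σ' e20 ha ⟨hT', e18, e19, hs⟩
    rw [Nat.sub_self, pow_zero, mul_one] at hT'
    refine Runs.for_of_invariant (k := 3 ^ l) (by simp [Cmd.writes]) (by simp [Cmd.writes])
      (by norm_num) (by omega) (by simp [e18])
      (fun j T₁ σ₁ => T₁ = j ∧ σ₁.reg 11 < N ∧
        (σ₁.reg 11 : ZMod N) = ∑ j ∈ range j, triSum 0 (fun x => (σ'.arr 2 l j x : ZMod N))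
          (fun z => (σ'.arr 3 l j z : ZMod N))) ?_ ?_ ?_
    · simp; omega
    · rintro j T₁ σ₁ hj hx₁ ha₁ ⟨rfl, hlt, hsum⟩
      have e20' : σ₁.reg 20 = l := by
        rw [ha₁.reg 20 (by simp [Cmd.writes])]; simp [e20]
      have e2 : σ₁.arr 2 = σ'.arr 2 := by rw [ha₁.arr 2 (by simp [Cmd.tags])]; rfl
      have e3 : σ₁.arr 3 = σ'.arr 3 := by rw [ha₁.arr 3 (by simp [Cmd.tags])]; rfl
      simp only [runs_assign, eval_plus, eval_mul, eval_get, eval_var, eval_const, St.set_reg,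
        Nat.reduceEqDiff, ↓reduceIte, e20', hx₁, e2, e3, true_and]
      refine ⟨Nat.mod_lt _ hN0, ?_⟩
      rw [sum_range_succ, ← hsum]
      simp [triSum]
    · rintro T₁ σ₁ - - ⟨rfl, hlt, hsum⟩
      refine ⟨by omega, ?_, hlt⟩
      rw [hsum, ← hs]
      simp [levelSum]

/-- Summing over residues weighted by class size is summing over elements. The range may exceed `M`,
because classes of numbers from `M` on are empty. -/
theorem sum_cls_mul {X : ℕ → ℕ} {n M K : ℕ} (hM : 0 < M) (hK : M ≤ K) (g : ℕ → ℕ) :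
    ∑ x ∈ range K, cls X n M x * g x = ∑ i ∈ range n, g (X (i + 1) % M) := by
  simp_rw [cls, card_filter, sum_mul]
  rw [sum_comm]
  refine sum_congr rfl fun i _ => ?_
  simp_rw [ite_mul, one_mul, zero_mul]
  rw [sum_ite_eq, if_pos]
  exact mem_range.2 ((Nat.mod_lt _ hM).trans_le hK)

/-- The number of solutions of `a + b = c` modulo `M` in the input. -/
def triCount (X : ℕ → ℕ) (n M : ℕ) : ℕ :=
  ∑ i ∈ range n, ∑ j ∈ range n, cls X n M ((X (i + 1) + X (j + 1)) % M)

theorem triCount_le (X : ℕ → ℕ) (n M : ℕ) : triCount X n M ≤ n ^ 3 := by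
  unfold triCount
  refine (sum_le_card_nsmul _ _ (n * n) fun i _ =>
    (sum_le_card_nsmul _ _ n fun j _ => cls_le _ _ _ _).trans_eq (by simp)).trans_eq ?_
  simp; ring

/-- Count the solutions of `a + b = c` modulo `v 9`, from the sizes of the residue classes in
row `ph`, `v 8` of array `1`. -/
def triCmd (ph : ℕ) : Cmd :=
  tabCmd 2 16 (.get 1 (lit ph) (v 8) (v 17)) ;; .assign 46 (lit 2 * v 16) ;;
  tabCmd 3 46 (.get 1 (lit ph) (v 8) (v 17 % v 9)) ;; karCmd

/-- The table `G` is extended periodically to twice the length, so that `G (x + y)` is the size of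
the class of `x + y` modulo `M` without a reduction of the index. -/
theorem triCmd_spec {ph n i M l : ℕ} {X : ℕ → ℕ} {σ : St} (hi : σ.reg 8 = i)
    (hM : σ.reg 9 = M) (hM0 : 0 < M) (hMl : M ≤ 2 ^ l) (hl : σ.reg 15 = l) (hT : σ.reg 16 = 2 ^ l)
    (h0 : ∀ r, σ.arr 1 ph i r = cls X n M r) (hN : 4 * 3 ^ l < N) (hnN : n ^ 3 < N) :
    Runs N pr κ (triCmd ph) σ (fun T σ' => T ≤ 45 * 3 ^ l + 14 ∧
      σ'.reg 11 = triCount X n M) := by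
  have h23 : 2 ^ l ≤ 3 ^ l := Nat.pow_le_pow_left (by norm_num) l
  have hN0 : 0 < N := by omega
  simp only [triCmd, runs_seq, runs_assign]
  refine (tabCmd_spec (w := fun x => cls X n M x) hT (by norm_num) (by omega) ?_).mono ?_
  · intro x hx σ' g1 g2 g3
    simp only [eval_get, eval_const, eval_var, g3, g1 8 (by norm_num), g2 1 (by norm_num), hi, h0]
  rintro T₁ σ₁ ag₁ ⟨hT₁, f₁⟩
  have r₁ : ∀ z, z ≠ 17 → σ₁.reg z = σ.reg z := fun z hz =>
    ag₁.reg z (by simp [Cmd.writes, tabCmd, Cmd.for, hz])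
  have a₁ : ∀ z, z ≠ 2 → σ₁.arr z = σ.arr z := fun z hz =>
    ag₁.arr z (by simp [Cmd.tags, tabCmd, Cmd.for, hz])
  have e16 : σ₁.reg 16 = 2 ^ l := by rw [r₁ 16 (by norm_num), hT]
  simp only [eval_mul, eval_const, eval_var, e16, Nat.mod_eq_of_lt (show 2 * 2 ^ l < N by omega)]
  refine (tabCmd_spec (w := fun x => cls X n M (x % M)) (k := 2 * 2 ^ l) (by simp) (by norm_num)
    (by omega) ?_).mono ?_
  · intro x hx σ' g1 g2 g3
    simp only [eval_get, eval_const, eval_var, eval_rem, g3, g1 8 (by norm_num),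
      g1 9 (by norm_num), g2 1 (by norm_num), St.set_reg, Nat.reduceEqDiff, ↓reduceIte,
      St.set_arr, r₁ 8 (by norm_num), r₁ 9 (by norm_num), a₁ 1 (by norm_num), hi, hM, h0]
  rintro T₂ σ₂ ag₂ ⟨hT₂, f₂⟩
  have r₂ : ∀ z, z ≠ 17 → z ≠ 46 → σ₂.reg z = σ.reg z := fun z hz hz' => by
    rw [ag₂.reg z (by simp [Cmd.writes, tabCmd, Cmd.for, hz]), St.set_reg, if_neg hz', r₁ z hz]
  have a₂ : σ₂.arr 2 = σ₁.arr 2 := ag₂.arr 2 (by simp [Cmd.tags, tabCmd, Cmd.for])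
  refine (karCmd_spec (l := l) (by rw [r₂ 15 (by norm_num) (by norm_num), hl])
    (by rw [r₂ 16 (by norm_num) (by norm_num), hT]) hN).mono ?_
  rintro T₃ σ₃ ag₃ ⟨hT₃, hs, hlt⟩
  refine ⟨by omega, ?_⟩
  have hnat : ∑ x ∈ range (2 ^ l), ∑ y ∈ range (2 ^ l),
      cls X n M x * cls X n M y * cls X n M ((x + y) % M) = triCount X n M := by
    simp_rw [mul_assoc, ← mul_sum]
    rw [sum_cls_mul hM0 hMl]
    unfold triCount
    refine sum_congr rfl fun i _ => ?_
    rw [sum_cls_mul hM0 hMl]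
    refine sum_congr rfl fun j _ => ?_
    rw [← Nat.add_mod]
  have hcast : levelSum N l 0 σ₂ = (triCount X n M : ZMod N) := by
    rw [← hnat]
    simp only [levelSum, pow_zero, sum_range_one, triSum, Nat.sub_zero, Nat.cast_sum,
      Nat.cast_mul]
    refine sum_congr rfl fun x hx => sum_congr rfl fun y hy => ?_
    rw [mem_range] at hx hy
    rw [a₂, f₁ x hx, f₁ y hy, f₂ (x + y) (by omega)]
  -- Karatsuba's method yields the count modulo `N`; it is at most `n ^ 3 < N`, hence known exactly.
  rw [hcast, ZMod.natCast_eq_natCast_iff', Nat.mod_eq_of_lt hlt,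
    Nat.mod_eq_of_lt ((triCount_le X n M).trans_lt hnN)] at hs
  exact hs

/-- The smallest power of two that is at least the value of register `45`, and its logarithm, in
registers `16` and `15`. -/
def logCmd : Cmd :=
  .assign 15 (lit 0) ;; .assign 16 (lit 1) ;;
  .for 17 45 (.ite (v 16) (v 45) (.assign 16 (lit 2 * v 16) ;; .assign 15 (v 15 + lit 1)) .skip)

theorem logCmd_spec {M : ℕ} {σ : St} (hM : σ.reg 45 = M) (hM1 : 1 ≤ M) (hN : 2 * M < N) :
    Runs N pr κ logCmd σ (fun T σ' => T ≤ 5 * M + 4 ∧ M ≤ 2 ^ σ'.reg 15 ∧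
      2 ^ σ'.reg 15 ≤ 2 * M ∧ σ'.reg 16 = 2 ^ σ'.reg 15) := by
  simp only [logCmd, runs_seq, runs_assign, eval_const]
  refine Runs.for_of_invariant (k := M) (by simp [Cmd.writes]) (by simp [Cmd.writes])
    (by norm_num) (by omega) (by simp [hM])
    (fun i T σ' => T ≤ 3 * i ∧ σ'.reg 15 ≤ i ∧ (i ≤ σ'.reg 15 ∨ M ≤ 2 ^ σ'.reg 15) ∧
      2 ^ σ'.reg 15 ≤ 2 * M ∧ σ'.reg 16 = 2 ^ σ'.reg 15) ?_ ?_ ?_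
  · simp; omega
  · rintro i T σ' hi hx ha ⟨hT, h0, h1, h2, h3⟩
    have e45 : σ'.reg 45 = M := by rw [ha.reg 45 (by simp [Cmd.writes])]; simp [hM]
    simp only [runs_ite, runs_seq, runs_assign, runs_skip, eval_var, eval_mul, eval_plus,
      eval_const, e45, h3, St.set_reg, Nat.reduceEqDiff, ↓reduceIte]
    split_ifs with hc
    · rw [Nat.mod_eq_of_lt (show σ'.reg 15 + 1 < N by omega),
        Nat.mod_eq_of_lt (show 2 * 2 ^ σ'.reg 15 < N by omega), pow_succ]
      refine ⟨by omega, by omega, by omega, by omega, by ring⟩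
    · exact ⟨by omega, by omega, by omega, h2, trivial⟩
  · rintro T σ' - - ⟨hT, h0, h1, h2, h3⟩
    refine ⟨by omega, ?_, h2, h3⟩
    rcases h1 with h | h
    · have : σ'.reg 15 = M := by omega
      rw [this]
      exact Nat.lt_two_pow_self.le
    · exact h

end
end HL

/-! ### The convolution instances -/

namespace Conv
open Finset

/-- The parameters of a convolution instance: the buckets, the moduli `p` and `p * q`, the block
length `s`, two blocks `I` and `J`, three ranks in the buckets, and the overflow `de` modulo
`p * q`. -/
structure Par where
  bk : ℕ → ℕ → ℕ
  p : ℕ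
  q : ℕ
  s : ℕ
  I : ℕ
  J : ℕ
  al : ℕ
  be : ℕ
  ga : ℕ
  de : ℕ

namespace Par
variable (π : Par)

/-- Elements of the first block. -/
def av (i : ℕ) : ℕ := π.bk (π.I * π.s + i) π.al

/-- Elements of the second block. -/
def bv (j : ℕ) : ℕ := π.bk (π.J * π.s + j) π.be

/-- The sum of the positions. -/
def tt (k : ℕ) : ℕ := (π.I + π.J) * π.s + k

/-- Elements of the block of sums. -/
def cv (k : ℕ) : ℕ := π.bk (π.tt k % π.p) π.ga

/-- The instance. -/
def inst (x : ℕ) : ℕ :=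
  if 3 * π.s ≤ x ∧ x < 5 * π.s ∧ 0 < π.cv (x - 3 * π.s) ∧ π.tt (x - 3 * π.s) < 2 * π.p then
    16 * π.q + π.cv (x - 3 * π.s) / π.p % π.q + π.de * π.q - π.tt (x - 3 * π.s) / π.p
  else if 2 * π.s ≤ x ∧ x < 3 * π.s ∧ 0 < π.bv (x - 2 * π.s) then
    12 * π.q + π.bv (x - 2 * π.s) / π.p % π.q
  else if π.s ≤ x ∧ x < 2 * π.s ∧ 0 < π.av (x - π.s) then
    4 * π.q + π.av (x - π.s) / π.p % π.q
  else 23 * π.q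

/-- The condition for `i + j = k` to be reported. -/
def Hit (i j : ℕ) : Prop :=
  0 < π.av i ∧ 0 < π.bv j ∧ 0 < π.cv (i + j) ∧ π.tt (i + j) < 2 * π.p ∧
    π.av i / π.p % π.q + π.bv j / π.p % π.q + π.tt (i + j) / π.p =
      π.cv (i + j) / π.p % π.q + π.de * π.q

/-- The four kinds of entries lie in the disjoint ranges `[16 q - 1, 18 q)`, `[12 q, 13 q)`, `[4 q,
5 q)` and `{23 q}`. The `- 1` comes from the carry `tt / p`, which is at most `1`. -/
theorem inst_cases (hq : 1 ≤ π.q) (hde : π.de ≤ 1) (x : ℕ) :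
    (∃ k < 2 * π.s, x = 3 * π.s + k ∧ 0 < π.cv k ∧ π.tt k < 2 * π.p ∧
      π.inst x + π.tt k / π.p = 16 * π.q + π.cv k / π.p % π.q + π.de * π.q ∧
      16 * π.q ≤ π.inst x + 1 ∧ π.inst x < 18 * π.q) ∨
    (∃ j < π.s, x = 2 * π.s + j ∧ 0 < π.bv j ∧ π.inst x = 12 * π.q + π.bv j / π.p % π.q ∧
      12 * π.q ≤ π.inst x ∧ π.inst x < 13 * π.q) ∨
    (∃ i < π.s, x = π.s + i ∧ 0 < π.av i ∧ π.inst x = 4 * π.q + π.av i / π.p % π.q ∧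
      4 * π.q ≤ π.inst x ∧ π.inst x < 5 * π.q) ∨ π.inst x = 23 * π.q := by
  have hmod : ∀ y, y % π.q < π.q := fun y => Nat.mod_lt _ hq
  have hdq : π.de * π.q ≤ π.q := by nlinarith
  unfold inst
  split_ifs with h1 h2 h3
  · left
    refine ⟨x - 3 * π.s, by omega, by omega, h1.2.2.1, h1.2.2.2, ?_⟩
    have ht : π.tt (x - 3 * π.s) / π.p < 2 := by
      rw [Nat.div_lt_iff_lt_mul (by omega)]; exact h1.2.2.2
    have := hmod (π.cv (x - 3 * π.s) / π.p)
    generalize π.tt (x - 3 * π.s) / π.p = τ at ht ⊢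
    omega
  · right; left
    have := hmod (π.bv (x - 2 * π.s) / π.p)
    exact ⟨x - 2 * π.s, by omega, by omega, h2.2.2, rfl, by omega, by omega⟩
  · right; right; left
    have := hmod (π.av (x - π.s) / π.p)
    exact ⟨x - π.s, by omega, by omega, h3.2.2, rfl, by omega, by omega⟩
  · exact .inr (.inr (.inr rfl))

theorem inst_pos (hq : 1 ≤ π.q) (hde : π.de ≤ 1) (x : ℕ) :
    1 ≤ π.inst x ∧ π.inst x ≤ 23 * π.q := by
  rcases π.inst_cases hq hde x with ⟨k, -, -, -, -, -, h⟩ | ⟨j, -, -, -, -, h⟩ |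
    ⟨i, -, -, -, -, h⟩ | h <;> omega

theorem inst_av {i : ℕ} (hi : i < π.s) (h : 0 < π.av i) :
    π.inst (π.s + i) = 4 * π.q + π.av i / π.p % π.q := by
  unfold inst
  rw [if_neg (by omega), if_neg (by omega), if_pos]
  · simp
  · simpa using ⟨by omega, h⟩

theorem inst_bv {j : ℕ} (hj : j < π.s) (h : 0 < π.bv j) :
    π.inst (2 * π.s + j) = 12 * π.q + π.bv j / π.p % π.q := by
  unfold inst
  rw [if_neg (by omega), if_pos]
  · simp
  · simpa using ⟨by omega, h⟩

theorem inst_cv {k : ℕ} (hk : k < 2 * π.s) (h : 0 < π.cv k) (ht : π.tt k < 2 * π.p) :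
    π.inst (3 * π.s + k) = 16 * π.q + π.cv k / π.p % π.q + π.de * π.q - π.tt k / π.p := by
  unfold inst
  rw [if_pos]
  · simp
  · simpa using ⟨by omega, h, ht⟩

/-- Among the ranges, only a first-block entry plus a second-block entry, in `[16 q, 18 q)`, can
equal another entry. Two of the first kind give `[8 q, 10 q)`, the first kind plus a sum entry stays
in `[20 q - 1, 23 q)`, and all other sums exceed `23 q`. So the decoys `23 q` never take part in a
solution. -/
theorem exists_inst_iff (hq : 1 ≤ π.q) (hs : 1 ≤ π.s) (hde : π.de ≤ 1) {k : ℕ}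
    (hk : k < 2 * π.s) :
    (∃ x ∈ Set.Icc 1 (8 * π.s), ∃ y ∈ Set.Icc 1 (8 * π.s), x + y = 3 * π.s + k ∧
      π.inst x + π.inst y = π.inst (3 * π.s + k)) ↔
    ∃ i < π.s, ∃ j < π.s, i + j = k ∧ π.Hit i j := by
  constructor
  · rintro ⟨x, hx, y, hy, hxy, h⟩
    have key : ∀ x y, x + y = 3 * π.s + k → π.inst x + π.inst y = π.inst (3 * π.s + k) →
        (∃ j < π.s, y = 2 * π.s + j ∧ 0 < π.bv j ∧ π.inst y = 12 * π.q + π.bv j / π.p % π.q) →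
        (∃ i < π.s, x = π.s + i ∧ 0 < π.av i ∧ π.inst x = 4 * π.q + π.av i / π.p % π.q) →
        ∃ i < π.s, ∃ j < π.s, i + j = k ∧ π.Hit i j := by
      rintro x y hxy h ⟨j, hj, rfl, hb, e2⟩ ⟨i, hi, rfl, ha, e1⟩
      have hm1 : π.av i / π.p % π.q < π.q := Nat.mod_lt _ hq
      have hm2 : π.bv j / π.p % π.q < π.q := Nat.mod_lt _ hq
      obtain rfl : k = i + j := by omega
      refine ⟨i, hi, j, hj, rfl, ha, hb, ?_⟩
      rcases π.inst_cases hq hde (3 * π.s + (i + j)) with ⟨k', hk', hkk, hc, ht, h1, h2, h3⟩ |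
        ⟨j', hj', hkk, -, -, h1, h2⟩ | ⟨i', hi', hkk, -, -, h1, h2⟩ | h1
      · obtain rfl : k' = i + j := by omega
        exact ⟨hc, ht, by omega⟩
      · omega
      · omega
      · omega
    -- All combinations of kinds are compared; linear arithmetic excludes each one except a
    -- first-block entry and a second-block entry, in either order.
    rcases π.inst_cases hq hde (3 * π.s + k) with ⟨_, _, _, _, _, _, _, _⟩ |
      ⟨_, _, _, _, _, _, _⟩ | ⟨_, _, _, _, _, _, _⟩ | _ <;>
    rcases π.inst_cases hq hde x with ⟨_, _, _, _, _, _, _, _⟩ |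
      ⟨j1, l1, e1, b1, v1, _, _⟩ | ⟨i1, l1, e1, b1, v1, _, _⟩ | _ <;>
    rcases π.inst_cases hq hde y with ⟨_, _, _, _, _, _, _, _⟩ |
      ⟨j2, l2, e2, b2, v2, _, _⟩ | ⟨i2, l2, e2, b2, v2, _, _⟩ | _ <;>
    first
    | (exfalso; omega)
    | exact key x y hxy h ⟨j2, l2, e2, b2, v2⟩ ⟨i1, l1, e1, b1, v1⟩
    | exact key y x (by omega) (by omega) ⟨j1, l1, e1, b1, v1⟩ ⟨i2, l2, e2, b2, v2⟩
  · rintro ⟨i, hi, j, hj, rfl, ha, hb, hc, ht, h⟩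
    refine ⟨π.s + i, ⟨by omega, by omega⟩, 2 * π.s + j, ⟨by omega, by omega⟩, by ring, ?_⟩
    have ht2 : π.tt (i + j) / π.p < 2 := by
      rw [Nat.div_lt_iff_lt_mul (by omega)]; exact ht
    rw [π.inst_av hi ha, π.inst_bv hj hb, π.inst_cv hk hc ht]
    omega

/-! ### What a hit says about the elements modulo `p q`. -/

/-- The buckets hold elements with the right residue. -/
def Sound : Prop := ∀ u r, π.bk u r ≠ 0 → π.bk u r % π.p = u

variable {π}

/-- The residue modulo `p q` is a two-digit number with low digit modulo `p` and high digit modulo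
`q`. A hit is schoolbook addition: the positions add the low digits with carry `tt / p`, the values
add the high digits with overflow `de`. -/
theorem Hit.mod_add (hs : π.Sound) {i j : ℕ} (h : π.Hit i j) :
    π.av i % (π.p * π.q) + π.bv j % (π.p * π.q) =
      π.cv (i + j) % (π.p * π.q) + π.p * π.q * π.de := by
  obtain ⟨ha, hb, hc, ht, h⟩ := h
  have ea : π.av i % π.p = π.I * π.s + i := hs _ _ (by simpa [av] using ha.ne')
  have eb : π.bv j % π.p = π.J * π.s + j := hs _ _ (by simpa [bv] using hb.ne')
  have ec : π.cv (i + j) % π.p = π.tt (i + j) % π.p := hs _ _ (by simpa [cv] using hc.ne')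
  have ra : π.av i % (π.p * π.q) = π.I * π.s + i + π.p * (π.av i / π.p % π.q) := by
    rw [Nat.mod_mul, ea]
  have rb : π.bv j % (π.p * π.q) = π.J * π.s + j + π.p * (π.bv j / π.p % π.q) := by
    rw [Nat.mod_mul, eb]
  have rc : π.cv (i + j) % (π.p * π.q) =
      π.tt (i + j) % π.p + π.p * (π.cv (i + j) / π.p % π.q) := by
    rw [Nat.mod_mul, ec]
  have htt : π.I * π.s + i + (π.J * π.s + j) = π.tt (i + j) := by unfold tt; ring
  have hdiv := Nat.mod_add_div (π.tt (i + j)) π.p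
  have hsum : π.I * π.s + i + π.p * (π.av i / π.p % π.q) +
      (π.J * π.s + j + π.p * (π.bv j / π.p % π.q)) =
      (π.tt (i + j) % π.p + π.p * (π.cv (i + j) / π.p % π.q)) + π.p * π.q * π.de := by
    calc _ = π.tt (i + j) + π.p * (π.av i / π.p % π.q + π.bv j / π.p % π.q) := by
          rw [← htt]; ring
      _ = π.tt (i + j) % π.p + π.p * (π.tt (i + j) / π.p) +
          π.p * (π.av i / π.p % π.q + π.bv j / π.p % π.q) := by rw [hdiv]
      _ = π.tt (i + j) % π.p + π.p * (π.av i / π.p % π.q + π.bv j / π.p % π.q +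
          π.tt (i + j) / π.p) := by ring
      _ = _ := by rw [h]; ring
  rw [ra, rb, hsum, ← rc]

theorem Hit.mod_eq (hs : π.Sound) {i j : ℕ} (h : π.Hit i j) :
    (π.av i + π.bv j) % (π.p * π.q) = π.cv (i + j) % (π.p * π.q) := by
  rw [Nat.add_mod, h.mod_add hs, Nat.add_mul_mod_self_left, Nat.mod_mod]

/-- Every solution is found for some overflow. -/
theorem exists_hit {bk : ℕ → ℕ → ℕ} {p q s : ℕ} (hp : 1 ≤ p) {a b c al be ga : ℕ}
    (habc : a + b = c) (ha : bk (a % p) al = a) (hb : bk (b % p) be = b) (hc : bk (c % p) ga = c)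
    (ha0 : 0 < a) (hb0 : 0 < b) :
    ∃ de ≤ 1, ∀ π : Par, π = ⟨bk, p, q, s, a % p / s, b % p / s, al, be, ga, de⟩ →
      π.Hit (a % p % s) (b % p % s) ∧ π.av (a % p % s) = a ∧ π.bv (b % p % s) = b ∧
        π.cv (a % p % s + b % p % s) = c := by
  have hd : (a % (p * q) + b % (p * q)) / (p * q) ≤ 1 := by
    rcases Nat.eq_zero_or_pos (p * q) with h | h
    · simp [h]
    · have h1 := Nat.mod_lt a h
      have h2 := Nat.mod_lt b h
      have : (a % (p * q) + b % (p * q)) / (p * q) < 2 := by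
        rw [Nat.div_lt_iff_lt_mul h]; omega
      omega
  refine ⟨_, hd, ?_⟩
  rintro π rfl
  set de := (a % (p * q) + b % (p * q)) / (p * q) with hde
  have e1 := Nat.div_add_mod' (a % p) s
  have e2 := Nat.div_add_mod' (b % p) s
  have htt : (a % p / s + b % p / s) * s + (a % p % s + b % p % s) = a % p + b % p := by
    rw [add_mul]; omega
  have hcm : (a % p + b % p) % p = c % p := by rw [← Nat.add_mod, habc]
  have hav : Par.av ⟨bk, p, q, s, a % p / s, b % p / s, al, be, ga, de⟩ (a % p % s) = a := by
    simp only [av, e1, ha]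
  have hbv : Par.bv ⟨bk, p, q, s, a % p / s, b % p / s, al, be, ga, de⟩ (b % p % s) = b := by
    simp only [bv, e2, hb]
  have hcv : Par.cv ⟨bk, p, q, s, a % p / s, b % p / s, al, be, ga, de⟩
      (a % p % s + b % p % s) = c := by
    simp only [cv, tt, htt, hcm, hc]
  refine ⟨⟨by rw [hav]; exact ha0, by rw [hbv]; exact hb0, by rw [hcv]; omega, ?_, ?_⟩, hav, hbv,
    hcv⟩
  · simp only [tt, htt]
    have h1 := Nat.mod_lt a hp
    have h2 := Nat.mod_lt b hp
    omega
  · rw [hav, hbv, hcv]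
    simp only [tt, htt]
    have h1 : a % (p * q) + b % (p * q) = c % (p * q) + p * q * de := by
      rw [← habc, Nat.add_mod a b (p * q), hde, Nat.mod_add_div]
    rw [Nat.mod_mul, Nat.mod_mul (x := b), Nat.mod_mul (x := c), ← hcm] at h1
    have h2 := Nat.mod_add_div (a % p + b % p) p
    refine Nat.eq_of_mul_eq_mul_left hp ?_
    have h3 : (a % p + b % p) % p + p * (a / p % q + b / p % q + (a % p + b % p) / p) =
        (a % p + b % p) % p + p * (c / p % q + de * q) := by
      calc _ = ((a % p + b % p) % p + p * ((a % p + b % p) / p)) + p * (a / p % q + b / p % q) := by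
            ring
        _ = a % p + b % p + p * (a / p % q + b / p % q) := by rw [h2]
        _ = a % p + p * (a / p % q) + (b % p + p * (b / p % q)) := by ring
        _ = _ := by rw [h1]; ring
    omega

/-! ### Charging reported positions to false triples. -/

/-- Position `k` of the instance is reported. -/
def Reported (π : Par) (k : ℕ) : Prop := ∃ i < π.s, ∃ j < π.s, i + j = k ∧ π.Hit i j

/-- The parameters of instance number `e`. -/
def decode (bk : ℕ → ℕ → ℕ) (p q s b Q e : ℕ) : Par :=
  ⟨bk, p, q, s, e % Q, e / Q % Q, e / Q / Q % b, e / Q / Q / b % b, e / Q / Q / b / b % b,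
    e / Q / Q / b / b / b⟩

theorem decode_de_le {bk : ℕ → ℕ → ℕ} {p q s b Q e : ℕ} (he : e < 2 * b * b * b * Q * Q) :
    (decode bk p q s b Q e).de ≤ 1 := by
  have hQ : 0 < Q := Nat.pos_of_ne_zero fun h => by simp [h] at he
  have hb : 0 < b := Nat.pos_of_ne_zero fun h => by simp [h] at he
  have : e / Q / Q / b / b / b < 2 := by
    rw [Nat.div_lt_iff_lt_mul hb, Nat.div_lt_iff_lt_mul hb, Nat.div_lt_iff_lt_mul hb,
      Nat.div_lt_iff_lt_mul hQ, Nat.div_lt_iff_lt_mul hQ]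
    exact he
  exact Nat.lt_succ_iff.1 this

theorem digit {Q d e T : ℕ} (hd : d < Q) (he : e < T) :
    ∃ x < T * Q, x % Q = d ∧ x / Q = e := by
  refine ⟨e * Q + d, ?_, ?_, ?_⟩
  · calc e * Q + d < (e + 1) * Q := by rw [add_mul]; omega
      _ ≤ T * Q := Nat.mul_le_mul_right _ he
  · rw [add_comm, Nat.add_mul_mod_self_right, Nat.mod_eq_of_lt hd]
  · rw [add_comm, Nat.add_mul_div_right _ _ (by omega), Nat.div_eq_of_lt hd, zero_add]

theorem exists_decode (bk : ℕ → ℕ → ℕ) (p q s : ℕ) {b Q I J al be ga de : ℕ} (hI : I < Q)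
    (hJ : J < Q) (hal : al < b) (hbe : be < b) (hga : ga < b) (hde : de ≤ 1) :
    ∃ e < 2 * b * b * b * Q * Q,
      decode bk p q s b Q e = ⟨bk, p, q, s, I, J, al, be, ga, de⟩ := by
  obtain ⟨x₁, h₁, m₁, d₁⟩ := digit hga (show de < 2 by omega)
  obtain ⟨x₂, h₂, m₂, d₂⟩ := digit hbe h₁
  obtain ⟨x₃, h₃, m₃, d₃⟩ := digit hal h₂
  obtain ⟨x₄, h₄, m₄, d₄⟩ := digit hJ h₃
  obtain ⟨x₅, h₅, m₅, d₅⟩ := digit hI h₄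
  exact ⟨x₅, h₅, by simp only [decode, m₅, d₅, m₄, d₄, m₃, d₃, m₂, d₂, m₁, d₁]⟩

theorem eq_of_digits {Q e e' : ℕ} (h : e % Q = e' % Q) (h' : e / Q = e' / Q) : e = e' := by
  rw [← Nat.mod_add_div e Q, ← Nat.mod_add_div e' Q, h, h']

open Classical in
/-- The false solutions that can be reported for the given parameters. -/
noncomputable def fiber (A : Finset ℕ) (π : Par) : Finset (ℕ × ℕ × ℕ) :=
  {z ∈ Pseudo.falTriples A (π.p * π.q) | z.1 % π.p / π.s = π.I ∧ z.2.1 % π.p / π.s = π.J ∧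
    π.bk (z.1 % π.p) π.al = z.1 ∧ π.bk (z.2.1 % π.p) π.be = z.2.1 ∧
    π.bk (z.2.2 % π.p) π.ga = z.2.2 ∧
    z.1 % (π.p * π.q) + z.2.1 % (π.p * π.q) = z.2.2 % (π.p * π.q) + π.p * π.q * π.de}

theorem mem_fiber {A : Finset ℕ} {z : ℕ × ℕ × ℕ} : z ∈ π.fiber A ↔
    (z.1 ∈ A ∧ z.2.1 ∈ A ∧ z.2.2 ∈ A) ∧ z.1 % π.p / π.s = π.I ∧ z.2.1 % π.p / π.s = π.J ∧
    π.bk (z.1 % π.p) π.al = z.1 ∧ π.bk (z.2.1 % π.p) π.be = z.2.1 ∧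
    π.bk (z.2.2 % π.p) π.ga = z.2.2 ∧
    z.1 % (π.p * π.q) + z.2.1 % (π.p * π.q) = z.2.2 % (π.p * π.q) + π.p * π.q * π.de ∧
    z.1 + z.2.1 ≠ z.2.2 ∧ (z.1 + z.2.1) % (π.p * π.q) = z.2.2 % (π.p * π.q) := by
  simp only [fiber, Pseudo.falTriples, mem_filter, mem_product]
  tauto

-- Every reported position has a hit, and without true solutions its triple is false. The assignment
-- is injective: the residues of `a` and `b` modulo `p` determine `i` and `j`, hence the position `i
-- + j`.
open Classical in
theorem card_reported_le {A : Finset ℕ} (hs : π.Sound) (hA : ∀ u r, π.bk u r ≠ 0 → π.bk u r ∈ A)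
    (hno : ∀ i < π.s, ∀ j < π.s, π.Hit i j → π.av i + π.bv j ≠ π.cv (i + j)) :
    #{k ∈ range (2 * π.s) | π.Reported k} ≤ #(π.fiber A) := by
  have hch : ∀ k, π.Reported k → ∃ z : ℕ × ℕ, z.1 < π.s ∧ z.2 < π.s ∧ z.1 + z.2 = k ∧
      π.Hit z.1 z.2 := fun k ⟨i, hi, j, hj, h, hh⟩ => ⟨(i, j), hi, hj, h, hh⟩
  choose! g hg using hch
  have hmod : ∀ i j, π.Hit i j → π.av i % π.p = π.I * π.s + i ∧ π.bv j % π.p = π.J * π.s + j := by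
    rintro i j ⟨h1, h2, -⟩
    exact ⟨hs _ _ h1.ne', hs _ _ h2.ne'⟩
  refine card_le_card_of_injOn (fun k => (π.av (g k).1, π.bv (g k).2, π.cv k))
    (fun k hk => ?_) (fun k hk k' hk' h => ?_)
  · simp only [coe_filter, mem_range, Set.mem_ofPred_eq] at hk
    obtain ⟨hi, hj, hk', hit⟩ := hg k hk.2
    obtain ⟨e1, e2⟩ := hmod _ _ hit
    have e3 : π.cv k % π.p = π.tt k % π.p := hs _ _ (by
      have := hit.2.2.1; rw [hk'] at this; exact this.ne')
    have hne := hno _ hi _ hj hit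
    have hadd := hit.mod_add hs
    have heq := hit.mod_eq hs
    have hc := hit.2.2.1
    rw [hk'] at hne hadd heq hc
    refine mem_coe.2 (mem_fiber.2 ⟨⟨hA _ _ hit.1.ne', hA _ _ hit.2.1.ne', hA _ _ hc.ne'⟩,
      ?_, ?_, ?_, ?_, ?_, hadd, hne, heq⟩)
    · rw [e1, mul_comm, Nat.mul_add_div (by omega), Nat.div_eq_of_lt hi, add_zero]
    · rw [e2, mul_comm, Nat.mul_add_div (by omega), Nat.div_eq_of_lt hj, add_zero]
    · rw [e1]; rfl
    · rw [e2]; rfl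
    · rw [e3]; rfl
  · simp only [coe_filter, mem_range, Set.mem_ofPred_eq] at hk hk'
    obtain ⟨hi, hj, hk1, hit⟩ := hg k hk.2
    obtain ⟨hi', hj', hk1', hit'⟩ := hg k' hk'.2
    simp only [Prod.mk.injEq] at h
    obtain ⟨e1, e2⟩ := hmod _ _ hit
    obtain ⟨e1', e2'⟩ := hmod _ _ hit'
    rw [h.1] at e1
    rw [h.2.1] at e2
    omega

/-- The fibers are disjoint: a triple determines its blocks, its ranks (no bucket repeats an
element) and its overflow, and these are all the digits of the instance number. -/
theorem sum_card_fiber_le {A : Finset ℕ} {bk : ℕ → ℕ → ℕ} {p q s b Q : ℕ} (hp : 1 ≤ p)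
    (hq : 1 ≤ q) (hA0 : 0 ∉ A)
    (hinj : ∀ u r r', bk u r ≠ 0 → bk u r = bk u r' → r = r') (T : ℕ) :
    ∑ e ∈ range T, #((decode bk p q s b Q e).fiber A) ≤ #(Pseudo.falTriples A (p * q)) := by
  classical
  rw [← card_biUnion]
  · refine card_le_card (biUnion_subset.2 fun e _ => ?_)
    exact filter_subset _ _
  · intro e _ e' _ hne
    refine disjoint_left.2 fun z hz hz' => hne ?_
    obtain ⟨⟨m1, m2, m3⟩, h1, h2, h3, h4, h5, h6, -⟩ := mem_fiber.1 hz
    obtain ⟨-, h1', h2', h3', h4', h5', h6', -⟩ := mem_fiber.1 hz'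
    simp only [decode] at h1 h2 h3 h4 h5 h6 h1' h2' h3' h4' h5' h6'
    have n1 : z.1 ≠ 0 := fun h => hA0 (h ▸ m1)
    have n2 : z.2.1 ≠ 0 := fun h => hA0 (h ▸ m2)
    have n3 : z.2.2 ≠ 0 := fun h => hA0 (h ▸ m3)
    have g3 := hinj _ _ _ (by rwa [h3]) (h3.trans h3'.symm)
    have g4 := hinj _ _ _ (by rwa [h4]) (h4.trans h4'.symm)
    have g5 := hinj _ _ _ (by rwa [h5]) (h5.trans h5'.symm)
    have hpq : 0 < p * q := Nat.mul_pos hp hq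
    have g6 : e / Q / Q / b / b / b = e' / Q / Q / b / b / b :=
      Nat.eq_of_mul_eq_mul_left hpq (by omega)
    exact eq_of_digits (h1.symm.trans h1') (eq_of_digits (h2.symm.trans h2')
      (eq_of_digits g3 (eq_of_digits g4 (eq_of_digits g5 g6))))

end Par
end Conv

/-! ### Heavy and light elements -/

namespace HL
open WordRAM

section
variable {N κ : ℕ} {pr : Prog}

/-- Mark the input elements in array `4`. -/
def tableCmd : Cmd := .for 10 0 (.put 4 (lit 0) (lit 0) inp (lit 1))

theorem tableCmd_spec {n : ℕ} {X : ℕ → ℕ} {σ : St} (hn : σ.reg 0 = n)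
    (hX : ∀ k, 1 ≤ k → k ≤ n → σ.arr 0 0 0 k = X k) (h0 : ∀ z, σ.arr 4 0 0 z = 0)
    (hN : n + 1 < N) :
    Runs N pr κ tableCmd σ (fun t σ' => t ≤ 3 * n + 2 ∧
      ∀ z, 0 < σ'.arr 4 0 0 z ↔ ∃ j < n, X (j + 1) = z) := by
  refine Runs.for_of_invariant (by simp [Cmd.writes]) (by simp [Cmd.writes])
    (by norm_num) (by omega) hn (fun i t σ' => t = i ∧
      ∀ z, 0 < σ'.arr 4 0 0 z ↔ ∃ j < i, X (j + 1) = z) ?_ ?_ ?_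
  · exact ⟨rfl, fun z => by simp [h0]⟩
  · rintro i t σ' hi hx ha ⟨rfl, h1⟩
    have eX : σ'.arr 0 0 0 (t + 1) = X (t + 1) := by
      rw [ha.arr 0 (by simp [Cmd.tags]), hX _ (by omega) (by omega)]
    simp only [runs_put, eval_plus, eval_var, eval_const, eval_get, hx, eX,
      Nat.mod_eq_of_lt (show t + 1 < N by omega), St.set_arr, St.put_arr, true_and]
    intro z
    split_ifs with h
    · exact ⟨fun _ => ⟨t, by omega, h.symm⟩, fun _ => one_pos⟩
    · rw [h1]
      constructor
      · rintro ⟨j, hj, e⟩; exact ⟨j, by omega, e⟩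
      · rintro ⟨j, hj, e⟩
        rcases Nat.lt_succ_iff_lt_or_eq.1 hj with h' | rfl
        · exact ⟨j, h', e⟩
        · exact absurd e.symm h
  · rintro t σ' - - ⟨rfl, h1⟩
    exact ⟨by omega, h1⟩

/-- Set register `27` if the element in register `23` occurs in a solution. -/
def scanCmd : Cmd :=
  .for 25 0 (.assign 26 (.get 0 (lit 0) (lit 0) (v 25 + lit 1)) ;;
    .ite (lit 0) (.get 4 (lit 0) (lit 0) (v 23 + v 26)) (.assign 27 (lit 1)) .skip ;;
    .ite (lit 0) (.get 4 (lit 0) (lit 0) (v 23 - v 26)) (.assign 27 (lit 1)) .skip)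

/-- Both roles of `x` are tested, as a summand through `x + X (j + 1)` and as a sum through `x - X
(j + 1)`. One element costs linear time. -/
theorem scanCmd_spec {n x : ℕ} {X : ℕ → ℕ} {σ : St} (hn : σ.reg 0 = n) (hx : σ.reg 23 = x)
    (hX : ∀ k, 1 ≤ k → k ≤ n → σ.arr 0 0 0 k = X k) {In : ℕ → Prop}
    (h4 : ∀ z, 0 < σ.arr 4 0 0 z ↔ In z) (hN : n + 1 < N) (hxN : ∀ j < n, x + X (j + 1) < N) :
    Runs N pr κ scanCmd σ (fun t σ' => t ≤ 7 * n + 2 ∧ (σ.reg 27 ≤ 1 → σ'.reg 27 ≤ 1) ∧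
      (σ'.reg 27 = 1 ↔ σ.reg 27 = 1 ∨ ∃ j < n, In (x + X (j + 1)) ∨ In (x - X (j + 1)))) := by
  refine Runs.for_of_invariant (by simp [Cmd.writes]) (by simp [Cmd.writes])
    (by norm_num) (by omega) hn (fun i t σ' => t = 5 * i ∧ (σ.reg 27 ≤ 1 → σ'.reg 27 ≤ 1) ∧
      (σ'.reg 27 = 1 ↔ σ.reg 27 = 1 ∨ ∃ j < i, In (x + X (j + 1)) ∨ In (x - X (j + 1)))) ?_ ?_ ?_
  · simp
  · rintro i t σ' hi hxi ha ⟨rfl, h1, h2⟩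
    have eX : σ'.arr 0 0 0 (i + 1) = X (i + 1) := by
      rw [ha.arr 0 (by simp [Cmd.tags]), hX _ (by omega) (by omega)]
    have e23 : σ'.reg 23 = x := by rw [ha.reg 23 (by simp [Cmd.writes]), hx]
    have e4 : σ'.arr 4 = σ.arr 4 := ha.arr 4 (by simp [Cmd.tags])
    have hs : (∃ j < i + 1, In (x + X (j + 1)) ∨ In (x - X (j + 1))) ↔
        (∃ j < i, In (x + X (j + 1)) ∨ In (x - X (j + 1))) ∨
          In (x + X (i + 1)) ∨ In (x - X (i + 1)) := by
      constructor
      · rintro ⟨j, hj, h⟩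
        rcases Nat.lt_succ_iff_lt_or_eq.1 hj with h' | rfl
        · exact .inl ⟨j, h', h⟩
        · exact .inr h
      · rintro (⟨j, hj, h⟩ | h)
        · exact ⟨j, by omega, h⟩
        · exact ⟨i, by omega, h⟩
    simp only [runs_seq, runs_ite, runs_assign, runs_skip, eval_plus, eval_sub, eval_var,
      eval_const, eval_get, hxi, eX, Nat.mod_eq_of_lt (show i + 1 < N by omega), St.set_reg,
      St.set_arr, Nat.reduceEqDiff, ↓reduceIte, e23, Nat.mod_eq_of_lt (hxN i hi), e4, hs]
    split_ifs with c1 c2 c2 <;> rw [h4] at c1 c2 <;>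
      simp only [c1, c2, h2, or_true, or_false, le_refl, imp_true_iff, and_true] <;> omega
  · rintro t σ' - - ⟨rfl, h1, h2⟩
    exact ⟨by omega, h1, h2⟩

/-- Test the heavy elements (those whose residue class modulo register `14` has more elements
than register `4`) by brute force, and sort the other elements into buckets in array `6`. -/
def splitCmd : Cmd :=
  .assign 8 (lit 0) ;; .assign 9 (v 14) ;; cntCmd 4 ;; tableCmd ;;
  .for 10 0 (.assign 23 inp ;; .assign 24 (v 23 % v 14) ;;
    .ite (v 4) (.get 1 (lit 4) (v 8) (v 24)) scanCmd
      (.put 6 (lit 0) (v 24) (.get 5 (lit 0) (lit 0) (v 24)) (v 23) ;;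
        .put 5 (lit 0) (lit 0) (v 24) (.get 5 (lit 0) (lit 0) (v 24) + lit 1)))

/-- There is a solution. -/
def Sol (X : ℕ → ℕ) (n : ℕ) : Prop :=
  ∃ i < n, ∃ j < n, ∃ k < n, X (i + 1) + X (j + 1) = X (k + 1)

/-- The element number `j + 1` is heavy. -/
def Heavy (X : ℕ → ℕ) (n p b j : ℕ) : Prop := b < cls X n p (X (j + 1) % p)

instance (X : ℕ → ℕ) (n p b j : ℕ) : Decidable (Heavy X n p b j) :=
  inferInstanceAs (Decidable (_ < _))

/-- If no heavy element occurs in a solution, all elements of all solutions are light and can be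
found in the buckets at ranks below `b`. The time is linear plus a linear scan per heavy element. -/
theorem splitCmd_spec {n p b U : ℕ} {X : ℕ → ℕ} {σ : St} (hn : σ.reg 0 = n) (hp : σ.reg 14 = p)
    (hb : σ.reg 4 = b) (hX : ∀ k, 1 ≤ k → k ≤ n → σ.arr 0 0 0 k = X k)
    (hX1 : ∀ j < n, 1 ≤ X (j + 1)) (hXU : ∀ j < n, X (j + 1) ≤ U)
    (hinj : ∀ i < n, ∀ j < n, X (i + 1) = X (j + 1) → i = j)
    (h1 : ∀ r, σ.arr 1 4 0 r = 0) (h4 : ∀ z, σ.arr 4 0 0 z = 0) (h5 : ∀ z, σ.arr 5 0 0 z = 0)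
    (h6 : ∀ u r, σ.arr 6 0 u r = 0) (h27 : σ.reg 27 = 0) (hN : n + 1 < N) (hUN : 2 * U < N) :
    Runs N pr κ splitCmd σ (fun t σ' =>
      t ≤ (7 * n + 3) * ((Finset.range n).filter (Heavy X n p b)).card + 13 * n + 8 ∧
      (σ'.reg 27 = 0 ∨ σ'.reg 27 = 1) ∧ (σ'.reg 27 = 1 → Sol X n) ∧
      (σ'.reg 27 = 0 → ∀ i < n, ∀ j < n, ∀ k < n, X (i + 1) + X (j + 1) = X (k + 1) →
        ¬Heavy X n p b i ∧ ¬Heavy X n p b j ∧ ¬Heavy X n p b k) ∧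
      (∀ u r, σ'.arr 6 0 u r ≠ 0 → ∃ j < n, X (j + 1) = σ'.arr 6 0 u r ∧ X (j + 1) % p = u) ∧
      (∀ j < n, ¬Heavy X n p b j → ∃ r < b, σ'.arr 6 0 (X (j + 1) % p) r = X (j + 1)) ∧
      ∀ u r r', σ'.arr 6 0 u r ≠ 0 → σ'.arr 6 0 u r = σ'.arr 6 0 u r' → r = r') := by
  rw [splitCmd]
  simp only [runs_seq, runs_assign, eval_const, eval_var]
  refine (cntCmd_spec (σ := (σ.set 8 0).set 9 ((σ.set 8 0).reg 14)) (n := n) (i := 0) (M := p)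
    (X := X) (by simp [hn]) (by simp) (by simp [hp]) hX h1 hN).mono ?_
  rintro t₁ σ₁ ag₁ ⟨ht₁, c₁, -⟩
  have r1 : ∀ z, z ∉ [8, 9, 10] → σ₁.reg z = σ.reg z := fun z hz => by
    rw [ag₁.reg z (by simp [cntCmd, Cmd.for, Cmd.writes] at hz ⊢; tauto)]
    simp at hz
    simp [hz]
  have r18 : σ₁.reg 8 = 0 := by
    rw [ag₁.reg 8 (by simp [cntCmd, Cmd.for, Cmd.writes])]; simp
  have a1 : ∀ z, z ≠ 1 → σ₁.arr z = σ.arr z := fun z hz => by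
    rw [ag₁.arr z (by simpa [cntCmd, Cmd.for, Cmd.tags] using hz)]; rfl
  refine (tableCmd_spec (σ := σ₁) (n := n) (X := X) (by rw [r1 0 (by simp), hn])
    (by rw [a1 0 (by simp)]; exact hX) (by rw [a1 4 (by simp)]; exact h4) hN).mono ?_
  rintro t₂ σ₂ ag₂ ⟨ht₂, c₂⟩
  have r2 : ∀ z, z ∉ [10] → σ₂.reg z = σ₁.reg z := fun z hz =>
    ag₂.reg z (by simpa [tableCmd, Cmd.for, Cmd.writes] using hz)
  have a2 : ∀ z, z ≠ 4 → σ₂.arr z = σ₁.arr z := fun z hz =>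
    ag₂.arr z (by simpa [tableCmd, Cmd.for, Cmd.tags] using hz)
  refine Runs.for_of_invariant (by simp [Cmd.writes, scanCmd, Cmd.for])
    (by simp [Cmd.writes, scanCmd, Cmd.for]) (by norm_num) (show n < N by omega)
    (by rw [r2 0 (by simp), r1 0 (by simp), hn]) (fun i t σ' =>
      t ≤ (7 * n + 3) * ((Finset.range i).filter (Heavy X n p b)).card + 5 * i ∧
      (σ'.reg 27 = 0 ∨ σ'.reg 27 = 1) ∧ (σ'.reg 27 = 1 → Sol X n) ∧
      (σ'.reg 27 = 0 → ∀ i' < i, Heavy X n p b i' → ∀ j < n, ∀ k < n,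
        X (i' + 1) + X (j + 1) ≠ X (k + 1) ∧ X (j + 1) + X (k + 1) ≠ X (i' + 1)) ∧
      (∀ u, σ'.arr 5 0 0 u ≤ cls X i p u) ∧
      (∀ u r, σ'.arr 6 0 u r ≠ 0 → (∃ j < i, X (j + 1) = σ'.arr 6 0 u r ∧ X (j + 1) % p = u) ∧
        r < σ'.arr 5 0 0 u) ∧
      (∀ j < i, ¬Heavy X n p b j → ∃ r < b, σ'.arr 6 0 (X (j + 1) % p) r = X (j + 1)) ∧
      ∀ u r r', σ'.arr 6 0 u r ≠ 0 → σ'.arr 6 0 u r = σ'.arr 6 0 u r' → r = r') ?_ ?_ ?_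
  · have e6 : σ₂.arr 6 = σ.arr 6 := by rw [a2 6 (by simp), a1 6 (by simp)]
    have e5 : σ₂.arr 5 = σ.arr 5 := by rw [a2 5 (by simp), a1 5 (by simp)]
    have e27 : σ₂.reg 27 = 0 := by rw [r2 27 (by simp), r1 27 (by simp), h27]
    simp [e6, e5, h6, h5, e27]
  · rintro i t σ' hi hx ha ⟨ht, i1, i2, i3, i5, i6, i7, i8⟩
    have wr : ∀ z, z ∉ [10, 23, 24, 25, 26, 27] → σ'.reg z = σ₂.reg z := fun z hz =>
      ha.reg z (by simp [scanCmd, Cmd.for, Cmd.writes] at hz ⊢; tauto)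
    have wt : ∀ z, z ∉ [5, 6] → σ'.arr z = σ₂.arr z := fun z hz =>
      ha.arr z (by simp [scanCmd, Cmd.for, Cmd.tags] at hz ⊢; tauto)
    have eX : σ'.arr 0 = σ.arr 0 := by rw [wt 0 (by simp), a2 0 (by simp), a1 0 (by simp)]
    have eXi : σ'.arr 0 0 0 (i + 1) = X (i + 1) := by rw [eX, hX _ (by omega) (by omega)]
    have e14 : σ'.reg 14 = p := by rw [wr 14 (by simp), r2 14 (by simp), r1 14 (by simp), hp]
    have e4 : σ'.reg 4 = b := by rw [wr 4 (by simp), r2 4 (by simp), r1 4 (by simp), hb]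
    have e8 : σ'.reg 8 = 0 := by rw [wr 8 (by simp), r2 8 (by simp), r18]
    have e0 : σ'.reg 0 = n := by rw [wr 0 (by simp), r2 0 (by simp), r1 0 (by simp), hn]
    have ec : ∀ r, σ'.arr 1 4 0 r = cls X n p r := fun r => by
      rw [wt 1 (by simp), a2 1 (by simp), c₁]
    simp only [runs_seq, runs_ite, runs_assign, eval_plus, eval_rem, eval_var,
      eval_const, eval_get, hx, eXi, Nat.mod_eq_of_lt (show i + 1 < N by omega), St.set_reg,
      St.set_arr, Nat.reduceEqDiff, ↓reduceIte, e14, e4, e8, ec, runs_put, St.put_arr, St.put_reg,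
      Nat.reduceEqDiff, false_and, true_and]
    split_ifs with hh
    · have hH : Heavy X n p b i := hh
      refine (scanCmd_spec (σ := (σ'.set 23 (X (i + 1))).set 24 (X (i + 1) % p)) (n := n)
        (x := X (i + 1)) (X := X) (by simp [e0]) (by simp) (by simpa [eX] using hX)
        (In := fun z => ∃ j < n, X (j + 1) = z) (fun z => by
          rw [St.set_arr, St.set_arr, wt 4 (by simp), c₂]) hN
        (fun j hj => by have := hXU i hi; have := hXU j hj; omega)).mono ?_
      rintro t₃ σ₃ ag₃ ⟨ht₃, hle, hiff⟩
      have e27 : ((σ'.set 23 (X (i + 1))).set 24 (X (i + 1) % p)).reg 27 = σ'.reg 27 := by simp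
      rw [e27] at hle hiff
      have e5 : σ₃.arr 5 = σ'.arr 5 := ag₃.arr 5 (by simp [scanCmd, Cmd.for, Cmd.tags])
      have e6 : σ₃.arr 6 = σ'.arr 6 := ag₃.arr 6 (by simp [scanCmd, Cmd.for, Cmd.tags])
      simp only [e5, e6]
      have hle' := hle (by omega)
      refine ⟨?_, by omega, ?_, ?_, ?_, ?_, ?_, i8⟩
      · rw [Finset.range_add_one, Finset.filter_insert, if_pos hH,
          Finset.card_insert_of_notMem (by simp), mul_add, mul_one]
        omega
      · intro h
        rcases hiff.1 h with h' | ⟨j, hj, ⟨k, hk, e⟩ | ⟨k, hk, e⟩⟩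
        · exact i2 h'
        · exact ⟨i, hi, j, hj, k, hk, e.symm⟩
        -- The difference is truncated, but the table contains positive numbers only, so a hit is a
        -- genuine equation.
        · have := hX1 k hk
          exact ⟨j, hj, k, hk, i, hi, by omega⟩
      · intro h i' hi' hh' j hj k hk
        rcases Nat.lt_succ_iff_lt_or_eq.1 hi' with h' | rfl
        · refine i3 ?_ i' h' hh' j hj k hk
          by_contra hc
          have := hiff.2 (.inl (by omega))
          omega
        · constructor
          · intro e
            have := hiff.2 (.inr ⟨j, hj, .inl ⟨k, hk, e.symm⟩⟩)
            omega
          · intro e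
            have := hiff.2 (.inr ⟨j, hj, .inr ⟨k, hk, by omega⟩⟩)
            omega
      · exact fun u => (i5 u).trans (by rw [cls_succ]; omega)
      · intro u r h
        obtain ⟨⟨j, hj, h⟩, h'⟩ := i6 u r h
        exact ⟨⟨j, by omega, h⟩, h'⟩
      · intro j hj hl
        rcases Nat.lt_succ_iff_lt_or_eq.1 hj with h' | rfl
        · exact i7 j h' hl
        · exact absurd hH hl
    · have hH : ¬Heavy X n p b i := hh
      set u₀ := X (i + 1) % p with hu₀
      set r₀ := σ'.arr 5 0 0 u₀ with hr₀
      have hr0 : r₀ ≤ cls X i p u₀ := i5 u₀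
      -- Element `i` belongs to the class among all `n` elements but not among the first `i`, so a
      -- light element gets a rank below `b`.
      have hcls : cls X i p u₀ + 1 ≤ cls X n p u₀ := by
        have h1 : cls X (i + 1) p u₀ = cls X i p u₀ + 1 := by rw [cls_succ, if_pos hu₀.symm]
        rw [← h1]
        exact Finset.card_le_card (Finset.filter_subset_filter _
          (Finset.range_subset_range.2 (by omega)))
      have hrb : r₀ < b := by unfold Heavy at hH; omega
      have hrN : r₀ + 1 < N := by have := cls_le X n p u₀; omega
      simp only [Nat.mod_eq_of_lt hrN]
      -- The listing is injective, so the element is not yet in its bucket.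
      have hnew : ∀ r, σ'.arr 6 0 u₀ r ≠ X (i + 1) := by
        intro r e
        have hne : σ'.arr 6 0 u₀ r ≠ 0 := by rw [e]; have := hX1 i hi; omega
        obtain ⟨⟨j, hj, h1, -⟩, -⟩ := i6 u₀ r hne
        have := hinj j (by omega) i hi (h1.trans e)
        omega
      have hX0 : X (i + 1) ≠ 0 := by have := hX1 i hi; omega
      have hzero : ∀ r, r₀ ≤ r → σ'.arr 6 0 u₀ r = 0 := by
        intro r hr
        by_contra hc
        have := (i6 u₀ r hc).2
        omega
      refine ⟨?_, i1, i2, ?_, ?_, ?_, ?_, ?_⟩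
      · rw [Finset.range_add_one, Finset.filter_insert, if_neg hH]
        omega
      · intro h i' hi' hh' j hj k hk
        rcases Nat.lt_succ_iff_lt_or_eq.1 hi' with h' | rfl
        · exact i3 h i' h' hh' j hj k hk
        · exact absurd hh' hH
      · intro u
        rw [cls_succ]
        split_ifs with h1 h2 h2
        · rw [h1]; omega
        · exact absurd h1.symm h2
        · have := i5 u; omega
        · have := i5 u; omega
      · intro u r h
        by_cases h1 : u = u₀
        · subst h1
          by_cases h2 : r = r₀
          · subst h2
            simp only [and_self, ↓reduceIte]
            exact ⟨⟨i, by omega, rfl, rfl⟩, by omega⟩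
          · simp only [h2, and_false, ↓reduceIte] at h ⊢
            obtain ⟨⟨j, hj, h⟩, h'⟩ := i6 u₀ r h
            exact ⟨⟨j, by omega, h⟩, by omega⟩
        · simp only [h1, false_and, ↓reduceIte] at h ⊢
          obtain ⟨⟨j, hj, h⟩, h'⟩ := i6 u r h
          exact ⟨⟨j, by omega, h⟩, h'⟩
      · intro j hj hl
        rcases Nat.lt_succ_iff_lt_or_eq.1 hj with h' | rfl
        · obtain ⟨r, hr, e⟩ := i7 j h' hl
          refine ⟨r, hr, ?_⟩
          rw [if_neg, e]
          rintro ⟨h1, h2⟩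
          have := hX1 j (by omega)
          rw [h1, h2, hzero r₀ le_rfl] at e
          omega
        · exact ⟨r₀, hrb, by simp [hu₀]⟩
      · intro u r r' h h'
        by_cases h1 : u = u₀
        · subst h1
          by_cases h2 : r = r₀ <;> by_cases h3 : r' = r₀
          · rw [h2, h3]
          · simp only [h2, h3, and_false, and_self, ↓reduceIte] at h'
            exact absurd h'.symm (hnew r')
          · simp only [h2, h3, and_false, and_self, ↓reduceIte] at h'
            exact absurd h' (hnew r)
          · simp only [h2, h3, and_false, ↓reduceIte] at h h'
            exact i8 u₀ r r' h h'
        · simp only [h1, false_and, ↓reduceIte] at h h'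
          exact i8 u r r' h h'
  · rintro t σ' - - ⟨ht, i1, i2, i3, i5, i6, i7, i8⟩
    refine ⟨by omega, i1, i2, fun h i hi j hj k hk e => ⟨fun hh => ?_, fun hh => ?_, fun hh => ?_⟩,
      fun u r h => (i6 u r h).1, i7, i8⟩
    · exact (i3 h i hi hh j hj k hk).1 e
    · exact (i3 h j hj hh i hi k hk).1 (by omega)
    · exact (i3 h k hk hh i hi j hj).2 e

end
end HL

/-! ### The main loop -/

namespace HL
open WordRAM

section
variable {N κ : ℕ} {pr : Prog}

/-- Fill row `v 31` of the oracle array with the default value. -/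
def dummyCmd : Cmd := .for 38 5 (.put 9 (lit 0) (v 31) (v 38 + lit 1) (lit 23 * v 28))

theorem dummyCmd_spec {m e q : ℕ} {σ : St} (h5 : σ.reg 5 = m) (he : σ.reg 31 = e)
    (hq : σ.reg 28 = q) (h0 : ∀ x, σ.arr 9 0 e x = 0) (hm : m + 1 < N) (hqN : 23 * q < N) :
    Runs N pr κ dummyCmd σ (fun t σ' => t ≤ 3 * m + 2 ∧
      (∀ x, σ'.arr 9 0 e x = if 1 ≤ x ∧ x ≤ m then 23 * q else 0) ∧
      ∀ e' x, e' ≠ e → σ'.arr 9 0 e' x = σ.arr 9 0 e' x) := by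
  refine Runs.for_of_invariant (by simp [Cmd.writes]) (by simp [Cmd.writes])
    (by norm_num) (by omega) h5 (fun i t σ' => t = i ∧
      (∀ x, σ'.arr 9 0 e x = if 1 ≤ x ∧ x ≤ i then 23 * q else 0) ∧
      ∀ e' x, e' ≠ e → σ'.arr 9 0 e' x = σ.arr 9 0 e' x) ?_ ?_ ?_
  · refine ⟨rfl, fun x => ?_, fun _ _ _ => rfl⟩
    rw [St.set_arr, h0, if_neg (by omega)]
  · rintro i t σ' hi hx ha ⟨rfl, h1, h2⟩
    have e31 : σ'.reg 31 = e := by rw [ha.reg 31 (by simp [Cmd.writes]), he]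
    have e28 : σ'.reg 28 = q := by rw [ha.reg 28 (by simp [Cmd.writes]), hq]
    simp only [runs_put, eval_plus, eval_mul, eval_var, eval_const, hx, e31, e28,
      Nat.mod_eq_of_lt (show t + 1 < N by omega), Nat.mod_eq_of_lt hqN, St.set_arr, St.put_arr,
      true_and]
    refine ⟨fun x => ?_, fun e' x he' => by rw [if_neg (by tauto), h2 _ _ he']⟩
    rw [h1]
    split_ifs <;> omega
  · rintro t σ' - - ⟨rfl, h1, h2⟩
    exact ⟨by omega, h1, h2⟩

/-- Write the elements of rank `v rk` of block `v blk` to row `v 31` of the oracle array. -/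
def partCmd (blk rk o co : ℕ) : Cmd :=
  .for 39 3 (.assign 42 (.get 6 (lit 0) (v blk * v 3 + v 39) (v rk)) ;;
    .ite (lit 0) (v 42)
      (.put 9 (lit 0) (v 31) (lit o * v 3 + v 39) (lit co * v 28 + v 42 / v 14 % v 28)) .skip)

theorem partCmd_spec {blk rk o co s I al e p q : ℕ} {bk : ℕ → ℕ → ℕ} {σ : St} (h3 : σ.reg 3 = s)
    (hblk : σ.reg blk = I) (hrk : σ.reg rk = al) (he : σ.reg 31 = e) (hp : σ.reg 14 = p)
    (hq : σ.reg 28 = q) (hbk : ∀ u r, σ.arr 6 0 u r = bk u r) (hd : blk ≠ 39 ∧ blk ≠ 42)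
    (hd' : rk ≠ 39 ∧ rk ≠ 42) (hq1 : 1 ≤ q) (hsN : s < N) (hIN : I * s + s < N)
    (hoN : o * s + s < N) (hcN : co * q + q < N) :
    Runs N pr κ (partCmd blk rk o co) σ (fun t σ' => t ≤ 5 * s + 2 ∧
      (∀ x, σ'.arr 9 0 e x = if o * s ≤ x ∧ x < o * s + s ∧ 0 < bk (I * s + (x - o * s)) al then
        co * q + bk (I * s + (x - o * s)) al / p % q else σ.arr 9 0 e x) ∧
      ∀ e' x, e' ≠ e → σ'.arr 9 0 e' x = σ.arr 9 0 e' x) := by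
  refine Runs.for_of_invariant (by simp [Cmd.writes]) (by simp [Cmd.writes])
    (by norm_num) hsN h3 (fun i t σ' => t = 3 * i ∧
      (∀ x, σ'.arr 9 0 e x = if o * s ≤ x ∧ x < o * s + i ∧ 0 < bk (I * s + (x - o * s)) al then
        co * q + bk (I * s + (x - o * s)) al / p % q else σ.arr 9 0 e x) ∧
      ∀ e' x, e' ≠ e → σ'.arr 9 0 e' x = σ.arr 9 0 e' x) ?_ ?_ ?_
  · refine ⟨rfl, fun x => ?_, fun _ _ _ => rfl⟩
    rw [St.set_arr, if_neg (by omega)]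
  · rintro i t σ' hi hx ha ⟨rfl, h1, h2⟩
    have wr : ∀ z, z ≠ 39 ∧ z ≠ 42 → σ'.reg z = σ.reg z := fun z hz =>
      ha.reg z (by simpa [Cmd.writes] using hz)
    have e6 : σ'.arr 6 = σ.arr 6 := ha.arr 6 (by simp [Cmd.tags])
    have hmod : bk (I * s + i) al / p % q < q := Nat.mod_lt _ hq1
    simp only [runs_seq, runs_ite, runs_assign, runs_put, runs_skip, eval_plus, eval_mul, eval_div,
      eval_rem, eval_var, eval_const, eval_get, hx, wr 3 (by simp), wr blk hd, wr rk hd',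
      wr 31 (by simp), wr 14 (by simp), wr 28 (by simp), h3, hblk, hrk, he, hp, hq, e6, hbk,
      St.set_reg, St.set_arr, Nat.reduceEqDiff, ↓reduceIte,
      Nat.mod_eq_of_lt (show I * s < N by omega), Nat.mod_eq_of_lt (show I * s + i < N by omega),
      Nat.mod_eq_of_lt (show o * s < N by omega), Nat.mod_eq_of_lt (show o * s + i < N by omega),
      Nat.mod_eq_of_lt (show co * q < N by omega),
      Nat.mod_eq_of_lt (show co * q + bk (I * s + i) al / p % q < N by omega)]
    have hnew : ∀ x, x ≠ o * s + i → (x < o * s + (i + 1) ↔ x < o * s + i) := fun x hx => by omega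
    split_ifs with hc
    · refine ⟨by omega, fun x => ?_, fun e' x he' => ?_⟩
      · rw [St.put_arr]
        by_cases hxe : x = o * s + i
        · subst hxe
          simp [hc]
        · simp only [hxe, and_false, if_false, St.set_arr, h1, hnew x hxe]
      · rw [St.put_arr, if_neg (by tauto)]
        exact h2 _ _ he'
    · refine ⟨by omega, fun x => ?_, h2⟩
      rw [h1]
      by_cases hxe : x = o * s + i
      · subst hxe
        simp [hc]
      · simp only [hnew x hxe]
  · rintro t σ' - - ⟨rfl, h1, h2⟩
    exact ⟨by omega, h1, h2⟩

/-- Write the third part of the convolution instance to row `v 31` of the oracle array. -/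
def sumCmd : Cmd :=
  .for 38 44 (.assign 40 ((v 32 + v 33) * v 3 + v 38) ;;
    .assign 41 (.get 6 (lit 0) (v 40 % v 14) (v 36)) ;;
    .ite (lit 0) (v 41) (.ite (v 40) (lit 2 * v 14)
      (.put 9 (lit 0) (v 31) (lit 3 * v 3 + v 38)
        (lit 16 * v 28 + v 41 / v 14 % v 28 + v 37 * v 28 - v 40 / v 14)) .skip) .skip)

theorem sumCmd_spec {e : ℕ} {π : Conv.Par} {σ : St} (h3 : σ.reg 3 = π.s)
    (h44 : σ.reg 44 = 2 * π.s) (hI : σ.reg 32 = π.I) (hJ : σ.reg 33 = π.J) (hga : σ.reg 36 = π.ga)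
    (hde : σ.reg 37 = π.de) (he : σ.reg 31 = e) (hp : σ.reg 14 = π.p)
    (hq : σ.reg 28 = π.q) (hbk : ∀ u r, σ.arr 6 0 u r = π.bk u r) (hq1 : 1 ≤ π.q) (hde1 : π.de ≤ 1)
    (hsN : 5 * π.s < N) (hIN : (π.I + π.J) * π.s + 2 * π.s < N) (hIJ : π.I + π.J < N)
    (hpN : 2 * π.p < N) (hqN : 18 * π.q < N) :
    Runs N pr κ sumCmd σ (fun t σ' => t ≤ 14 * π.s + 2 ∧
      (∀ x, σ'.arr 9 0 e x = if 3 * π.s ≤ x ∧ x < 5 * π.s ∧ 0 < π.cv (x - 3 * π.s) ∧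
        π.tt (x - 3 * π.s) < 2 * π.p then 16 * π.q + π.cv (x - 3 * π.s) / π.p % π.q + π.de * π.q -
          π.tt (x - 3 * π.s) / π.p else σ.arr 9 0 e x) ∧
      ∀ e' x, e' ≠ e → σ'.arr 9 0 e' x = σ.arr 9 0 e' x) := by
  refine Runs.for_of_invariant (by simp [Cmd.writes]) (by simp [Cmd.writes])
    (by norm_num) (show 2 * π.s < N by omega) h44 (fun i t σ' => t ≤ 5 * i ∧
      (∀ x, σ'.arr 9 0 e x = if 3 * π.s ≤ x ∧ x < 3 * π.s + i ∧ 0 < π.cv (x - 3 * π.s) ∧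
        π.tt (x - 3 * π.s) < 2 * π.p then 16 * π.q + π.cv (x - 3 * π.s) / π.p % π.q + π.de * π.q -
          π.tt (x - 3 * π.s) / π.p else σ.arr 9 0 e x) ∧
      ∀ e' x, e' ≠ e → σ'.arr 9 0 e' x = σ.arr 9 0 e' x) ?_ ?_ ?_
  · refine ⟨le_rfl, fun x => ?_, fun _ _ _ => rfl⟩
    rw [St.set_arr, if_neg (by omega)]
  · rintro i t σ' hi hx ha ⟨ht, h1, h2⟩
    have wr : ∀ z, z ∉ [38, 40, 41] → σ'.reg z = σ.reg z := fun z hz =>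
      ha.reg z (by simpa [Cmd.writes] using hz)
    have e6 : σ'.arr 6 = σ.arr 6 := ha.arr 6 (by simp [Cmd.tags])
    have htt : (π.I + π.J) * π.s + i = π.tt i := rfl
    have htN : π.tt i < N := by unfold Conv.Par.tt; omega
    have hcv : π.bk (π.tt i % π.p) π.ga = π.cv i := rfl
    have hmod : π.cv i / π.p % π.q < π.q := Nat.mod_lt _ hq1
    have hdq : π.de * π.q ≤ π.q := by nlinarith
    simp only [runs_seq, runs_ite, runs_assign, runs_put, runs_skip, eval_plus, eval_mul, eval_div,
      eval_rem, eval_sub, eval_var, eval_const, eval_get, hx, wr 3 (by simp), wr 32 (by simp),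
      wr 33 (by simp), wr 36 (by simp), wr 37 (by simp),
      wr 31 (by simp), wr 14 (by simp), wr 28 (by simp), h3, hI, hJ, hga, hde, he, hp, hq, e6, hbk,
      St.set_reg, St.set_arr, Nat.reduceEqDiff, ↓reduceIte, Nat.mod_eq_of_lt hIJ,
      Nat.mod_eq_of_lt (show (π.I + π.J) * π.s < N by omega), htt, Nat.mod_eq_of_lt htN, hcv,
      Nat.mod_eq_of_lt (show 3 * π.s < N by omega),
      Nat.mod_eq_of_lt (show 3 * π.s + i < N by omega), Nat.mod_eq_of_lt hpN,
      Nat.mod_eq_of_lt (show 16 * π.q < N by omega), Nat.mod_eq_of_lt (show π.de * π.q < N by omega),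
      Nat.mod_eq_of_lt (show 16 * π.q + π.cv i / π.p % π.q < N by omega),
      Nat.mod_eq_of_lt (show 16 * π.q + π.cv i / π.p % π.q + π.de * π.q < N by omega)]
    have hnew : ∀ x, x ≠ 3 * π.s + i → (x < 3 * π.s + (i + 1) ↔ x < 3 * π.s + i) :=
      fun x hx => by omega
    split_ifs with hc hc'
    · refine ⟨by omega, fun x => ?_, fun e' x he' => ?_⟩
      · rw [St.put_arr]
        by_cases hxe : x = 3 * π.s + i
        · subst hxe
          simp [hc, hc']
        · simp only [hxe, and_false, if_false, St.set_arr, h1, hnew x hxe]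
      · rw [St.put_arr, if_neg (by tauto)]
        exact h2 _ _ he'
    · refine ⟨by omega, fun x => ?_, h2⟩
      rw [h1]
      by_cases hxe : x = 3 * π.s + i
      · subst hxe
        simp [hc']
      · simp only [hnew x hxe]
    · refine ⟨by omega, fun x => ?_, h2⟩
      rw [h1]
      by_cases hxe : x = 3 * π.s + i
      · subst hxe
        simp [hc]
      · simp only [hnew x hxe]
  · rintro t σ' - - ⟨ht, h1, h2⟩
    refine ⟨by omega, fun x => ?_, h2⟩
    rw [h1, show 3 * π.s + 2 * π.s = 5 * π.s by ring]

/-- The registers and arrays that hold the parameters of an instance. -/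
structure Holds (σ : St) (π : Conv.Par) : Prop where
  s : σ.reg 3 = π.s
  s2 : σ.reg 44 = 2 * π.s
  m : σ.reg 5 = 8 * π.s
  p : σ.reg 14 = π.p
  q : σ.reg 28 = π.q
  I : σ.reg 32 = π.I
  J : σ.reg 33 = π.J
  al : σ.reg 34 = π.al
  be : σ.reg 35 = π.be
  ga : σ.reg 36 = π.ga
  de : σ.reg 37 = π.de
  bk : ∀ u r, σ.arr 6 0 u r = π.bk u r

theorem Holds.of_agree {σ σ' : St} {π : Conv.Par} {rs ts : List ℕ} (h : Holds σ π)
    (ha : Agree rs ts σ σ') (hr : ∀ z ∈ [3, 5, 14, 28, 32, 33, 34, 35, 36, 37, 44], z ∉ rs)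
    (ht : 6 ∉ ts) : Holds σ' π := by
  have e : ∀ z ∈ [3, 5, 14, 28, 32, 33, 34, 35, 36, 37, 44], σ'.reg z = σ.reg z :=
    fun z hz => ha.reg z (hr z hz)
  simp only [List.mem_cons, List.not_mem_nil, or_false, forall_eq_or_imp, forall_eq] at e
  obtain ⟨e1, e2, e3, e4, e5, e6, e7, e8, e9, e10, e11⟩ := e
  exact ⟨e1.trans h.s, e11.trans h.s2, e2.trans h.m, e3.trans h.p, e4.trans h.q, e5.trans h.I,
    e6.trans h.J, e7.trans h.al, e8.trans h.be, e9.trans h.ga, e10.trans h.de,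
    fun u r => by rw [ha.arr 6 ht, h.bk]⟩

/-- The numbers that occur in an instance are small. -/
structure Small (N : ℕ) (π : Conv.Par) : Prop where
  q1 : 1 ≤ π.q
  s1 : 1 ≤ π.s
  de1 : π.de ≤ 1
  s : 8 * π.s + 1 < N
  IJs : (π.I + π.J) * π.s + 2 * π.s < N
  IJ : π.I + π.J < N
  p : 2 * π.p < N
  q : 23 * π.q < N

/-- Build the convolution instance in row `v 31` of the oracle array. -/
def buildCmd : Cmd := dummyCmd ;; partCmd 32 34 1 4 ;; partCmd 33 35 2 12 ;; sumCmd

/-- The decoys are written first and then overwritten by three parts with disjoint ranges of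
positions, which reproduces the nested cases of `inst`. -/
theorem buildCmd_spec {e : ℕ} {π : Conv.Par} {σ : St} (h : Holds σ π) (hN : Small N π)
    (he : σ.reg 31 = e) (h0 : ∀ x, σ.arr 9 0 e x = 0) :
    Runs N pr κ buildCmd σ (fun t σ' => t ≤ 48 * π.s + 8 ∧
      (∀ x, σ'.arr 9 0 e x = (input (8 * π.s) π.inst).mem x) ∧
      ∀ e' x, e' ≠ e → σ'.arr 9 0 e' x = σ.arr 9 0 e' x) := by
  obtain ⟨hq1, hs1, hde1, hsN, hIJs, hIJ, hpN, hqN⟩ := hN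
  have hIJ' : (π.I + π.J) * π.s = π.I * π.s + π.J * π.s := by ring
  rw [buildCmd]
  simp only [runs_seq]
  refine (dummyCmd_spec h.m he h.q h0 hsN hqN).mono ?_
  rintro t₁ σ₁ ag₁ ⟨ht₁, c₁, d₁⟩
  have H₁ := h.of_agree ag₁ (by simp [dummyCmd, Cmd.for, Cmd.writes])
    (by simp [dummyCmd, Cmd.for, Cmd.tags])
  have e₁ : σ₁.reg 31 = e := by
    rw [ag₁.reg 31 (by simp [dummyCmd, Cmd.for, Cmd.writes]), he]
  refine (partCmd_spec (o := 1) (co := 4) H₁.s H₁.I H₁.al e₁ H₁.p H₁.q H₁.bk (by simp) (by simp)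
    hq1 (by omega) (by omega) (by omega) (by omega)).mono ?_
  rintro t₂ σ₂ ag₂ ⟨ht₂, c₂, d₂⟩
  have H₂ := H₁.of_agree ag₂ (by simp [partCmd, Cmd.for, Cmd.writes])
    (by simp [partCmd, Cmd.for, Cmd.tags])
  have e₂ : σ₂.reg 31 = e := by
    rw [ag₂.reg 31 (by simp [partCmd, Cmd.for, Cmd.writes]), e₁]
  refine (partCmd_spec (o := 2) (co := 12) H₂.s H₂.J H₂.be e₂ H₂.p H₂.q H₂.bk (by simp) (by simp)
    hq1 (by omega) (by omega) (by omega) (by omega)).mono ?_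
  rintro t₃ σ₃ ag₃ ⟨ht₃, c₃, d₃⟩
  have H₃ := H₂.of_agree ag₃ (by simp [partCmd, Cmd.for, Cmd.writes])
    (by simp [partCmd, Cmd.for, Cmd.tags])
  have e₃ : σ₃.reg 31 = e := by
    rw [ag₃.reg 31 (by simp [partCmd, Cmd.for, Cmd.writes]), e₂]
  refine (sumCmd_spec H₃.s H₃.s2 H₃.I H₃.J H₃.ga H₃.de e₃ H₃.p H₃.q H₃.bk hq1 hde1
    (by omega) hIJs hIJ hpN (by omega)).mono ?_
  rintro t₄ σ₄ - ⟨ht₄, c₄, d₄⟩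
  refine ⟨by omega, fun x => ?_, fun e' x hne => by
    rw [d₄ _ _ hne, d₃ _ _ hne, d₂ _ _ hne, d₁ _ _ hne]⟩
  rw [c₄, c₃, c₂, c₁]
  simp only [one_mul, show 2 * π.s + π.s = 3 * π.s by ring, show π.s + π.s = 2 * π.s by ring,
    input]
  by_cases hx : 1 ≤ x ∧ x ≤ 8 * π.s
  · simp only [hx, and_self, if_true]
    rfl
  · rw [if_neg (by omega), if_neg (by omega), if_neg (by omega), if_neg hx, if_neg hx]

/-- Search for a solution at position `v 38`. -/
def probeCmd : Cmd :=
  .for 39 3 (.ite (v 39) (v 38 + lit 1)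
    (.assign 42 (.get 6 (lit 0) (v 32 * v 3 + v 39) (v 34)) ;;
      .assign 43 (.get 6 (lit 0) (v 33 * v 3 + (v 38 - v 39)) (v 35)) ;;
      .assign 41 (.get 6 (lit 0) (((v 32 + v 33) * v 3 + v 38) % v 14) (v 36)) ;;
      .ite (lit 0) (v 42) (.ite (lit 0) (v 43) (.ite (v 42 + v 43) (v 41 + lit 1)
        (.ite (v 41) (v 42 + v 43 + lit 1) (.assign 27 (lit 1)) .skip) .skip) .skip) .skip) .skip)

/-- The check compares `a + b` and `c` as integers, so a positive answer is always correct, whatever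
the moduli and the oracle reported. -/
theorem probeCmd_spec {k U : ℕ} {π : Conv.Par} {σ : St} (h : Holds σ π) (hN : Small N π)
    (hk : σ.reg 38 = k) (hks : k < 2 * π.s) (hU : ∀ u r, π.bk u r ≤ U) (hUN : 2 * U + 1 < N) :
    Runs N pr κ probeCmd σ (fun t σ' => t ≤ 11 * π.s + 2 ∧ (σ.reg 27 ≤ 1 → σ'.reg 27 ≤ 1) ∧
      (σ'.reg 27 = 1 ↔ σ.reg 27 = 1 ∨ ∃ i < π.s, i ≤ k ∧ 0 < π.av i ∧ 0 < π.bv (k - i) ∧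
        π.av i + π.bv (k - i) = π.cv k)) := by
  obtain ⟨hq1, hs1, hde1, hsN, hIJs, hIJ, hpN, hqN⟩ := hN
  have hIJ' : (π.I + π.J) * π.s = π.I * π.s + π.J * π.s := by ring
  refine Runs.for_of_invariant (by simp [Cmd.writes]) (by simp [Cmd.writes])
    (by norm_num) (show π.s < N by omega) h.s (fun i t σ' => t ≤ 9 * i ∧
      (σ.reg 27 ≤ 1 → σ'.reg 27 ≤ 1) ∧
      (σ'.reg 27 = 1 ↔ σ.reg 27 = 1 ∨ ∃ i' < i, i' ≤ k ∧ 0 < π.av i' ∧ 0 < π.bv (k - i') ∧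
        π.av i' + π.bv (k - i') = π.cv k)) ?_ ?_ ?_
  · simp
  · rintro i t σ' hi hx ha ⟨ht, h1, h2⟩
    have H := h.of_agree ha (by simp [Cmd.writes]) (by simp [Cmd.tags])
    have e38 : σ'.reg 38 = k := by rw [ha.reg 38 (by simp [Cmd.writes]), hk]
    have hs : (∃ i' < i + 1, i' ≤ k ∧ 0 < π.av i' ∧ 0 < π.bv (k - i') ∧
        π.av i' + π.bv (k - i') = π.cv k) ↔ (∃ i' < i, i' ≤ k ∧ 0 < π.av i' ∧ 0 < π.bv (k - i') ∧
        π.av i' + π.bv (k - i') = π.cv k) ∨ (i ≤ k ∧ 0 < π.av i ∧ 0 < π.bv (k - i) ∧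
        π.av i + π.bv (k - i) = π.cv k) := by
      constructor
      · rintro ⟨j, hj, h⟩
        rcases Nat.lt_succ_iff_lt_or_eq.1 hj with h' | rfl
        · exact .inl ⟨j, h', h⟩
        · exact .inr h
      · rintro (⟨j, hj, h⟩ | h)
        · exact ⟨j, by omega, h⟩
        · exact ⟨i, by omega, h⟩
    have hs' : (σ.reg 27 = 1 ∨ ∃ i' < i + 1, i' ≤ k ∧ 0 < π.av i' ∧ 0 < π.bv (k - i') ∧
        π.av i' + π.bv (k - i') = π.cv k) ↔ (σ'.reg 27 = 1 ∨ i ≤ k ∧ 0 < π.av i ∧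
          0 < π.bv (k - i) ∧ π.av i + π.bv (k - i) = π.cv k) := by
      rw [hs, ← or_assoc, ← h2]
    have ea : π.bk (π.I * π.s + i) π.al = π.av i := rfl
    have eb : π.bk (π.J * π.s + (k - i)) π.be = π.bv (k - i) := rfl
    have ec : π.bk (((π.I + π.J) * π.s + k) % π.p) π.ga = π.cv k := rfl
    have ba : π.av i ≤ U := hU _ _
    have bb : π.bv (k - i) ≤ U := hU _ _
    have bc : π.cv k ≤ U := hU _ _
    simp only [runs_seq, runs_ite, runs_assign, runs_skip, eval_plus, eval_mul,
      eval_rem, eval_sub, eval_var, eval_const, eval_get, hx, e38, H.s, H.p, H.I, H.J, H.al, H.be,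
      H.ga, H.bk, St.set_reg, St.set_arr, Nat.reduceEqDiff, ↓reduceIte, Nat.mod_eq_of_lt hIJ,
      Nat.mod_eq_of_lt (show (π.I + π.J) * π.s < N by omega),
      Nat.mod_eq_of_lt (show (π.I + π.J) * π.s + k < N by omega),
      Nat.mod_eq_of_lt (show π.I * π.s < N by omega),
      Nat.mod_eq_of_lt (show π.I * π.s + i < N by omega),
      Nat.mod_eq_of_lt (show π.J * π.s < N by omega),
      Nat.mod_eq_of_lt (show π.J * π.s + (k - i) < N by omega),
      Nat.mod_eq_of_lt (show k + 1 < N by omega), ea, eb, ec,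
      Nat.mod_eq_of_lt (show π.av i + π.bv (k - i) < N by omega),
      Nat.mod_eq_of_lt (show π.av i + π.bv (k - i) + 1 < N by omega),
      Nat.mod_eq_of_lt (show π.cv k + 1 < N by omega), hs']
    clear h2 hs hs'
    split_ifs <;> refine ⟨by omega, ?_, ?_⟩ <;> first | omega | (rw [true_iff]; omega)
  · rintro t σ' - - ⟨ht, h1, h2⟩
    exact ⟨by omega, h1, h2⟩

end
end HL

/-! ### Running the instances -/

namespace Conv.Par

/-- There is a solution at position `k`. -/
def Probe (π : Conv.Par) (k : ℕ) : Prop :=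
  ∃ i < π.s, i ≤ k ∧ 0 < π.av i ∧ 0 < π.bv (k - i) ∧ π.av i + π.bv (k - i) = π.cv k

end Conv.Par

namespace HL
open WordRAM

section
variable {N κ : ℕ} {pr : Prog}

/-- Search for solutions at the positions that the oracle reports. -/
def verifyCmd : Cmd :=
  .for 38 44 (.ite (v 27) (lit 1)
    (.ite (lit 0) (.get 9 (lit 0) (v 31) (lit 3 * v 3 + v 38))
      (.ite (.get 9 (lit 0) (v 31) (lit 3 * v 3 + v 38)) (lit 2) probeCmd .skip) .skip) .skip)

-- Probing stops once a solution is known; hence the factor `1 - σ.reg 27` in the time bound. A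
-- report is a cell equal to `1`, tested as `0 <` and `< 2`.
open Classical in
theorem verifyCmd_spec {e U : ℕ} {π : Conv.Par} {σ : St} (h : Holds σ π) (hN : Small N π)
    (he : σ.reg 31 = e) (hU : ∀ u r, π.bk u r ≤ U) (hUN : 2 * U + 1 < N) (h27 : σ.reg 27 ≤ 1)
    (hrep : ∀ k < 2 * π.s, σ.arr 9 0 e (3 * π.s + k) = 1 ↔ π.Reported k) :
    Runs N pr κ verifyCmd σ (fun t σ' =>
      t ≤ 12 * π.s + 2 + (11 * π.s + 5) * ((1 - σ.reg 27) *
        ((Finset.range (2 * π.s)).filter π.Reported).card) ∧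
      σ'.reg 27 ≤ 1 ∧ (σ.reg 27 = 1 → σ'.reg 27 = 1) ∧
      (σ'.reg 27 = 1 → σ.reg 27 = 1 ∨ ∃ k, π.Probe k) ∧
      (σ'.reg 27 = 0 → ∀ k < 2 * π.s, π.Reported k → ¬π.Probe k)) := by
  have hs8 := hN.s
  refine Runs.for_of_invariant (by simp [Cmd.writes, probeCmd, Cmd.for])
    (by simp [Cmd.writes, probeCmd, Cmd.for])
    (by norm_num) (show 2 * π.s < N by omega) h.s2 (fun i t σ' =>
      t ≤ 4 * i + (11 * π.s + 5) * ((1 - σ.reg 27) *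
        ((Finset.range i).filter π.Reported).card) ∧
      σ'.reg 27 ≤ 1 ∧ (σ.reg 27 = 1 → σ'.reg 27 = 1) ∧
      (σ'.reg 27 = 1 → σ.reg 27 = 1 ∨ ∃ k, π.Probe k) ∧
      (σ'.reg 27 = 0 → ∀ k < i, π.Reported k → ¬π.Probe k)) ?_ ?_ ?_
  · simp [h27]
    tauto
  · rintro i t σ' hi hx ha ⟨ht, h1, h2, h3, h4⟩
    have H := h.of_agree ha (by simp [Cmd.writes, probeCmd, Cmd.for])
      (by simp [Cmd.tags, probeCmd, Cmd.for])
    have e31 : σ'.reg 31 = e := by rw [ha.reg 31 (by simp [Cmd.writes, probeCmd, Cmd.for]), he]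
    have e9 : σ'.arr 9 = σ.arr 9 := ha.arr 9 (by simp [Cmd.tags, probeCmd, Cmd.for])
    have hmono : ((Finset.range i).filter π.Reported).card ≤
        ((Finset.range (i + 1)).filter π.Reported).card :=
      Finset.card_le_card (Finset.filter_subset_filter _
        (Finset.range_subset_range.2 (by omega)))
    have hmono' := Nat.mul_le_mul_left (11 * π.s + 5) (Nat.mul_le_mul_left (1 - σ.reg 27) hmono)
    have hnext : (¬π.Reported i ∨ ¬π.Probe i) → σ'.reg 27 = 0 →
        ∀ k < i + 1, π.Reported k → ¬π.Probe k := by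
      intro hn h0 k hk hr
      rcases Nat.lt_succ_iff_lt_or_eq.1 hk with h' | rfl
      · exact h4 h0 k h' hr
      · tauto
    have hskip : (¬π.Reported i ∨ σ'.reg 27 = 1) →
      σ'.reg 27 = 0 → ∀ k < i + 1, π.Reported k → ¬π.Probe k := by
      rintro (h | h) h0
      · exact hnext (.inl h) h0
      · omega
    have hr := hrep i hi
    simp only [runs_ite, runs_skip, eval_plus, eval_mul, eval_var, eval_const, eval_get, hx, H.s,
      e31, e9, Nat.mod_eq_of_lt (show 3 * π.s < N by omega),
      Nat.mod_eq_of_lt (show 3 * π.s + i < N by omega)]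
    split_ifs with c1 c2 c3
    · have hR : π.Reported i := hr.1 (by omega)
      refine (probeCmd_spec (σ := σ') H hN hx hi hU hUN).mono ?_
      rintro t' σ'' - ⟨ht', hle, hiff⟩
      simp only [St.set_reg, Nat.reduceEqDiff, ↓reduceIte]
      have hns : σ.reg 27 ≠ 1 := fun h' => by have := h2 h'; omega
      rw [show 1 - σ.reg 27 = 1 by omega] at ht ⊢
      have hcard : ((Finset.range (i + 1)).filter π.Reported).card =
          ((Finset.range i).filter π.Reported).card + 1 := by
        rw [Finset.range_add_one, Finset.filter_insert, if_pos hR,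
          Finset.card_insert_of_notMem (by simp)]
      simp only [one_mul] at ht ⊢
      rw [hcard, mul_add (11 * π.s + 5)]
      refine ⟨by omega, hle h1, fun h' => absurd h' hns, fun h' => ?_, fun h' k hk hrk => ?_⟩
      · rcases hiff.1 h' with h'' | h''
        · exact h3 h''
        · exact .inr ⟨i, h''⟩
      · refine hnext (.inr fun hp => ?_) (by omega) k hk hrk
        have := hiff.2 (.inr hp)
        omega
    · simp only [St.set_reg, Nat.reduceEqDiff, ↓reduceIte]
      refine ⟨by omega, h1, h2, h3, hskip (.inl fun h => ?_)⟩
      have := hr.2 h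
      omega
    · simp only [St.set_reg, Nat.reduceEqDiff, ↓reduceIte]
      refine ⟨by omega, h1, h2, h3, hskip (.inl fun h => ?_)⟩
      have := hr.2 h
      omega
    · simp only [St.set_reg, Nat.reduceEqDiff, ↓reduceIte]
      exact ⟨by omega, h1, h2, h3, hskip (.inr (by omega))⟩
  · rintro t σ' - - ⟨ht, h1, h2, h3, h4⟩
    exact ⟨by omega, h1, h2, h3, h4⟩

/-- Compute the parameters of instance number `v 31`. -/
def decodeCmd : Cmd :=
  .assign 32 (v 31 % v 29) ;; .assign 33 (v 31 / v 29 % v 29) ;;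
  .assign 34 (v 31 / v 29 / v 29 % v 4) ;; .assign 35 (v 31 / v 29 / v 29 / v 4 % v 4) ;;
  .assign 36 (v 31 / v 29 / v 29 / v 4 / v 4 % v 4) ;;
  .assign 37 (v 31 / v 29 / v 29 / v 4 / v 4 / v 4)

/-- Build, solve, and verify instance number `v 31`. -/
def stepCmd : Cmd := decodeCmd ;; buildCmd ;; .call 5 31 ;; verifyCmd

/-- The oracle solves Convolution 3SUM for the instance in at most `To` steps. -/
def Solves (pr : Prog) (κ To m : ℕ) (X : ℕ → ℕ) : Prop :=
  ∃ t st, Exec (wordLength κ m) pr (input m X) t st ∧ t ≤ To ∧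
    ∀ k ∈ Set.Icc 1 m, (st.mem k = 1 ↔
      ∃ i ∈ Set.Icc 1 m, ∃ j ∈ Set.Icc 1 m, i + j = k ∧ X i + X j = X k)

-- One round consumes one row of the oracle array, which must still be zero, and leaves the other
-- rows alone. The term `60 * s` consists of `48 * s` for building and `12 * s` for reading the
-- answers.
open Classical in
theorem stepCmd_spec {e U p q s b Q To : ℕ} {bk : ℕ → ℕ → ℕ} {π : Conv.Par} {σ : St}
    (hπ : π = Conv.Par.decode bk p q s b Q e) (h3 : σ.reg 3 = s) (h44 : σ.reg 44 = 2 * s)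
    (h5 : σ.reg 5 = 8 * s) (h14 : σ.reg 14 = p) (h28 : σ.reg 28 = q) (h29 : σ.reg 29 = Q)
    (h4 : σ.reg 4 = b) (he : σ.reg 31 = e) (hbk : ∀ u r, σ.arr 6 0 u r = bk u r)
    (hN : Small N π) (hU : ∀ u r, bk u r ≤ U) (hUN : 2 * U + 1 < N) (h27 : σ.reg 27 ≤ 1)
    (h0 : ∀ x, σ.arr 9 0 e x = 0) (hw : 2 ^ wordLength κ (8 * s) ≤ N)
    (horc : Solves pr κ To (8 * s) π.inst) :
    Runs N pr κ stepCmd σ (fun t σ' =>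
      t ≤ 60 * s + To + 17 + (11 * s + 5) * ((1 - σ.reg 27) *
        ((Finset.range (2 * s)).filter π.Reported).card) ∧
      σ'.reg 27 ≤ 1 ∧ (σ.reg 27 = 1 → σ'.reg 27 = 1) ∧
      (σ'.reg 27 = 1 → σ.reg 27 = 1 ∨ ∃ k, π.Probe k) ∧
      (σ'.reg 27 = 0 → ∀ k < 2 * s, π.Reported k → ¬π.Probe k) ∧
      ∀ e' x, e' ≠ e → σ'.arr 9 0 e' x = σ.arr 9 0 e' x) := by
  obtain ⟨tₒ, st, hex, hto, hans⟩ := horc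
  have hπs : π.s = s := by rw [hπ]; rfl
  rw [stepCmd, runs_seq]
  have hdec : Runs N pr κ decodeCmd σ (fun t σ' => t = 6 ∧ Holds σ' π ∧ σ'.reg 31 = e ∧
      σ'.reg 27 = σ.reg 27 ∧ σ'.arr = σ.arr) := by
    rw [decodeCmd]
    simp only [runs_seq, runs_assign, eval_div, eval_rem, eval_var, St.set_reg, Nat.reduceEqDiff,
      ↓reduceIte, he, h29, h4, St.set_arr, and_true, true_and]
    rw [hπ]
    constructor <;> simp [Conv.Par.decode, h3, h44, h5, h14, h28, hbk]
  refine hdec.mono ?_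
  rintro t₁ σ₁ - ⟨rfl, H₁, e₁, f₁, a₁⟩
  rw [runs_seq]
  refine (buildCmd_spec (σ := σ₁) H₁ hN e₁ (by rw [a₁]; exact h0)).mono ?_
  rintro t₂ σ₂ ag₂ ⟨ht₂, c₂, d₂⟩
  have H₂ := H₁.of_agree ag₂
    (by simp [buildCmd, dummyCmd, partCmd, sumCmd, Cmd.for, Cmd.writes])
    (by simp [buildCmd, dummyCmd, partCmd, sumCmd, Cmd.for, Cmd.tags])
  have e₂ : σ₂.reg 31 = e := by
    rw [ag₂.reg 31 (by simp [buildCmd, dummyCmd, partCmd, sumCmd, Cmd.for, Cmd.writes]), e₁]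
  have f₂ : σ₂.reg 27 = σ.reg 27 := by
    rw [ag₂.reg 27 (by simp [buildCmd, dummyCmd, partCmd, sumCmd, Cmd.for, Cmd.writes]), f₁]
  have m₂ : σ₂.reg 5 = 8 * s := by rw [H₂.m, hπs]
  rw [runs_seq]
  refine Runs.call π.inst (fun k _ => ?_) (by rwa [m₂]) (by rw [m₂]; exact hex) ?_
  · rw [e₂, m₂, ← hπs]; exact c₂ k
  rw [e₂]
  have H₃ : Holds (σ₂.putRow orcTag 0 e st.mem) π :=
    H₂.of_agree (rs := []) (ts := [orcTag])
      ⟨fun _ _ => rfl, fun t ht => by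
        have : t ≠ orcTag := by simpa using ht
        funext i j k
        simp [this]⟩ (by simp) (by simp [orcTag])
  refine (verifyCmd_spec (σ := σ₂.putRow orcTag 0 e st.mem) (e := e) H₃ hN (by simp [e₂])
    (U := U) (by rw [hπ]; exact hU) hUN (by simp [f₂, h27]) (fun k hk => ?_)).mono ?_
  · have := hN.s1
    simp only [St.putRow_arr, orcTag, and_self, if_true]
    rw [hans _ ⟨by omega, by omega⟩, ← hπs, π.exists_inst_iff hN.q1 hN.s1 hN.de1 hk]
    rfl
  · rintro t₃ σ₃ ag₃ ⟨ht₃, g1, g2, g3, g4⟩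
    simp only [St.putRow_reg, f₂, hπs] at ht₃ g2 g3 g4
    refine ⟨by omega, g1, g2, g3, g4, fun e' x hne => ?_⟩
    rw [ag₃.arr 9 (by simp [verifyCmd, probeCmd, Cmd.for, Cmd.tags]), St.putRow_arr,
      if_neg (by tauto), d₂ _ _ hne, a₁]

/-- Run all instances. -/
def mainCmd : Cmd :=
  .assign 44 (lit 2 * v 3) ;; .assign 29 (v 14 / v 3 + lit 1) ;;
  .assign 30 (lit 2 * v 4 * v 4 * v 4 * v 29 * v 29) ;; .for 31 30 stepCmd

/-- As long as no solution is found, probes are paid for by false triples modulo `p q`. The round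
that finds a solution may probe up to `2 s` positions, and later rounds probe none. -/
theorem mainCmd_spec {U p q s b Q To : ℕ} {A : Finset ℕ} {bk : ℕ → ℕ → ℕ} {σ : St}
    (h3 : σ.reg 3 = s) (h5 : σ.reg 5 = 8 * s) (h14 : σ.reg 14 = p) (h28 : σ.reg 28 = q)
    (h4 : σ.reg 4 = b) (h27 : σ.reg 27 ≤ 1) (hbk : ∀ u r, σ.arr 6 0 u r = bk u r)
    (h0 : ∀ e x, σ.arr 9 0 e x = 0) (hQ : Q = p / s + 1) (hp : 1 ≤ p) (hq : 1 ≤ q) (hs : 1 ≤ s)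
    (hb : 1 ≤ b) (hA0 : 0 ∉ A) (hAU : ∀ a ∈ A, a ≤ U)
    (hbA : ∀ u r, bk u r ≠ 0 → bk u r ∈ A ∧ bk u r % p = u)
    (hinj : ∀ u r r', bk u r ≠ 0 → bk u r = bk u r' → r = r')
    (hUN : 2 * U + 1 < N) (hsN : 8 * s + 1 < N) (hQsN : 2 * Q * s + 2 * s < N) (hpN : 2 * p < N)
    (hqN : 23 * q < N) (htN : 2 * b * b * b * Q * Q < N) (hw : 2 ^ wordLength κ (8 * s) ≤ N)
    (horc : ∀ X : ℕ → ℕ, (∀ i ∈ Set.Icc 1 (8 * s), X i ∈ Set.Icc 1 (23 * q)) →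
      Solves pr κ To (8 * s) X) :
    Runs N pr κ mainCmd σ (fun t σ' =>
      t ≤ 2 * b * b * b * Q * Q * (60 * s + To + 19) +
        (11 * s + 5) * ((Pseudo.falTriples A (p * q)).card + 2 * s) + 5 ∧
      σ'.reg 27 ≤ 1 ∧ (σ'.reg 27 = 1 → σ.reg 27 = 1 ∨ ∃ x ∈ A, ∃ y ∈ A, ∃ z ∈ A, x + y = z) ∧
      (σ'.reg 27 = 0 → σ.reg 27 = 0 ∧ ∀ x ∈ A, ∀ y ∈ A, ∀ z ∈ A, x + y = z →
        (∃ r < b, bk (x % p) r = x) → (∃ r < b, bk (y % p) r = y) →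
        ¬∃ r < b, bk (z % p) r = z)) := by
  classical
  have hQ1 : 1 ≤ Q := by rw [hQ]; exact Nat.le_add_left _ _
  set dec := Conv.Par.decode bk p q s b Q with hdec
  have htb : b ≤ 2 * b * b * b * Q * Q := by
    calc b = 1 * b * 1 * 1 * 1 * 1 := by ring
      _ ≤ 2 * b * b * b * Q * Q := by gcongr; norm_num
  have hb2 : 2 * b < N := by
    refine lt_of_le_of_lt ?_ htN
    calc 2 * b = 2 * b * 1 * 1 * 1 * 1 := by ring
      _ ≤ 2 * b * b * b * Q * Q := by gcongr
  have hb3 : 2 * b * b < N := by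
    refine lt_of_le_of_lt ?_ htN
    calc 2 * b * b = 2 * b * b * 1 * 1 * 1 := by ring
      _ ≤ 2 * b * b * b * Q * Q := by gcongr
  have hb4 : 2 * b * b * b < N := by
    refine lt_of_le_of_lt ?_ htN
    calc 2 * b * b * b = 2 * b * b * b * 1 * 1 := by ring
      _ ≤ 2 * b * b * b * Q * Q := by gcongr
  have hb5 : 2 * b * b * b * Q < N := by
    refine lt_of_le_of_lt ?_ htN
    calc 2 * b * b * b * Q = 2 * b * b * b * Q * 1 := by ring
      _ ≤ 2 * b * b * b * Q * Q := by gcongr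
  have hQN : 2 * Q < N := by
    have : 2 * Q ≤ 2 * Q * s := Nat.le_mul_of_pos_right _ hs
    omega
  have hsmall : ∀ e < 2 * b * b * b * Q * Q, Small N (dec e) := by
    intro e he
    have hI : (dec e).I < Q := Nat.mod_lt _ hQ1
    have hJ : (dec e).J < Q := Nat.mod_lt _ hQ1
    have hIJ : ((dec e).I + (dec e).J) * s ≤ 2 * Q * s := Nat.mul_le_mul_right _ (by omega)
    refine ⟨hq, hs, Conv.Par.decode_de_le he, hsN, ?_, by omega, hpN, hqN⟩
    show ((dec e).I + (dec e).J) * s + 2 * s < N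
    omega
  have hsound : ∀ e, (dec e).Sound := fun e u r h => (hbA u r h).2
  have hbU : ∀ u r, bk u r ≤ U := fun u r => by
    by_cases h : bk u r = 0
    · omega
    · exact hAU _ (hbA u r h).1
  have hprobe : ∀ e k, (dec e).Probe k → ∃ x ∈ A, ∃ y ∈ A, ∃ z ∈ A, x + y = z := by
    rintro e k ⟨i, hi, hik, ha, hb, h⟩
    have hc : 0 < (dec e).cv k := by omega
    exact ⟨_, (hbA _ _ ha.ne').1, _, (hbA _ _ hb.ne').1, _, (hbA _ _ hc.ne').1, h⟩
  rw [mainCmd]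
  simp only [runs_seq, runs_assign, eval_plus, eval_mul, eval_div, eval_var, eval_const,
    St.set_reg, Nat.reduceEqDiff, ↓reduceIte, h3, h14, h4, ← hQ,
    Nat.mod_eq_of_lt (show 2 * s < N by omega), Nat.mod_eq_of_lt (show Q < N by omega),
    Nat.mod_eq_of_lt hb2, Nat.mod_eq_of_lt hb3, Nat.mod_eq_of_lt hb4, Nat.mod_eq_of_lt hb5,
    Nat.mod_eq_of_lt htN]
  have hwr : stepCmd.writes = [32, 33, 34, 35, 36, 37, 38, 38, 39, 42, 39, 39, 42, 39, 38, 40, 41,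
      38, 38, 39, 42, 43, 41, 27, 39, 38] := rfl
  have htg : stepCmd.tags = [9, 9, 9, 9, 9] := rfl
  refine Runs.for_of_invariant (by simp [hwr]) (by simp [hwr])
    (by norm_num) htN (by simp) (fun e t σ' =>
      t ≤ e * (60 * s + To + 17) +
        (11 * s + 5) * (∑ e' ∈ Finset.range e, ((dec e').fiber A).card + 2 * s * σ'.reg 27) ∧
      σ'.reg 27 ≤ 1 ∧ (σ'.reg 27 = 1 → σ.reg 27 = 1 ∨ ∃ x ∈ A, ∃ y ∈ A, ∃ z ∈ A, x + y = z) ∧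
      (σ'.reg 27 = 0 → σ.reg 27 = 0 ∧ ∀ e' < e, ∀ k < 2 * s, (dec e').Reported k →
        ¬(dec e').Probe k) ∧ ∀ e' ≥ e, ∀ x, σ'.arr 9 0 e' x = 0) ?_ ?_ ?_
  · simp only [St.set_reg, Nat.reduceEqDiff, ↓reduceIte, St.set_arr]
    refine ⟨by simp, h27, fun h => .inl h, fun h => ⟨h, by simp⟩, fun e' _ x => h0 e' x⟩
  · rintro e t σ' he hx ha ⟨ht, i1, i2, i3, i4⟩
    have wr : ∀ z ∈ [3, 4, 5, 14, 28, 29, 44], z ∉ 31 :: stepCmd.writes := by simp [hwr]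
    refine (stepCmd_spec (σ := σ') (e := e) (π := dec e) (Q := Q) rfl
      (by rw [ha.reg 3 (wr 3 (by simp))]; simp [h3])
      (by rw [ha.reg 44 (wr 44 (by simp))]; simp) (by rw [ha.reg 5 (wr 5 (by simp))]; simp [h5])
      (by rw [ha.reg 14 (wr 14 (by simp))]; simp [h14])
      (by rw [ha.reg 28 (wr 28 (by simp))]; simp [h28])
      (by rw [ha.reg 29 (wr 29 (by simp))]; simp) (by rw [ha.reg 4 (wr 4 (by simp))]; simp [h4])
      hx (fun u r => by rw [ha.arr 6 (by simp [htg])]; exact hbk u r) (hsmall e he) hbU hUN i1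
      (i4 e le_rfl) hw (horc _ fun x _ => (dec e).inst_pos hq (hsmall e he).de1 x)).mono ?_
    rintro t' σ'' - ⟨ht', j1, j2, j3, j4, j5⟩
    simp only [St.set_reg, Nat.reduceEqDiff, ↓reduceIte, St.set_arr]
    refine ⟨?_, j1, fun h => ?_, fun h => ?_, fun e' he' x => ?_⟩
    · have hmul : (e + 1) * (60 * s + To + 17) = e * (60 * s + To + 17) + (60 * s + To + 17) := by
        ring
      -- The potential `2 * s * σ.reg 27` rises exactly in the round that finds a solution and
      -- absorbs its probes. In a round without success every reported position is false and is
      -- charged to the fiber.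
      have hext : (11 * s + 5) * ((1 - σ'.reg 27) *
          ((Finset.range (2 * s)).filter (dec e).Reported).card) +
          (11 * s + 5) * (2 * s * σ'.reg 27) ≤
          (11 * s + 5) * (((dec e).fiber A).card + 2 * s * σ''.reg 27) := by
        rw [← mul_add]
        refine Nat.mul_le_mul_left _ ?_
        by_cases hc : σ'.reg 27 = 1
        · rw [j2 hc, hc]
          omega
        · rw [show σ'.reg 27 = 0 by omega, mul_zero, add_zero, Nat.sub_zero, one_mul]
          rcases Nat.lt_or_ge 0 (σ''.reg 27) with h | h
          · rw [show σ''.reg 27 = 1 by omega]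
            have := Finset.card_filter_le (Finset.range (2 * s)) (dec e).Reported
            rw [Finset.card_range] at this
            omega
          -- No success in this round means that no reported position has a true solution, which is
          -- what the charging lemma needs.
          · refine le_trans ?_ (Nat.le_add_right _ _)
            refine Conv.Par.card_reported_le (hsound e) (fun u r h => (hbA u r h).1) ?_
            intro i hi j hj hit heq
            have hi' : i < s := hi
            have hj' : j < s := hj
            refine j4 (by omega) (i + j) (by omega) ⟨i, hi, j, hj, rfl, hit⟩
              ⟨i, hi, by omega, hit.1, ?_⟩
            rw [Nat.add_sub_cancel_left]
            exact ⟨hit.2.1, heq⟩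
      rw [Finset.sum_range_succ, hmul]
      simp only [mul_add] at ht hext ht' ⊢
      omega
    · rcases j3 h with h' | ⟨k, hk⟩
      · exact i2 h'
      · exact .inr (hprobe e k hk)
    · have h' : σ'.reg 27 = 0 := by
        by_contra hc
        have := j2 (by omega)
        omega
      refine ⟨(i3 h').1, fun e' he' k hk hr => ?_⟩
      rcases Nat.lt_succ_iff_lt_or_eq.1 he' with h'' | rfl
      · exact (i3 h').2 e' h'' k hk hr
      · exact j4 h k hk hr
    · rw [j5 _ _ (by omega)]
      exact i4 e' (by omega) x
  · rintro t σ' - - ⟨ht, i1, i2, i3, i4⟩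
    refine ⟨?_, i1, i2, fun h => ⟨(i3 h).1, ?_⟩⟩
    · have h1 : ∑ e ∈ Finset.range (2 * b * b * b * Q * Q), ((dec e).fiber A).card ≤
          (Pseudo.falTriples A (p * q)).card :=
        Conv.Par.sum_card_fiber_le hp hq hA0 hinj _
      have h2 : 2 * s * σ'.reg 27 ≤ 2 * s := by
        calc 2 * s * σ'.reg 27 ≤ 2 * s * 1 := Nat.mul_le_mul_left _ i1
          _ = 2 * s := by ring
      have h3 := Nat.mul_le_mul_left (11 * s + 5) (add_le_add h1 h2)
      generalize 2 * b * b * b * Q * Q = T at *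
      have h4 : T * (60 * s + To + 19) = T * (60 * s + To + 17) + 2 * T := by ring
      omega
    · rintro x hx y hy z hz hxyz ⟨al, hal, ea⟩ ⟨be, hbe, eb⟩ ⟨ga, hga, ec⟩
      have x0 : 0 < x := Nat.pos_of_ne_zero fun h => hA0 (h ▸ hx)
      have y0 : 0 < y := Nat.pos_of_ne_zero fun h => hA0 (h ▸ hy)
      -- Completeness: a solution by elements in buckets is a hit of one particular instance, so the
      -- oracle reports its position and the probe would have found it.
      obtain ⟨de, hde, hall⟩ := Conv.Par.exists_hit (q := q) (s := s) hp hxyz ea eb ec x0 y0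
      have hlt : ∀ w, w % p / s < Q := fun w => by
        have := Nat.div_le_div_right (c := s) (Nat.mod_lt w hp).le
        omega
      obtain ⟨e, he, hdece⟩ := Conv.Par.exists_decode bk p q s (hlt x) (hlt y) hal hbe hga hde
      obtain ⟨hit, ha, hb, hc⟩ := hall _ hdece
      have h1 : x % p % s < s := Nat.mod_lt _ hs
      have h2 : y % p % s < s := Nat.mod_lt _ hs
      refine (i3 h).2 e he (x % p % s + y % p % s) (by omega) ⟨_, h1, _, h2, rfl, hit⟩
        ⟨_, h1, by omega, hit.1, ?_⟩
      rw [Nat.add_sub_cancel_left]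
      refine ⟨hit.2.1, ?_⟩
      rw [ha, hb, hc, hxyz]

end
end HL

/-! ### Counting estimates -/

namespace HL.Bounds

theorem mul_sqrt_le {n B s y : ℕ} (hBs : B ≤ s) (hs : s ^ 20 ≤ n) (hs1 : 1 ≤ s)
    (hy : y ^ 2 ≤ n) : B * y ≤ n := by
  have h1 : B ^ 2 ≤ n := (Nat.pow_le_pow_left hBs 2).trans
    ((Nat.pow_le_pow_right hs1 (by norm_num)).trans hs)
  refine (Nat.pow_le_pow_iff_left (n := 2) (by norm_num)).1 ?_
  calc (B * y) ^ 2 = B ^ 2 * y ^ 2 := by ring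
    _ ≤ n * n := Nat.mul_le_mul h1 hy
    _ = n ^ 2 := by ring

theorem mul_sq_le {n B s : ℕ} (hBs : B ≤ s) (hs : s ^ 20 ≤ n) (hs1 : 1 ≤ s) :
    B * s ^ 2 ≤ n :=
  calc B * s ^ 2 ≤ s * s ^ 2 := Nat.mul_le_mul_right _ hBs
    _ = s ^ 3 := by ring
    _ ≤ s ^ 20 := Nat.pow_le_pow_right hs1 (by norm_num)
    _ ≤ n := hs

/-- Since `3 ^ 5 ≤ 2 ^ 8`, the number `3 ^ l` is at most `(2 ^ l) ^ (8 / 5)`; the fifth power keeps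
the exponents integral. What remains is `s ^ 31 ≤ s ^ 40 ≤ n ^ 2`, where the smallness `s ^ 20 ≤ n`
enters. -/
theorem karatsuba_le {n B s l : ℕ} (hBs : B ≤ s) (hs : s ^ 20 ≤ n) (hs1 : 1 ≤ s)
    (hl : 2 ^ l ≤ 16 * (n * s ^ 2)) : B * (s ^ 2 * 3 ^ l) ≤ 128 * n ^ 2 := by
  refine (Nat.pow_le_pow_iff_left (n := 5) (by norm_num)).1 ?_
  calc (B * (s ^ 2 * 3 ^ l)) ^ 5 = B ^ 5 * s ^ 10 * (3 ^ 5) ^ l := by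
        rw [← pow_mul 3 5 l, mul_comm 5 l, pow_mul]; ring
    _ ≤ s ^ 5 * s ^ 10 * (2 ^ 8) ^ l := Nat.mul_le_mul
        (Nat.mul_le_mul_right _ (Nat.pow_le_pow_left hBs 5))
        (Nat.pow_le_pow_left (by norm_num : 3 ^ 5 ≤ 2 ^ 8) l)
    _ = s ^ 15 * (2 ^ l) ^ 8 := by rw [← pow_mul, mul_comm 8 l, pow_mul]; ring
    _ ≤ s ^ 15 * (16 * (n * s ^ 2)) ^ 8 := by gcongr
    _ = 16 ^ 8 * n ^ 8 * s ^ 31 := by ring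
    _ ≤ 16 ^ 8 * n ^ 8 * s ^ 40 := by gcongr; norm_num
    _ = 16 ^ 8 * n ^ 8 * (s ^ 20) ^ 2 := by ring
    _ ≤ 16 ^ 8 * n ^ 8 * n ^ 2 := by gcongr
    _ ≤ 128 ^ 5 * (n ^ 2) ^ 5 := by
        rw [show 16 ^ 8 * n ^ 8 * n ^ 2 = 16 ^ 8 * (n ^ 2) ^ 5 by ring]
        exact Nat.mul_le_mul_right _ (by norm_num : 16 ^ 8 ≤ 128 ^ 5)
    _ = (128 * n ^ 2) ^ 5 := by ring

/-- Two choices of a factor of `p` each gain `D / y`, and `y ^ 2` is at least `n / 4`. -/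
theorem off_le {n y D o₁ o : ℕ} (hn : 1 ≤ n) (hy : n ≤ 4 * y ^ 2) (h₁ : y * o₁ ≤ D * n ^ 2)
    (h : y * o ≤ D * o₁) : o ≤ 4 * D ^ 2 * n := by
  refine Nat.le_of_mul_le_mul_left ?_ hn
  calc n * o ≤ 4 * y ^ 2 * o := Nat.mul_le_mul_right _ hy
    _ = 4 * y * (y * o) := by ring
    _ ≤ 4 * y * (D * o₁) := Nat.mul_le_mul_left _ h
    _ = 4 * D * (y * o₁) := by ring
    _ ≤ 4 * D * (D * n ^ 2) := Nat.mul_le_mul_left _ h₁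
    _ = n * (4 * D ^ 2 * n) := by ring

/-- The threshold `B ^ 2` makes the heavy elements number at most `4 D ^ 2 n / B ^ 2`, and `D ^ 2 ≤
D ^ 3 ≤ K B` leaves a saving of `B`. -/
theorem heavy_le {n B D K H o : ℕ} (hB : 1 ≤ B) (hD1 : 1 ≤ D) (hD : D ^ 3 ≤ K * B)
    (ho : o ≤ 4 * D ^ 2 * n) (h : H * (B * B) ≤ o) : B * H ≤ 4 * K * n := by
  refine Nat.le_of_mul_le_mul_left ?_ hB
  calc B * (B * H) = H * (B * B) := by ring
    _ ≤ 4 * D ^ 2 * n := h.trans ho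
    _ ≤ 4 * D ^ 3 * n := by gcongr; norm_num
    _ ≤ 4 * (K * B) * n := by gcongr
    _ = B * (4 * K * n) := by ring

/-- The choice of `q` among `s ^ 2` candidates gains `s ^ 2 / D` on `O(D ^ 2 n ^ 2)` false triples.
One factor `s` pays for the probe of a position, and the other one covers `D ^ 3` and the saving. -/
theorem fal_le {n B s D K F f o : ℕ} (hB : 1 ≤ B) (hBs : B ^ 2 ≤ s) (hD1 : 1 ≤ D)
    (hD : D ^ 3 ≤ K * B) (ho : o ≤ 4 * D ^ 2 * n) (hf : f ≤ n * (n + o)) (h : s ^ 2 * F ≤ D * f) :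
    B * (s * F) ≤ 5 * K * n ^ 2 := by
  refine Nat.le_of_mul_le_mul_left ?_ hB
  calc B * (B * (s * F)) = B ^ 2 * (s * F) := by ring
    _ ≤ s * (s * F) := Nat.mul_le_mul_right _ hBs
    _ = s ^ 2 * F := by ring
    _ ≤ D * (n * (n + 4 * D ^ 2 * n)) := by
        refine h.trans (Nat.mul_le_mul_left _ (hf.trans ?_)); gcongr
    _ = D ^ 1 * n ^ 2 + 4 * D ^ 3 * n ^ 2 := by ring
    _ ≤ D ^ 3 * n ^ 2 + 4 * D ^ 3 * n ^ 2 := by gcongr; norm_num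
    _ = 5 * D ^ 3 * n ^ 2 := by ring
    _ ≤ 5 * (K * B) * n ^ 2 := by gcongr
    _ = B * (5 * K * n ^ 2) := by ring

/-- There are `2 B ^ 6 Q ^ 2` instances with `Q s = O(n)`. A saving of `B ^ 16` per oracle call
outweighs `B ^ 6` and the desired `B`; the excess is the factor `B ^ 9`. -/
theorem main_le {n B s p Q To C : ℕ} (hB : 1 ≤ B) (hBs : B ^ 16 ≤ s) (hsn : s ≤ n)
    (hp : p ≤ 4 * n) (hQ : Q = p / s + 1) (hTo : To * B ^ 16 ≤ C * s ^ 2) :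
    B * (2 * (B * B) * (B * B) * (B * B) * Q * Q * (60 * s + To + 19)) ≤
      50 * (79 + C) * n ^ 2 := by
  have hs1 : 1 ≤ s := (Nat.one_le_pow _ _ hB).trans hBs
  have hQs : Q * s ≤ 5 * n := by
    have := Nat.div_mul_le_self p s
    rw [hQ, add_mul]
    omega
  refine Nat.le_of_mul_le_mul_left ?_ (show 0 < B ^ 9 by positivity)
  calc B ^ 9 * (B * (2 * (B * B) * (B * B) * (B * B) * Q * Q * (60 * s + To + 19)))
      = 2 * Q ^ 2 * (B ^ 16 * (60 * s + 19) + To * B ^ 16) := by ring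
    _ ≤ 2 * Q ^ 2 * (s * (60 * s + 19 * s) + C * s ^ 2) := by
        gcongr
        omega
    _ = 2 * (Q * s) ^ 2 * (79 + C) := by ring
    _ ≤ 2 * (5 * n) ^ 2 * (79 + C) := by gcongr
    _ = 1 * (50 * (79 + C) * n ^ 2) := by ring
    _ ≤ B ^ 9 * (50 * (79 + C) * n ^ 2) := by gcongr; exact Nat.one_le_pow _ _ hB

/-- The universe is polynomial in `n` and `n < (B + 1) ^ g`, so a divisor bound with a small enough
exponent, here `1 / (3 (c + 1) g)`, turns into a cube root of `O(B)`. The constant `K` may depend on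
`c` and `g` but not on `n`. -/
theorem exists_divisor_bound (c g : ℕ) (hg : 1 ≤ g) : ∃ K : ℕ, ∀ n B : ℕ, 1 ≤ B →
    n < (B + 1) ^ g → ∃ D, 1 ≤ D ∧ D ^ 3 ≤ K * B ∧
      ∀ z, 0 < z → z ≤ 2 * n ^ c → z.divisors.card ≤ D := by
  obtain ⟨C, hC, h⟩ := Pseudo.card_divisors_pow_le (3 * ((c + 1) * g))
  refine ⟨4 * C, fun n B hB hn => ?_⟩
  have hpow : ∀ z, 0 < z → z ≤ 2 * n ^ c → z.divisors.card ^ 3 ≤ 4 * C * B := by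
    intro z hz hzn
    have hM : (c + 1) * g ≠ 0 := Nat.mul_ne_zero (by omega) (by omega)
    refine (Nat.pow_le_pow_iff_left hM).1 ?_
    rw [← pow_mul]
    have h2 : n ^ c ≤ (2 * B) ^ ((c + 1) * g) := by
      calc n ^ c ≤ ((B + 1) ^ g) ^ c := Nat.pow_le_pow_left hn.le c
        _ = (B + 1) ^ (g * c) := by rw [pow_mul]
        _ ≤ (2 * B) ^ (g * c) := Nat.pow_le_pow_left (by omega) _
        _ ≤ (2 * B) ^ ((c + 1) * g) := Nat.pow_le_pow_right (by omega) (by nlinarith)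
    calc z.divisors.card ^ (3 * ((c + 1) * g)) ≤ C * z := h z hz.ne'
      _ ≤ C * (2 * (2 * B) ^ ((c + 1) * g)) := Nat.mul_le_mul_left _ (by omega)
      _ = 2 * C * (2 * B) ^ ((c + 1) * g) := by ring
      _ ≤ (2 * C) ^ ((c + 1) * g) * (2 * B) ^ ((c + 1) * g) :=
          Nat.mul_le_mul_right _ (Nat.le_self_pow hM _)
      _ = (4 * C * B) ^ ((c + 1) * g) := by rw [← mul_pow]; congr 1; ring
  rcases Nat.eq_zero_or_pos (n ^ c) with h0 | h0
  · exact ⟨1, le_rfl, by nlinarith, fun z hz hz' => by omega⟩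
  · obtain ⟨z₀, hz₀, hmax⟩ := Finset.exists_max_image (Finset.Icc 1 (2 * n ^ c))
      (fun z => z.divisors.card) ⟨1, by simp; omega⟩
    rw [Finset.mem_Icc] at hz₀
    refine ⟨z₀.divisors.card, ?_, hpow _ (by omega) hz₀.2,
      fun z hz hz' => hmax z (Finset.mem_Icc.2 ⟨hz, hz'⟩)⟩
    exact Finset.card_pos.2 ⟨1, by simp; omega⟩

end HL.Bounds

/-! ### Counting over the listing of a set -/

namespace HL
open Finset

variable {n : ℕ} {X : ℕ → ℕ} {A : Finset ℕ}

theorem cls_eq (hA : A = (range n).image fun j => X (j + 1))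
    (hinj : ∀ i < n, ∀ j < n, X (i + 1) = X (j + 1) → i = j) (M r : ℕ) :
    cls X n M r = #{a ∈ A | a % M = r} := by
  rw [cls, hA, filter_image, card_image_of_injOn]
  intro i hi j hj h
  simp only [coe_filter, mem_range, Set.mem_ofPred_eq] at hi hj
  exact hinj i hi.1 j hj.1 h

theorem sum_listing (hA : A = (range n).image fun j => X (j + 1))
    (hinj : ∀ i < n, ∀ j < n, X (i + 1) = X (j + 1) → i = j) (f : ℕ → ℕ) :
    ∑ j ∈ range n, f (X (j + 1)) = ∑ a ∈ A, f a := by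
  rw [hA, sum_image]
  intro i hi j hj h
  exact hinj i (by simpa using hi) j (by simpa using hj) h

theorem sum_cls_eq_coll (hA : A = (range n).image fun j => X (j + 1))
    (hinj : ∀ i < n, ∀ j < n, X (i + 1) = X (j + 1) → i = j) (M : ℕ) :
    ∑ j ∈ range n, cls X n M (X (j + 1) % M) = Pseudo.coll A M := by
  rw [sum_listing hA hinj fun a => cls X n M (a % M), Pseudo.coll, card_filter, sum_product]
  refine sum_congr rfl fun a _ => ?_
  rw [cls_eq hA hinj, card_filter]
  simp only [eq_comm]

theorem triCount_eq_tri (hA : A = (range n).image fun j => X (j + 1))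
    (hinj : ∀ i < n, ∀ j < n, X (i + 1) = X (j + 1) → i = j) (M : ℕ) :
    triCount X n M = Pseudo.tri A M := by
  rw [triCount, Pseudo.tri, card_filter, sum_product]
  rw [sum_listing hA hinj fun a => ∑ j ∈ range n, cls X n M ((a + X (j + 1)) % M)]
  refine sum_congr rfl fun a _ => ?_
  rw [sum_product, sum_listing hA hinj fun b => cls X n M ((a + b) % M)]
  refine sum_congr rfl fun b _ => ?_
  rw [cls_eq hA hinj, card_filter]
  simp only [eq_comm]

theorem card_heavy_eq (hA : A = (range n).image fun j => X (j + 1))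
    (hinj : ∀ i < n, ∀ j < n, X (i + 1) = X (j + 1) → i = j) (p b : ℕ) :
    #{j ∈ range n | Heavy X n p b j} = #{x ∈ A | b < #{a ∈ A | a % p = x % p}} := by
  rw [card_filter, card_filter]
  rw [← sum_listing hA hinj fun x => if b < #{a ∈ A | a % p = x % p} then 1 else 0]
  refine sum_congr rfl fun j _ => ?_
  simp only [Heavy, cls_eq hA hinj]

end HL

/-! ### The reduction as a command -/

namespace HL
open WordRAM

section
variable {N κ : ℕ} {pr : Prog} {n : ℕ} {X : ℕ → ℕ} {A : Finset ℕ}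

theorem argmin_collCmd_spec {ph P lo : ℕ} {σ : St} (hA : A = (Finset.range n).image fun j => X (j + 1))
    (hinj : ∀ i < n, ∀ j < n, X (i + 1) = X (j + 1) → i = j)
    (hn : σ.reg 0 = n) (hP : σ.reg 6 = P) (hlo : σ.reg 7 = lo) (hlo1 : 1 ≤ lo) (hP1 : 1 ≤ P)
    (hX : ∀ k, 1 ≤ k → k ≤ n → σ.arr 0 0 0 k = X k) (h0 : ∀ i r, σ.arr 1 ph i r = 0)
    (hN : n * n + 1 < N) (hlN : P * (2 * lo) < N) :
    Runs N pr κ (argminCmd ph (collCmd ph)) σ (fun t σ' => t ≤ lo * (6 * n + 11) + 3 ∧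
      lo ≤ σ'.reg 13 ∧ σ'.reg 13 < 2 * lo ∧
      (∀ i < lo, Pseudo.coll A (P * σ'.reg 13) ≤ Pseudo.coll A (P * (lo + i))) ∧
      ∀ a i r, a ≠ ph → σ'.arr 1 a i r = σ.arr 1 a i r) := by
  have hnn : n ≤ n * n := Nat.le_mul_self n
  refine (argminCmd_spec (Tb := 3 * n + 3) (V := Pseudo.coll A) hn hP hlo hlo1 hP1 hX h0 (by omega)
    hlN (by simp [collCmd, Cmd.for, Cmd.writes]) (by simp [collCmd, Cmd.for, Cmd.tags])
    (by simp [collCmd, Cmd.for, Cmd.tags]) (fun i _ => ?_) ?_).mono ?_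
  · rw [← sum_cls_eq_coll hA hinj]
    refine lt_of_le_of_lt (Nat.succ_le_succ (Finset.sum_le_card_nsmul _ _ n fun j _ =>
      cls_le _ _ _ _)) ?_
    simpa using hN
  · intro i _ σ' ha h8 h9 hc
    refine (collCmd_spec (by rw [ha.reg 0 (by simp [collCmd, Cmd.for, Cmd.writes]), hn]) h8 h9
      (by rw [ha.arr 0 (by simp [collCmd, Cmd.for, Cmd.tags])]; exact hX) hc hN).mono ?_
    rintro t σ'' - ⟨h1, h2⟩
    exact ⟨h1, by rw [h2, sum_cls_eq_coll hA hinj]⟩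
  · rintro t σ' - ⟨h1, h2⟩
    exact ⟨by rwa [show 3 * n + 3 + 3 * n + 8 = 6 * n + 11 by ring] at h1, h2⟩

theorem argmin_triCmd_spec {ph P lo l : ℕ} {σ : St}
    (hA : A = (Finset.range n).image fun j => X (j + 1))
    (hinj : ∀ i < n, ∀ j < n, X (i + 1) = X (j + 1) → i = j)
    (hn : σ.reg 0 = n) (hP : σ.reg 6 = P) (hlo : σ.reg 7 = lo) (hlo1 : 1 ≤ lo) (hP1 : 1 ≤ P)
    (hl : σ.reg 15 = l) (hl' : σ.reg 16 = 2 ^ l) (hPl : P * (2 * lo) ≤ 2 ^ l)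
    (hX : ∀ k, 1 ≤ k → k ≤ n → σ.arr 0 0 0 k = X k) (h0 : ∀ i r, σ.arr 1 ph i r = 0)
    (hnN : n + 1 < N) (hN : n ^ 3 + 1 < N) (hlN : 4 * 3 ^ l < N) :
    Runs N pr κ (argminCmd ph (triCmd ph)) σ (fun t σ' =>
      t ≤ lo * (45 * 3 ^ l + 3 * n + 22) + 3 ∧
      lo ≤ σ'.reg 13 ∧ σ'.reg 13 < 2 * lo ∧
      (∀ i < lo, Pseudo.tri A (P * σ'.reg 13) ≤ Pseudo.tri A (P * (lo + i))) ∧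
      ∀ a i r, a ≠ ph → σ'.arr 1 a i r = σ.arr 1 a i r) := by
  have h23 : 2 ^ l ≤ 3 ^ l := Nat.pow_le_pow_left (by norm_num) l
  have hw : (triCmd ph).writes = [17, 17, 46, 17, 17, 18, 19, 20, 21, 19, 22, 17, 17, 17, 17, 22,
    18, 20, 11, 22, 11, 22] := rfl
  have ht : (triCmd ph).tags = [2, 3, 2, 2, 2, 3, 3, 3] := rfl
  refine (argminCmd_spec (Tb := 45 * 3 ^ l + 14) (V := Pseudo.tri A) hn hP hlo hlo1 hP1 hX h0 hnN
    (by omega) (by simp [hw]) (by simp [ht]) (by simp [ht]) (fun i _ => ?_) ?_).mono ?_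
  · rw [← triCount_eq_tri hA hinj]
    have := triCount_le X n (P * (lo + i))
    omega
  · intro i hi σ' ha h8 h9 hc
    have hle : P * (lo + i) ≤ P * (2 * lo) := Nat.mul_le_mul_left _ (by omega)
    refine (triCmd_spec h8 h9 (Nat.mul_pos hP1 (by omega)) (hle.trans hPl)
      (by rw [ha.reg 15 (by simp [hw]), hl]) (by rw [ha.reg 16 (by simp [hw]), hl'])
      hc hlN (by omega)).mono ?_
    rintro t σ'' - ⟨h1, h2⟩
    exact ⟨h1, by rw [h2, triCount_eq_tri hA hinj]⟩
  · rintro t σ' - ⟨h1, h2⟩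
    exact ⟨by rwa [show 45 * 3 ^ l + 14 + 3 * n + 8 = 45 * 3 ^ l + 3 * n + 22 by ring] at h1, h2⟩

/-- Compute the parameters `B`, `y`, `s`, `b` and the size of the instances. -/
def paramCmd (g J : ℕ) : Cmd :=
  rootCmd g 1 ;; rootCmd 2 2 ;; .assign 3 ((v 1).pow J) ;; .assign 4 (v 1 * v 1) ;;
  .assign 5 (lit 8 * v 3)

theorem eq_of_root {g n x y : ℕ} (hx : x ^ g ≤ n) (hx' : n < (x + 1) ^ g) (hy : y ^ g ≤ n)
    (hy' : n < (y + 1) ^ g) : x = y := by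
  have h1 := lt_of_pow_lt_pow_left₀ g (by omega) (hx.trans_lt hy')
  have h2 := lt_of_pow_lt_pow_left₀ g (by omega) (hy.trans_lt hx')
  omega

theorem paramCmd_spec {g J B y : ℕ} {σ : St} (hg : 1 ≤ g) (hn : σ.reg 0 = n) (hn1 : 1 ≤ n)
    (h1 : σ.reg 1 = 0) (h2 : σ.reg 2 = 0) (hB : B ^ g ≤ n) (hB' : n < (B + 1) ^ g)
    (hy : y ^ 2 ≤ n) (hy' : n < (y + 1) ^ 2) (hBJ : 8 * B ^ J < N) (hBN : B * B < N)
    (hgN : n ^ g < N) (h2N : n ^ 2 + 1 < N) :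
    Runs N pr κ (paramCmd g J) σ (fun t σ' => t ≤ 8 * n + 7 ∧ σ'.reg 1 = B ∧ σ'.reg 2 = y ∧
      σ'.reg 3 = B ^ J ∧ σ'.reg 4 = B * B ∧ σ'.reg 5 = 8 * B ^ J) := by
  have hn2 : n ≤ n ^ 2 := Nat.le_self_pow (by norm_num) n
  rw [paramCmd, runs_seq]
  refine (rootCmd_spec hg (by norm_num) (by norm_num) hn hn1 h1 hgN (by omega)).mono ?_
  rintro t₁ σ₁ ag₁ ⟨ht₁, b1, b2⟩
  have eB := eq_of_root b1 b2 hB hB'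
  have w₁ : ∀ z, z ≠ 1 → z ≠ 17 → σ₁.reg z = σ.reg z := fun z h h' =>
    ag₁.reg z (by simp [rootCmd, Cmd.for, Cmd.writes, h, h'])
  rw [runs_seq]
  refine (rootCmd_spec (by norm_num) (by norm_num) (by norm_num)
    ((w₁ 0 (by norm_num) (by norm_num)).trans hn) hn1
    ((w₁ 2 (by norm_num) (by norm_num)).trans h2) (by omega) (by omega)).mono ?_
  rintro t₂ σ₂ ag₂ ⟨ht₂, y1, y2⟩
  have ey := eq_of_root y1 y2 hy hy'
  have e1 : σ₂.reg 1 = B := by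
    rw [ag₂.reg 1 (by simp [rootCmd, Cmd.for, Cmd.writes]), eB]
  simp only [runs_seq, runs_assign, eval_pow (show 1 < N by omega), eval_mul, eval_var, eval_const,
    St.set_reg, Nat.reduceEqDiff, ↓reduceIte, e1, ey, Nat.mod_eq_of_lt (show B ^ J < N by omega),
    Nat.mod_eq_of_lt hBJ, Nat.mod_eq_of_lt hBN, and_true]
  omega

/-- Choose the modulus `p`. -/
def chooseCmd : Cmd :=
  .assign 6 (lit 1) ;; .assign 7 (v 2) ;; argminCmd 1 (collCmd 1) ;;
  .assign 6 (v 13) ;; argminCmd 2 (collCmd 2) ;; .assign 14 (v 6 * v 13)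

/-- A search over about `n` candidates for `p` would cost quadratic time, as each takes linear time.
Building `p` from two factors of size about `√n` needs only about `2 √n` evaluations. -/
theorem chooseCmd_spec {y : ℕ} {σ : St} (hA : A = (Finset.range n).image fun j => X (j + 1))
    (hinj : ∀ i < n, ∀ j < n, X (i + 1) = X (j + 1) → i = j) (hn : σ.reg 0 = n)
    (hy : σ.reg 2 = y) (hy1 : 1 ≤ y)
    (hX : ∀ k, 1 ≤ k → k ≤ n → σ.arr 0 0 0 k = X k) (h0 : ∀ a i r, σ.arr 1 a i r = 0)
    (hN : n * n + 1 < N) (hyN : 4 * (y * y) < N) :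
    Runs N pr κ chooseCmd σ (fun t σ' => t ≤ 2 * (y * (6 * n + 11)) + 10 ∧
      (∃ p₁ p₂, y ≤ p₁ ∧ p₁ < 2 * y ∧ y ≤ p₂ ∧ p₂ < 2 * y ∧ σ'.reg 14 = p₁ * p₂ ∧
        (∀ i < y, Pseudo.coll A (1 * p₁) ≤ Pseudo.coll A (1 * (y + i))) ∧
        ∀ i < y, Pseudo.coll A (p₁ * p₂) ≤ Pseudo.coll A (p₁ * (y + i))) ∧
      ∀ a i r, a ≠ 1 → a ≠ 2 → σ'.arr 1 a i r = 0) := by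
  have hw : ∀ ph, (argminCmd ph (collCmd ph)).writes = [12, 8, 9, 10, 10, 11, 10, 11, 10, 12, 13,
    8] := fun _ => rfl
  have htg : ∀ ph, (argminCmd ph (collCmd ph)).tags = [1] := fun _ => rfl
  simp only [chooseCmd, runs_seq, runs_assign, eval_const, eval_var]
  have hyy : y ≤ y * y := Nat.le_mul_self y
  refine (argmin_collCmd_spec (σ := (σ.set 6 1).set 7 ((σ.set 6 1).reg 2)) (P := 1) (lo := y)
    hA hinj (by simp [hn]) (by simp) (by simp [hy]) hy1 le_rfl hX (h0 1) hN (by omega)).mono ?_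
  rintro t₁ σ₁ ag₁ ⟨ht₁, l₁, u₁, m₁, z₁⟩
  have e2 : σ₁.reg 7 = y := by rw [ag₁.reg 7 (by simp [hw])]; simp [hy]
  have e0 : σ₁.reg 0 = n := by rw [ag₁.reg 0 (by simp [hw])]; simp [hn]
  have ea : σ₁.arr 0 = σ.arr 0 := by rw [ag₁.arr 0 (by simp [htg])]; rfl
  have hb : ∀ x < 2 * y, σ₁.reg 13 * x < N := fun x hx =>
    calc σ₁.reg 13 * x ≤ 2 * y * (2 * y) := Nat.mul_le_mul (by omega) (by omega)
      _ = 4 * (y * y) := by ring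
      _ < N := hyN
  refine (argmin_collCmd_spec (σ := σ₁.set 6 (σ₁.reg 13)) (P := σ₁.reg 13) (lo := y)
    hA hinj (by simp [e0]) (by simp) (by simp [e2]) hy1 (by omega) (by rw [St.set_arr, ea]; exact hX)
    (fun i r => by
      rw [St.set_arr, z₁ 2 i r (by norm_num)]
      exact h0 2 i r) hN ?_).mono ?_
  · calc σ₁.reg 13 * (2 * y) ≤ 2 * y * (2 * y) := Nat.mul_le_mul_right _ (by omega)
      _ = 4 * (y * y) := by ring
      _ < N := hyN
  rintro t₂ σ₂ ag₂ ⟨ht₂, l₂, u₂, m₂, z₂⟩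
  have e6 : σ₂.reg 6 = σ₁.reg 13 := by rw [ag₂.reg 6 (by simp [hw])]; simp
  simp only [eval_mul, eval_var, e6, St.set_reg, ↓reduceIte, St.set_arr,
    Nat.mod_eq_of_lt (hb _ u₂)]
  refine ⟨by omega, ⟨_, _, l₁, u₁, l₂, u₂, rfl, m₁, m₂⟩, fun a i r h1 h2 => ?_⟩
  rw [z₂ a i r h2, St.set_arr, z₁ a i r h1]
  exact h0 a i r

/-- Choose the modulus `q`. -/
def refineCmd : Cmd :=
  .assign 6 (v 14) ;; .assign 7 (v 3 * v 3) ;; .assign 45 (v 6 * (lit 2 * v 7)) ;; logCmd ;;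
  argminCmd 3 (triCmd 3) ;; .assign 28 (v 13)

/-- All candidates are below `2 s ^ 2`, so a single table size `2 ^ l ≥ 2 p s ^ 2` serves every
modulus `p q` that is tried. -/
theorem refineCmd_spec {p s : ℕ} {σ : St} (hA : A = (Finset.range n).image fun j => X (j + 1))
    (hinj : ∀ i < n, ∀ j < n, X (i + 1) = X (j + 1) → i = j) (hn : σ.reg 0 = n)
    (hp : σ.reg 14 = p) (hp1 : 1 ≤ p) (hs : σ.reg 3 = s) (hs1 : 1 ≤ s)
    (hX : ∀ k, 1 ≤ k → k ≤ n → σ.arr 0 0 0 k = X k) (h0 : ∀ i r, σ.arr 1 3 i r = 0)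
    (hnN : n + 1 < N) (hN : n ^ 3 + 1 < N) (hlN : 4 * (4 * (p * s ^ 2)) ^ 2 < N) :
    Runs N pr κ refineCmd σ (fun t σ' =>
      (∃ l, 2 ^ l ≤ 4 * (p * s ^ 2) ∧
        t ≤ 10 * (p * s ^ 2) + s ^ 2 * (45 * 3 ^ l + 3 * n + 22) + 11) ∧
      s ^ 2 ≤ σ'.reg 28 ∧ σ'.reg 28 < 2 * s ^ 2 ∧
      (∀ i < s ^ 2, Pseudo.tri A (p * σ'.reg 28) ≤ Pseudo.tri A (p * (s ^ 2 + i))) ∧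
      ∀ a i r, a ≠ 3 → σ'.arr 1 a i r = σ.arr 1 a i r) := by
  have hw : (argminCmd 3 (triCmd 3)).writes = [12, 8, 9, 10, 10, 17, 17, 46, 17, 17, 18, 19, 20,
    21, 19, 22, 17, 17, 17, 17, 22, 18, 20, 11, 22, 11, 22, 12, 13, 8] := rfl
  have hlw : logCmd.writes = [15, 16, 17, 16, 15, 17] := rfl
  have hlt : logCmd.tags = [] := rfl
  have hs2 : 1 ≤ s ^ 2 := Nat.one_le_pow _ _ hs1
  have hps : 1 ≤ p * s ^ 2 := Nat.mul_pos hp1 hs2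
  have hsp : s ^ 2 ≤ p * s ^ 2 := Nat.le_mul_of_pos_left _ hp1
  have h4 : 4 * (p * s ^ 2) ≤ (4 * (p * s ^ 2)) ^ 2 := Nat.le_self_pow (by norm_num) _
  have ess : s * s = s ^ 2 := by ring
  have hMe : p * (2 * s ^ 2) = 2 * (p * s ^ 2) := by ring
  simp only [refineCmd, runs_seq, runs_assign, eval_const, eval_var, eval_mul, St.set_reg,
    Nat.reduceEqDiff, ↓reduceIte, hp, hs, ess, Nat.mod_eq_of_lt (show s ^ 2 < N by omega),
    Nat.mod_eq_of_lt (show 2 * s ^ 2 < N by omega),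
    Nat.mod_eq_of_lt (show p * (2 * s ^ 2) < N by omega)]
  refine (logCmd_spec (M := p * (2 * s ^ 2)) (by simp) (by omega) (by omega)).mono ?_
  rintro t₁ σ₁ ag₁ ⟨ht₁, hM, hM', h16⟩
  set l := σ₁.reg 15 with hl
  have hM2 : 2 ^ l ≤ 4 * (p * s ^ 2) := hM'.trans_eq (by ring)
  -- A crude bound by `4 ^ l`, used only to exclude overflow; the running time keeps `3 ^ l`.
  have h3l : 3 ^ l ≤ (4 * (p * s ^ 2)) ^ 2 := by
    calc 3 ^ l ≤ 4 ^ l := Nat.pow_le_pow_left (by norm_num) l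
      _ = (2 ^ l) ^ 2 := by rw [← pow_mul, mul_comm, pow_mul]; norm_num
      _ ≤ _ := Nat.pow_le_pow_left hM2 2
  have ear : σ₁.arr = σ.arr := by
    funext t
    rw [ag₁.arr t (by simp [hlt])]; rfl
  refine (argmin_triCmd_spec (σ := σ₁) (P := p) (lo := s ^ 2) (l := l) hA hinj
    (by rw [ag₁.reg 0 (by simp [hlw])]; simp [hn]) (by rw [ag₁.reg 6 (by simp [hlw])]; simp)
    (by rw [ag₁.reg 7 (by simp [hlw])]; simp) hs2 hp1 rfl h16 hM (by rw [ear]; exact hX)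
    (by rw [ear]; exact h0) hnN hN (by omega)).mono ?_
  rintro t₂ σ₂ - ⟨ht₂, l₂, u₂, m₂, z₂⟩
  simp only [St.set_reg, ↓reduceIte, St.set_arr]
  refine ⟨⟨l, hM2, ?_⟩, l₂, u₂, m₂, fun a i r h => by rw [z₂ a i r h, ear]⟩
  omega

end
end HL


/-! ### The complete reduction: correctness and running time. -/

namespace HL
open WordRAM

section
variable {N κ : ℕ} {pr : Prog} {n : ℕ} {X : ℕ → ℕ} {A : Finset ℕ}

/-- The reduction from 3SUM to Convolution 3SUM. -/
def solveCmd (g J : ℕ) : Cmd := paramCmd g J ;; chooseCmd ;; refineCmd ;; splitCmd ;; mainCmd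

/-- The running time is stated as a bound on `B * t`, in natural numbers. The hypothesis `big` says
that `N` exceeds every monomial that occurs, so no arithmetic wraps around unintentionally. -/
theorem solveCmd_spec {g J B U D K C To : ℕ} (hJ : 16 ≤ J) (hg : g = 20 * J) (hn1 : 1 ≤ n)
    (hB : B ^ g ≤ n) (hB' : n < (B + 1) ^ g)
    (hA : A = (Finset.range n).image fun j => X (j + 1))
    (hinj : ∀ i < n, ∀ j < n, X (i + 1) = X (j + 1) → i = j)
    (hX1 : ∀ j < n, 1 ≤ X (j + 1)) (hXU : ∀ j < n, X (j + 1) ≤ U)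
    (hD1 : 1 ≤ D) (hDK : D ^ 3 ≤ K * B) (hD : ∀ z, 0 < z → z ≤ 2 * U → z.divisors.card ≤ D)
    (big : ∀ i j, i + j ≤ 40 + g → 2 ^ i * n ^ j < N) (hUN : 2 * U + 1 < N)
    (hw : 2 ^ wordLength κ (8 * B ^ J) ≤ N)
    (horc : ∀ Y : ℕ → ℕ,
      (∀ i ∈ Set.Icc 1 (8 * B ^ J), Y i ∈ Set.Icc 1 ((8 * B ^ J) ^ 2)) →
      Solves pr κ To (8 * B ^ J) Y)
    (hTo : To * B ^ 16 ≤ C * (B ^ J) ^ 2) :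
    Runs N pr κ (solveCmd g J) (initSt n X) (fun t σ =>
      B * t ≤ (10000 + 50 * C + 120 * K) * n ^ 2 ∧
        (σ.reg 27 = 1 ↔ ∃ x ∈ A, ∃ y ∈ A, ∃ z ∈ A, x + y = z)) := by
  have hg1 : 1 ≤ g := by omega
  have hB1 : 1 ≤ B := by
    by_contra h
    rw [show B = 0 by omega, zero_add, one_pow] at hB'
    omega
  obtain ⟨s, hs⟩ : ∃ s, s = B ^ J := ⟨_, rfl⟩
  rw [← hs] at hw horc hTo
  have hs20 : s ^ 20 ≤ n := by rw [hs, ← pow_mul, mul_comm, ← hg]; exact hB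
  have hB16 : B ^ 16 ≤ s := hs ▸ Nat.pow_le_pow_right hB1 hJ
  have hB2 : B ^ 2 ≤ s := hs ▸ Nat.pow_le_pow_right hB1 (by omega)
  have hBs : B ≤ s := hs ▸ Nat.le_self_pow (by omega) B
  have hs1 : 1 ≤ s := hB1.trans hBs
  have hsk : ∀ k ≤ 20, s ^ k ≤ n := fun k hk => (Nat.pow_le_pow_right hs1 hk).trans hs20
  have hsn : s ≤ n := by simpa using hsk 1 (by norm_num)
  have hs2n : s ^ 2 ≤ n := hsk 2 (by norm_num)
  have hBn : B ≤ n := hBs.trans hsn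
  have hnn : n ≤ n ^ 2 := Nat.le_self_pow (by norm_num) n
  have hnn' : n * n = n ^ 2 := by ring
  obtain ⟨y, hy, hy'⟩ : ∃ y, y ^ 2 ≤ n ∧ n < (y + 1) ^ 2 :=
    ⟨Nat.sqrt n, by simpa [sq] using Nat.sqrt_le n, by simpa [sq] using Nat.lt_succ_sqrt n⟩
  have hy1 : 1 ≤ y := by
    by_contra h
    rw [show y = 0 by omega] at hy'
    omega
  have hy4 : n ≤ 4 * y ^ 2 := by nlinarith
  have hBy := Bounds.mul_sqrt_le hBs hs20 hs1 hy
  have hBss := Bounds.mul_sq_le hBs hs20 hs1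
  have big1 := big 20 0 (by omega)
  have big2 := big 10 1 (by omega)
  have big3 := big 10 2 (by omega)
  have big4 := big 10 3 (by omega)
  have bigg : n ^ g < N := by simpa using big 0 g (by omega)
  norm_num at big1 big2 big3 big4
  have hcard : A.card = n := by
    rw [hA, Finset.card_image_of_injOn, Finset.card_range]
    intro i hi j hj h
    exact hinj i (by simpa using hi) j (by simpa using hj) h
  have memA : ∀ x, x ∈ A ↔ ∃ j < n, X (j + 1) = x := by
    intro x
    rw [hA]
    simp
  have hA0 : 0 ∉ A := by
    rw [memA]
    rintro ⟨j, hj, h⟩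
    have := hX1 j hj
    omega
  have hAU : ∀ a ∈ A, a ≤ U := by
    intro a ha
    obtain ⟨j, hj, rfl⟩ := (memA a).1 ha
    exact hXU j hj
  have hX0 : ∀ k, 1 ≤ k → k ≤ n → (initSt n X).arr 0 0 0 k = X k := by
    intro k h1 h2
    simp [initSt, h1, h2]
  have hi0 : ∀ t, t ≠ 0 → ∀ i j k, (initSt n X).arr t i j k = 0 := by
    intro t ht i j k
    simp [initSt, ht]
  have hr0 : ∀ z, z ≠ 0 → (initSt n X).reg z = 0 := fun z hz => by simp [initSt, hz]
  rw [solveCmd, runs_seq]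
  refine (paramCmd_spec (n := n) (J := J) (σ := initSt n X) (y := y) hg1 rfl hn1 (hr0 1 (by norm_num))
    (hr0 2 (by norm_num)) hB hB' hy hy' (by rw [← hs]; omega) (by
      have := Nat.mul_le_mul hBn hBn
      omega) bigg (by omega)).mono ?_
  rintro t₁ σ₁ ag₁ ⟨ht₁, b1, b2, b3, b4, b5⟩
  rw [← hs] at b3 b5
  have w₁ : ∀ z ∈ [0, 27], σ₁.reg z = (initSt n X).reg z := fun z hz => ag₁.reg z (by
    simp at hz
    rcases hz with rfl | rfl <;> simp [paramCmd, rootCmd, Cmd.for, Cmd.writes])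
  have a₁ : σ₁.arr = (initSt n X).arr := by
    funext t
    exact ag₁.arr t (by simp [paramCmd, rootCmd, Cmd.for, Cmd.tags])
  rw [runs_seq]
  refine (chooseCmd_spec (σ := σ₁) hA hinj (w₁ 0 (by simp)) b2 hy1 (by rw [a₁]; exact hX0)
    (fun a i r => by rw [a₁]; exact hi0 1 (by norm_num) _ _ _) (by omega) (by
      rw [show y * y = y ^ 2 by ring]; omega)).mono ?_
  rintro t₂ σ₂ ag₂ ⟨ht₂, ⟨p₁, p₂, lp₁, up₁, lp₂, up₂, h14, hc₁, hc₂⟩, z₂⟩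
  have w₂ : ∀ z ∈ [0, 3, 4, 5, 27], σ₂.reg z = σ₁.reg z := fun z hz => ag₂.reg z (by
    revert z; decide)
  have a₂ : ∀ t, t ≠ 1 → σ₂.arr t = (initSt n X).arr t := fun t ht => by
    rw [ag₂.arr t (by simp [chooseCmd, argminCmd, cntCmd, collCmd, Cmd.for, Cmd.tags, ht]), a₁]
  set p := p₁ * p₂ with hp
  have hp1 : 1 ≤ p := Nat.mul_pos (by omega) (by omega)
  have hp4 : p ≤ 4 * n := by
    calc p ≤ 2 * y * (2 * y) := Nat.mul_le_mul up₁.le up₂.le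
      _ = 4 * y ^ 2 := by ring
      _ ≤ 4 * n := by omega
  have hps : p * s ^ 2 ≤ 4 * n * s ^ 2 := Nat.mul_le_mul_right _ hp4
  have hpsn : p * s ^ 2 ≤ 4 * n ^ 2 := by
    calc p * s ^ 2 ≤ 4 * n * n := Nat.mul_le_mul hp4 hs2n
      _ = 4 * n ^ 2 := by ring
  rw [runs_seq]
  refine (refineCmd_spec (σ := σ₂) hA hinj ((w₂ 0 (by simp)).trans (w₁ 0 (by simp))) h14 hp1
    ((w₂ 3 (by simp)).trans b3) hs1 (by rw [a₂ 0 (by norm_num)]; exact hX0)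
    (fun i r => z₂ 3 i r (by norm_num) (by norm_num)) (by omega) (by omega) (by
      have h := big 10 4 (by omega)
      calc 4 * (4 * (p * s ^ 2)) ^ 2 ≤ 4 * (4 * (4 * n ^ 2)) ^ 2 := by gcongr
        _ = 2 ^ 10 * n ^ 4 := by ring
        _ < N := h)).mono ?_
  rintro t₃ σ₃ ag₃ ⟨⟨l, hl, ht₃⟩, lq, uq, hc₃, z₃⟩
  have w₃ : ∀ z ∈ [0, 3, 4, 5, 14, 27], σ₃.reg z = σ₂.reg z := fun z hz => ag₃.reg z (by
    revert z; decide)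
  have a₃ : ∀ t, t ≠ 1 → t ≠ 2 → t ≠ 3 → σ₃.arr t = (initSt n X).arr t := fun t h1 h2 h3 => by
    rw [ag₃.arr t (by
      have : refineCmd.tags = [1, 2, 3, 2, 2, 2, 3, 3, 3] := rfl
      simp [this, h1, h2, h3]), a₂ t h1]
  set q := σ₃.reg 28 with hq
  have hq1 : 1 ≤ q := (Nat.one_le_pow _ _ hs1).trans lq
  have hqn : q ≤ 2 * n := by omega
  have e₃ : σ₃.reg 14 = p := (w₃ 14 (by simp)).trans h14
  have e4 : σ₃.reg 4 = B * B := (w₃ 4 (by simp)).trans ((w₂ 4 (by simp)).trans b4)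
  rw [runs_seq]
  refine (splitCmd_spec (σ := σ₃) (n := n) (p := p) (b := B * B) (U := U) (X := X)
    ((w₃ 0 (by simp)).trans ((w₂ 0 (by simp)).trans (w₁ 0 (by simp)))) e₃ e4
    (by rw [a₃ 0 (by norm_num) (by norm_num) (by norm_num)]; exact hX0) hX1 hXU hinj
    (fun r => by rw [z₃ 4 0 r (by norm_num), z₂ 4 0 r (by norm_num) (by norm_num)])
    (fun z => by rw [a₃ 4 (by norm_num) (by norm_num) (by norm_num)]; exact hi0 4 (by norm_num) _ _ _)
    (fun z => by rw [a₃ 5 (by norm_num) (by norm_num) (by norm_num)]; exact hi0 5 (by norm_num) _ _ _)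
    (fun u r => by rw [a₃ 6 (by norm_num) (by norm_num) (by norm_num)]; exact hi0 6 (by norm_num) _ _ _)
    ((w₃ 27 (by simp)).trans ((w₂ 27 (by simp)).trans ((w₁ 27 (by simp)).trans
      (hr0 27 (by norm_num))))) (by omega) (by omega)).mono ?_
  rintro t₄ σ₄ ag₄ ⟨ht₄, f1, f2, f3, k1, k2, k3⟩
  have w₄ : ∀ z ∈ [3, 4, 5, 14, 28], σ₄.reg z = σ₃.reg z := fun z hz => ag₄.reg z (by
    revert z; decide)
  have a₄ : σ₄.arr 9 = (initSt n X).arr 9 := by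
    rw [ag₄.arr 9 (by decide), a₃ 9 (by norm_num) (by norm_num) (by norm_num)]
  have hQs : (p / s + 1) * s ≤ 5 * n := by
    have := Nat.div_mul_le_self p s
    rw [add_mul]
    omega
  refine (mainCmd_spec (σ := σ₄) (U := U) (p := p) (q := q) (s := s) (b := B * B)
    (Q := p / s + 1) (To := To) (A := A) (bk := fun u r => σ₄.arr 6 0 u r)
    ((w₄ 3 (by simp)).trans ((w₃ 3 (by simp)).trans ((w₂ 3 (by simp)).trans b3)))
    ((w₄ 5 (by simp)).trans ((w₃ 5 (by simp)).trans ((w₂ 5 (by simp)).trans b5)))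
    ((w₄ 14 (by simp)).trans e₃) (w₄ 28 (by simp)) ((w₄ 4 (by simp)).trans e4) (by omega)
    (fun _ _ => rfl) (fun e x => by rw [a₄]; exact hi0 9 (by norm_num) _ _ _) rfl hp1 hq1 hs1
    (Nat.mul_pos hB1 hB1) hA0 hAU (fun u r h => ?_) k3 hUN (by omega) (by
      rw [mul_assoc]; omega) (by omega) (by omega) ?_ hw (fun Y hY => horc Y fun i hi => ?_)).mono ?_
  · obtain ⟨j, hj, h1, h2⟩ := k1 u r h
    exact ⟨(memA _).2 ⟨j, hj, h1⟩, h1 ▸ h2⟩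
  · calc 2 * (B * B) * (B * B) * (B * B) * (p / s + 1) * (p / s + 1)
        ≤ 2 * (n * n) * (n * n) * (n * n) * (5 * n) * (5 * n) := by
          gcongr <;> exact (Nat.le_mul_of_pos_right _ hs1).trans hQs
      _ = 50 * n ^ 8 := by ring
      _ ≤ 2 ^ 6 * n ^ 8 := by gcongr; norm_num
      _ < N := big 6 8 (by omega)
  -- Here the quadratic universe is used: `q < 2 s ^ 2`, so the entries are at most `23 q ≤ 46 s ^ 2
  -- ≤ (8 s) ^ 2`.
  · have := hY i hi
    refine ⟨this.1, this.2.trans ?_⟩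
    rw [mul_pow]
    omega
  rintro t₅ σ₅ - ⟨ht₅, g1, g2, g3⟩
  refine ⟨?_, fun h => ?_, fun ⟨x, hx, x', hx', x'', hx'', hsum⟩ => ?_⟩
  · set o := Pseudo.off A p with ho
    have ho4 : o ≤ 4 * D ^ 2 * n := by
      have h1 := Pseudo.off_step (D := D) (fun z h h' => hD z h (by omega)) hAU le_rfl hc₁
      have h2 := Pseudo.off_step (D := D) (fun z h h' => hD z h (by omega)) hAU
        (show 1 ≤ p₁ by omega) hc₂
      rw [one_mul] at h1
      -- The greedy choice starts from the modulus `1`, for which there are at most `n ^ 2`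
      -- collisions.
      refine Bounds.off_le hn1 hy4 (h1.trans (Nat.mul_le_mul_left _ ?_)) h2
      have h3 := Pseudo.coll_eq A 1
      have h4 : Pseudo.coll A 1 ≤ (A ×ˢ A).card := Finset.card_filter_le _ _
      rw [Finset.card_product, hcard, hnn'] at h4
      omega
    have hH := Bounds.heavy_le hB1 hD1 hDK ho4 (Pseudo.heavy_mul_le A p (B * B))
    rw [← card_heavy_eq hA hinj] at hH
    have hF : B * (s * (Pseudo.falTriples A (p * q)).card) ≤ 5 * K * n ^ 2 := by
      -- Before the choice of `q`, the false triples modulo `p` are bounded by all triples modulo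
      -- `p`, hence by `n` times the number of collisions.
      refine Bounds.fal_le hB1 hB2 hD1 hDK ho4 (f := (Pseudo.falTriples A p).card) ?_
        (Pseudo.fal_step hD hAU hp1 hc₃)
      have h1 := Pseudo.tri_eq A p
      have h2 := Pseudo.tri_le (A := A) hp1
      rw [Pseudo.coll_eq, hcard, ← ho] at h2
      omega
    have hkar := Bounds.karatsuba_le hBs hs20 hs1 (l := l) (by
      calc 2 ^ l ≤ 4 * (p * s ^ 2) := hl
        _ ≤ 4 * (4 * n * s ^ 2) := by gcongr
        _ = 16 * (n * s ^ 2) := by ring)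
    have hmain := Bounds.main_le (To := To) hB1 hB16 hsn hp4 rfl hTo
    set F := (Pseudo.falTriples A (p * q)).card
    set H := ((Finset.range n).filter (Heavy X n p (B * B))).card
    set T := 2 * (B * B) * (B * B) * (B * B) * (p / s + 1) * (p / s + 1) * (60 * s + To + 19)
    have hBn2 : B * n ≤ n ^ 2 := by rw [← hnn']; exact Nat.mul_le_mul_right _ hBn
    have c₁ : B * t₁ ≤ 15 * n ^ 2 := by
      calc B * t₁ ≤ B * (15 * n) := Nat.mul_le_mul_left _ (by omega)
        _ = 15 * (B * n) := by ring
        _ ≤ 15 * n ^ 2 := Nat.mul_le_mul_left _ hBn2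
    have c₂ : B * t₂ ≤ 44 * n ^ 2 := by
      calc B * t₂ ≤ B * (2 * (y * (17 * n)) + 10 * n) :=
            Nat.mul_le_mul_left _ (by
              have : y * (6 * n + 11) ≤ y * (17 * n) := Nat.mul_le_mul_left _ (by omega)
              omega)
        _ = 34 * (B * y * n) + 10 * (B * n) := by ring
        _ ≤ 34 * (n * n) + 10 * n ^ 2 := by gcongr
        _ = 44 * n ^ 2 := by ring
    have c₃ : B * t₃ ≤ 5836 * n ^ 2 := by
      calc B * t₃ ≤ B * (10 * (4 * n * s ^ 2) + s ^ 2 * (45 * 3 ^ l + 25 * n) + 11 * n) :=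
            Nat.mul_le_mul_left _ (by
              have : s ^ 2 * (45 * 3 ^ l + 3 * n + 22) ≤ s ^ 2 * (45 * 3 ^ l + 25 * n) :=
                Nat.mul_le_mul_left _ (by omega)
              omega)
        _ = 65 * (B * s ^ 2 * n) + 45 * (B * (s ^ 2 * 3 ^ l)) + 11 * (B * n) := by ring
        _ ≤ 65 * (n * n) + 45 * (128 * n ^ 2) + 11 * n ^ 2 := by gcongr
        _ = 5836 * n ^ 2 := by ring
    have c₄ : B * t₄ ≤ (40 * K + 21) * n ^ 2 := by
      calc B * t₄ ≤ B * (10 * n * H + 21 * n) :=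
            Nat.mul_le_mul_left _ (ht₄.trans (by
              have : (7 * n + 3) * H ≤ 10 * n * H := Nat.mul_le_mul_right _ (by omega)
              omega))
        _ = 10 * n * (B * H) + 21 * (B * n) := by ring
        _ ≤ 10 * n * (4 * K * n) + 21 * n ^ 2 := by gcongr
        _ = (40 * K + 21) * n ^ 2 := by ring
    have c₅ : B * t₅ ≤ (50 * (79 + C) + 80 * K + 37) * n ^ 2 := by
      calc B * t₅ ≤ B * (T + 16 * s * (F + 2 * s) + 5 * n) :=
            Nat.mul_le_mul_left _ (by
              have : (11 * s + 5) * (F + 2 * s) ≤ 16 * s * (F + 2 * s) :=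
                Nat.mul_le_mul_right _ (by omega)
              omega)
        _ = B * T + 16 * (B * (s * F)) + 32 * (B * s ^ 2) + 5 * (B * n) := by ring
        _ ≤ 50 * (79 + C) * n ^ 2 + 16 * (5 * K * n ^ 2) + 32 * n ^ 2 + 5 * n ^ 2 := by
            gcongr
            exact hBss.trans hnn
        _ = (50 * (79 + C) + 80 * K + 37) * n ^ 2 := by ring
    calc B * (t₁ + (t₂ + (t₃ + (t₄ + t₅))))
        = B * t₁ + B * t₂ + B * t₃ + B * t₄ + B * t₅ := by ring
      _ ≤ 15 * n ^ 2 + 44 * n ^ 2 + 5836 * n ^ 2 + (40 * K + 21) * n ^ 2 +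
          (50 * (79 + C) + 80 * K + 37) * n ^ 2 := by gcongr
      _ = (9903 + 50 * C + 120 * K) * n ^ 2 := by ring
      _ ≤ (10000 + 50 * C + 120 * K) * n ^ 2 := by gcongr; norm_num
  · rcases g2 h with h' | h'
    · obtain ⟨i, hi, j, hj, k, hk, e⟩ := f2 h'
      exact ⟨_, (memA _).2 ⟨i, hi, rfl⟩, _, (memA _).2 ⟨j, hj, rfl⟩, _, (memA _).2 ⟨k, hk, rfl⟩, e⟩
    · exact h'
  · by_contra hne
    obtain ⟨h0, hno⟩ := g3 (by omega)
    obtain ⟨i, hi, rfl⟩ := (memA _).1 hx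
    obtain ⟨j, hj, rfl⟩ := (memA _).1 hx'
    obtain ⟨k, hk, rfl⟩ := (memA _).1 hx''
    obtain ⟨l1, l2, l3⟩ := f3 h0 i hi j hj k hk hsum
    exact hno _ hx _ hx' _ hx'' hsum (k2 i hi l1) (k2 j hj l2) (k2 k hk l3)

end
end HL

/-! ### The lower bound -/

open WordRAM HL

theorem HL.lt_modulus {κ n i j : ℕ} (hn : 1 ≤ n) (h : i + j < κ) :
    2 ^ i * n ^ j < modulus κ n := by
  have hW : n < 2 ^ (Nat.log 2 n + 1) := Nat.lt_pow_succ_log_self (by norm_num) n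
  unfold modulus
  set W := 2 ^ (Nat.log 2 n + 1)
  have hW2 : 2 ≤ W := by omega
  calc 2 ^ i * n ^ j ≤ W ^ i * W ^ j :=
        Nat.mul_le_mul (Nat.pow_le_pow_left hW2 i) (Nat.pow_le_pow_left hW.le j)
    _ = W ^ (i + j) := (pow_add _ _ _).symm
    _ < W ^ κ := Nat.pow_lt_pow_right hW2 h

/-- The oracle gets inputs of size `8 s ≤ 8 n`, whose logarithm exceeds that of `n` by at most `3`.
So its whole address space fits into one row. -/
theorem HL.pow_wordLength_le {κ κ' n s : ℕ} (hs : s ≤ n) (hκ : 4 * κ ≤ κ') :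
    2 ^ wordLength κ (8 * s) ≤ modulus κ' n := by
  unfold wordLength modulus
  rw [← pow_mul]
  refine Nat.pow_le_pow_right (by norm_num) ?_
  have h : Nat.log 2 (8 * s) < Nat.log 2 n + 4 := by
    refine Nat.log_lt_of_lt_pow' (by omega) ?_
    have := Nat.lt_pow_succ_log_self (b := 2) (by norm_num) n
    calc 8 * s ≤ 8 * n := by omega
      _ < 8 * 2 ^ (Nat.log 2 n + 1) := by omega
      _ = 2 ^ (Nat.log 2 n + 4) := by ring
  calc κ * (Nat.log 2 (8 * s) + 1) ≤ κ * (4 * (Nat.log 2 n + 1)) :=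
        Nat.mul_le_mul_left _ (by omega)
    _ = 4 * κ * (Nat.log 2 n + 1) := by ring
    _ ≤ κ' * (Nat.log 2 n + 1) := Nat.mul_le_mul_right _ hκ
    _ = (Nat.log 2 n + 1) * κ' := mul_comm _ _

theorem HL.exists_root {g n : ℕ} (hg : 1 ≤ g) : ∃ B, B ^ g ≤ n ∧ n < (B + 1) ^ g := by
  have h0 : (0 : ℕ) ^ g ≤ n := by rw [zero_pow (by omega)]; exact Nat.zero_le n
  refine ⟨Nat.findGreatest (fun b => b ^ g ≤ n) n,
    Nat.findGreatest_spec (P := fun b => b ^ g ≤ n) (Nat.zero_le n) h0, ?_⟩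
  set B := Nat.findGreatest (fun b => b ^ g ≤ n) n
  by_contra h
  have h1 : B + 1 ≤ (B + 1) ^ g := Nat.le_self_pow (by omega) _
  exact Nat.findGreatest_is_greatest (P := fun b => b ^ g ≤ n) (Nat.lt_add_one B) (by omega)
    (not_lt.1 h)

/-- The oracle saves `(8 s) ^ ε ≥ s ^ ε = B ^ (J ε) ≥ B ^ 16` over quadratic time. -/
theorem HL.oracle_time_le {C ε : ℝ} {J B : ℕ} (hε : 0 < ε) (hJ : 16 ≤ J * ε) (hB : 1 ≤ B) :
    ⌊C * ((8 * B ^ J : ℕ) : ℝ) ^ (2 - ε)⌋₊ * B ^ 16 ≤ ⌈64 * |C|⌉₊ * (B ^ J) ^ 2 := by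
  have hB1 : (1 : ℝ) ≤ B := by exact_mod_cast hB
  have hs : (1 : ℝ) ≤ (B : ℝ) ^ J := one_le_pow₀ hB1
  have hcast : ((8 * B ^ J : ℕ) : ℝ) = 8 * (B : ℝ) ^ J := by push_cast; ring
  rw [hcast]
  have h1 : (8 * (B : ℝ) ^ J) ^ (2 - ε) * (B : ℝ) ^ 16 ≤ 64 * ((B : ℝ) ^ J) ^ 2 := by
    rw [Real.rpow_sub (by positivity), Real.rpow_two, div_mul_eq_mul_div,
      div_le_iff₀ (by positivity)]
    have h2 : (B : ℝ) ^ 16 ≤ (8 * (B : ℝ) ^ J) ^ ε := by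
      calc (B : ℝ) ^ 16 = (B : ℝ) ^ (16 : ℝ) := by norm_cast
        _ ≤ (B : ℝ) ^ (J * ε) := Real.rpow_le_rpow_of_exponent_le hB1 hJ
        _ = ((B : ℝ) ^ J) ^ ε := by rw [Real.rpow_mul (by positivity), Real.rpow_natCast]
        _ ≤ (8 * (B : ℝ) ^ J) ^ ε :=
          Real.rpow_le_rpow (by positivity) (by linarith) hε.le
    calc (8 * (B : ℝ) ^ J) ^ 2 * (B : ℝ) ^ 16 ≤ (8 * (B : ℝ) ^ J) ^ 2 * (8 * (B : ℝ) ^ J) ^ ε := by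
          gcongr
      _ = 64 * ((B : ℝ) ^ J) ^ 2 * (8 * (B : ℝ) ^ J) ^ ε := by ring
  have h3 : (⌊C * (8 * (B : ℝ) ^ J) ^ (2 - ε)⌋₊ : ℝ) ≤ |C| * (8 * (B : ℝ) ^ J) ^ (2 - ε) := by
    refine (Nat.cast_le.2 (Nat.floor_le_floor ?_)).trans (Nat.floor_le (by positivity))
    gcongr
    exact le_abs_self C
  have h4 : (⌊C * (8 * (B : ℝ) ^ J) ^ (2 - ε)⌋₊ * B ^ 16 : ℝ) ≤
      ⌈64 * |C|⌉₊ * ((B : ℝ) ^ J) ^ 2 := by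
    calc (⌊C * (8 * (B : ℝ) ^ J) ^ (2 - ε)⌋₊ * B ^ 16 : ℝ)
        ≤ |C| * (8 * (B : ℝ) ^ J) ^ (2 - ε) * (B : ℝ) ^ 16 := by gcongr
      _ = |C| * ((8 * (B : ℝ) ^ J) ^ (2 - ε) * (B : ℝ) ^ 16) := by ring
      _ ≤ |C| * (64 * ((B : ℝ) ^ J) ^ 2) := by gcongr
      _ = 64 * |C| * ((B : ℝ) ^ J) ^ 2 := by ring
      _ ≤ _ := by gcongr; exact Nat.le_ceil _
  exact_mod_cast h4

/-- From `n < (B + 1) ^ g` follows `n ^ (1 / g) ≤ 2 B`, so a saving of `B` is a polynomial saving.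
-/
theorem HL.le_rpow_of_mul_le {g n B t K : ℕ} (hg : 1 ≤ g) (hn : 1 ≤ n) (hB : 1 ≤ B)
    (hB' : n < (B + 1) ^ g) (h : B * t ≤ K * n ^ 2) :
    (t : ℝ) ≤ (2 * K : ℕ) * (n : ℝ) ^ (2 - 1 / (g : ℝ)) := by
  have hn0 : (0 : ℝ) < n := by exact_mod_cast hn
  have hg0 : (0 : ℝ) < g := by exact_mod_cast hg
  have h1 : (n : ℝ) ^ (1 / (g : ℝ)) ≤ 2 * B := by
    have h2 : (n : ℝ) ≤ (2 * B : ℝ) ^ g := by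
      have : n ≤ (2 * B) ^ g := hB'.le.trans (Nat.pow_le_pow_left (by omega) g)
      exact_mod_cast this
    calc (n : ℝ) ^ (1 / (g : ℝ)) ≤ ((2 * B : ℝ) ^ g) ^ (1 / (g : ℝ)) :=
          Real.rpow_le_rpow hn0.le h2 (by positivity)
      _ = 2 * B := by
          rw [← Real.rpow_natCast, ← Real.rpow_mul (by positivity), mul_one_div_cancel hg0.ne',
            Real.rpow_one]
  rw [Real.rpow_sub hn0, Real.rpow_two, mul_div_assoc', le_div_iff₀ (by positivity)]
  have h' : (B * t : ℝ) ≤ K * (n : ℝ) ^ 2 := by exact_mod_cast h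
  calc (t : ℝ) * (n : ℝ) ^ (1 / (g : ℝ)) ≤ t * (2 * B) := by gcongr
    _ = 2 * (B * t) := by ring
    _ ≤ 2 * (K * (n : ℝ) ^ 2) := by gcongr
    _ = (2 * K : ℕ) * (n : ℝ) ^ 2 := by push_cast; ring

theorem lemma4p5 (hyp : DeterministicThreeSumHypothesis) (ε : ℝ) (hε : 0 < ε) :
    ¬ ConvThreeSumSolvable (fun n => n ^ 2) (fun n => (n : ℝ) ^ (2 - ε)) := by
  rintro ⟨pr, κ, C, horc⟩
  obtain ⟨J, hJ, hJε⟩ : ∃ J : ℕ, 16 ≤ J ∧ 16 ≤ J * ε := by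
    refine ⟨max 16 ⌈16 / ε⌉₊, le_max_left _ _, ?_⟩
    rw [← div_le_iff₀ hε]
    exact (Nat.le_ceil _).trans (by exact_mod_cast le_max_right _ _)
  obtain ⟨g, hg⟩ : ∃ g, g = 20 * J := ⟨_, rfl⟩
  have hg1 : 1 ≤ g := by omega
  have hg0 : (0 : ℝ) < g := by exact_mod_cast hg1
  -- The exponent `1 / g` depends on `ε` only, and `c` is obtained from it. All later constants may
  -- depend on `c`.
  obtain ⟨c, hc⟩ := hyp (1 / (g : ℝ)) (by positivity)
  obtain ⟨K, hK⟩ := Bounds.exists_divisor_bound c g hg1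
  refine hc ?_
  set cmd := solveCmd g J
  set C' := ⌈64 * |C|⌉₊
  -- The modulus has to exceed the inputs (`c`), the intermediate values (`g` and `50`), the
  -- oracle's address space (`4 * κ`) and the constants in the program text (`cmd.top`).
  set κ' := c + g + 4 * κ + 50 + cmd.top with hκ'
  set R := pr.regs + 1
  -- The oracle's constant `C` enters only through `C'`, and the divisor bound only through `K`.
  set K' := 10000 + 50 * C' + 120 * K
  set K'' := cmd.factor R * K' + (11 + κ')
  refine ⟨cmd.program κ' R pr 27, 4 * κ', (2 * K'' : ℕ), fun n hn A hA hcard x hx => ?_⟩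
  obtain ⟨B, hB, hB'⟩ := exists_root (n := n) hg1
  have hB1 : 1 ≤ B := by
    by_contra h
    rw [show B = 0 by omega, zero_add, one_pow] at hB'
    omega
  obtain ⟨D, hD1, hDK, hD⟩ := hK n B hB1 hB'
  have hBn : B ≤ n := (Nat.le_self_pow (by omega) B).trans hB
  have hsn : B ^ J ≤ n := (Nat.pow_le_pow_right hB1 (by omega)).trans hB
  have hs1 : 1 ≤ B ^ J := Nat.one_le_pow _ _ hB1
  have hxm : ∀ j < n, x (j + 1) ∈ A := fun j hj =>
    hx.mapsTo (Set.mem_Icc.2 ⟨by omega, by omega⟩)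
  have hAx : A = (Finset.range n).image fun j => x (j + 1) := by
    ext a
    simp only [Finset.mem_image, Finset.mem_range]
    constructor
    · intro ha
      obtain ⟨i, hi, rfl⟩ := hx.surjOn ha
      rw [Set.mem_Icc] at hi
      exact ⟨i - 1, by omega, by rw [Nat.sub_add_cancel hi.1]⟩
    · rintro ⟨j, hj, rfl⟩
      exact hxm j hj
  have hinj : ∀ i < n, ∀ j < n, x (i + 1) = x (j + 1) → i = j := by
    intro i hi j hj h
    have := hx.injOn (Set.mem_Icc.2 ⟨by omega, by omega⟩) (Set.mem_Icc.2 ⟨by omega, by omega⟩) h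
    omega
  have hxU : ∀ j < n, 1 ≤ x (j + 1) ∧ x (j + 1) ≤ n ^ c := fun j hj =>
    Finset.mem_Icc.1 (hA (hxm j hj))
  have hnc : 1 ≤ n ^ c := Nat.one_le_pow _ _ hn
  have big := fun i j (h : i + j < κ') => lt_modulus (κ := κ') (i := i) (j := j) hn h
  have hncN := big 2 c (by omega)
  have hruns := solveCmd_spec (N := modulus κ' n) (κ := κ) (pr := pr) (X := x) (C := C') hJ hg hn hB
    hB' hAx hinj (fun j hj => (hxU j hj).1) (fun j hj => (hxU j hj).2) hD1 hDK hD
    (fun i j h => big i j (by omega)) (by omega) (pow_wordLength_le hsn (by omega))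
    (fun Y hY => by
      obtain ⟨t, st, h1, h2, h3⟩ := horc (8 * B ^ J) (by omega) Y hY
      exact ⟨t, st, h1, Nat.le_floor h2, h3⟩) (oracle_time_le hε hJε hB1)
  obtain ⟨t, st, hex, ht, hout⟩ := Cmd.program_spec (κ := κ') (R := R) (T := K' * n ^ 2 / B)
    (Q := fun r => r = 1 ↔ ∃ a ∈ A, ∃ b ∈ A, ∃ c ∈ A, a + b = c) (by omega) (by omega) (by omega)
    hn (by simpa using big 0 1 (by omega)) (fun i h1 h2 => by
      have := (hxU (i - 1) (by omega)).2
      rw [Nat.sub_add_cancel h1] at this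
      omega) (by
      have := big cmd.top 0 (by omega)
      rw [pow_zero, mul_one] at this
      exact Nat.lt_two_pow_self.trans this)
    (hruns.mono fun t σ _ h => ⟨(Nat.le_div_iff_mul_le hB1).2 (by rw [mul_comm]; exact h.1), h.2⟩)
  refine ⟨t, st, hex, le_rpow_of_mul_le hg1 hn hB1 hB' ?_, hout⟩
  have hlog : Nat.log 2 n ≤ n := Nat.log_le_self 2 n
  calc B * t ≤ B * (cmd.factor R * (K' * n ^ 2 / B) + (11 + κ') * n) := by
        refine Nat.mul_le_mul_left _ (ht.trans (Nat.add_le_add_left ?_ _))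
        have : κ' ≤ κ' * n := Nat.le_mul_of_pos_right _ hn
        rw [add_mul]
        omega
    _ = cmd.factor R * (K' * n ^ 2 / B * B) + (11 + κ') * (B * n) := by ring
    _ ≤ cmd.factor R * (K' * n ^ 2) + (11 + κ') * (n * n) := by
        exact Nat.add_le_add (Nat.mul_le_mul_left _ (Nat.div_mul_le_self _ _))
          (Nat.mul_le_mul_left _ (Nat.mul_le_mul_right _ hBn))
    _ = K'' * n ^ 2 := by ring
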